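/- Call a graph *Helly* if every family of pairwise intersecting balls $N^r[v]=\{u : \mathrm{dist}(u,v)\le r\}$ has a nonempty common intersection, and call a pair $(u,v)$ of vertices *diametral* if $\mathrm{dist}(u,v)=\mathrm{diam}(G)$. **Theorem 2.7.** A diametral pair of a connected Helly graph with $n$ vertices and $m$ edges, together with its diameter, can be computed with high probability in $\tilde{O}(m\sqrt n)$ time. That is: for every constant $c\in\mathbb{N}$ there are a randomized RAM algorithm and constants $C\in\mathbb{R}$, $d\in\mathbb{N}$ such that, for every connected Helly graph $G$ with vertex set $\{0,\dots,n-1\}$ and $m$ edges, and every adjacency-list representation of $G$ given as input, with probability at least $1-n^{-c}$ over the random bits of the algorithm, it halts after at most $C\,m\sqrt n\,(\log n)^d$ steps and outputs a diametral pair of $G$ and the number $\mathrm{diam}(G)$. Here the RAM has finitely many registers and finitely many random-access arrays, holding natural numbers and initially zero apart from the input (the number $n$, and an array of neighbours with the offsets of the lists). Each of the following takes one step: assigning a constant, copying a register, adding $1$, subtracting $1$ (truncated at $0$), reading or writing an array cell whose index is in a register, comparing two registers, drawing a fair random bit (independent of the others), and doing nothing. -/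

import Mathlib

/-! ### Helly graphs -/

/-- The ball `N^r[v]` of radius `r` and center `v` in the graph `G`. -/
def graphBall {V : Type*} (G : SimpleGraph V) (v : V) (r : ℕ) : Set V :=
  {u | G.edist v u ≤ (r : ℕ∞)}

/-- A graph is Helly if every family of pairwise intersecting balls has a nonempty common
intersection. A family of balls is given by a set of pairs (center, radius). -/
def IsHellyGraph {V : Type*} (G : SimpleGraph V) : Prop :=
  ∀ F : Set (V × ℕ),
    (∀ p ∈ F, ∀ q ∈ F, (graphBall G p.1 p.2 ∩ graphBall G q.1 q.2).Nonempty) →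
      (⋂ p ∈ F, graphBall G p.1 p.2).Nonempty

/-! ### A randomized random-access machine with unit-cost steps

A machine has registers and arrays, indexed by natural numbers; registers and array cells hold
natural numbers. A program is a finite text, so it names only finitely many registers and arrays,
but each array has random access, through an index held in a register. The only arithmetic
operations are successor and predecessor. Hence after `t` steps every number in memory exceeds
the largest number of the input and of the program text by at most `t`. In particular, a
computation of polynomially many steps only handles numbers of `O(log n)` bits, and every step is
one of the constant-time instructions of the usual word RAM with words of `O(log n)` bits.
The instruction `flip` draws one fair random bit. -/

namespace RandRAM

/-- Comparison of the contents of two registers. -/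
inductive Test : Type
  | lt (x y : ℕ)
  | le (x y : ℕ)
  | eq (x y : ℕ)
  | ne (x y : ℕ)

/-- Programs. In the comments, `x`, `y` are (names of) registers, `a` is (the name of) an array. -/
inductive Prog : Type
  /-- do nothing -/
  | skip
  /-- `x := k` for a constant `k` -/
  | const (x k : ℕ)
  /-- `x := y` -/
  | copy (x y : ℕ)
  /-- `x := y + 1` -/
  | succ (x y : ℕ)
  /-- `x := max (y - 1) 0` -/
  | pred (x y : ℕ)
  /-- `x := a[y]` -/
  | load (x a y : ℕ)
  /-- `a[x] := y` -/
  | store (a x y : ℕ)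
  /-- `x :=` a fair random bit -/
  | flip (x : ℕ)
  /-- `P; Q` -/
  | seq (P Q : Prog)
  /-- `if b then P else Q` -/
  | ite (b : Test) (P Q : Prog)
  /-- `while b do P` -/
  | loop (b : Test) (P : Prog)

/-- A configuration: contents of the registers, contents of the arrays, and the sequence of the
random bits that have not been drawn yet. -/
structure State : Type where
  reg : ℕ → ℕ
  arr : ℕ → ℕ → ℕ
  coins : ℕ → Bool

/-- `s.setReg x k` is `s` after the assignment `x := k`. -/
def State.setReg (s : State) (x k : ℕ) : State :=
  { s with reg := Function.update s.reg x k }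

/-- `s.setArr a i k` is `s` after the assignment `a[i] := k`. -/
def State.setArr (s : State) (a i k : ℕ) : State :=
  { s with arr := Function.update s.arr a (Function.update (s.arr a) i k) }

/-- The truth value of a test. -/
def Test.Holds (s : State) : Test → Prop
  | .lt x y => s.reg x < s.reg y
  | .le x y => s.reg x ≤ s.reg y
  | .eq x y => s.reg x = s.reg y
  | .ne x y => s.reg x ≠ s.reg y

/-- `Exec P s t s₁`: started in the configuration `s`, the program `P` halts after exactly `t`
steps, in the configuration `s₁`. Every basic instruction and every evaluation of a test is
one step. -/
inductive Exec : Prog → State → ℕ → State → Prop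
  | skip (s : State) : Exec .skip s 1 s
  | const (s : State) (x k : ℕ) : Exec (.const x k) s 1 (s.setReg x k)
  | copy (s : State) (x y : ℕ) : Exec (.copy x y) s 1 (s.setReg x (s.reg y))
  | succ (s : State) (x y : ℕ) : Exec (.succ x y) s 1 (s.setReg x (s.reg y + 1))
  | pred (s : State) (x y : ℕ) : Exec (.pred x y) s 1 (s.setReg x (s.reg y - 1))
  | load (s : State) (x a y : ℕ) : Exec (.load x a y) s 1 (s.setReg x (s.arr a (s.reg y)))
  | store (s : State) (a x y : ℕ) : Exec (.store a x y) s 1 (s.setArr a (s.reg x) (s.reg y))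
  | flip (s : State) (x : ℕ) :
      Exec (.flip x) s 1
        { s.setReg x (s.coins 0).toNat with coins := fun i => s.coins (i + 1) }
  | seq {P Q : Prog} {s s₁ s₂ : State} {t₁ t₂ : ℕ}
      (h₁ : Exec P s t₁ s₁) (h₂ : Exec Q s₁ t₂ s₂) : Exec (.seq P Q) s (t₁ + t₂) s₂
  | ite_true {b : Test} {P Q : Prog} {s s₁ : State} {t : ℕ}
      (hb : b.Holds s) (h : Exec P s t s₁) : Exec (.ite b P Q) s (t + 1) s₁
  | ite_false {b : Test} {P Q : Prog} {s s₁ : State} {t : ℕ}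
      (hb : ¬ b.Holds s) (h : Exec Q s t s₁) : Exec (.ite b P Q) s (t + 1) s₁
  | loop_true {b : Test} {P : Prog} {s s₁ s₂ : State} {t₁ t₂ : ℕ}
      (hb : b.Holds s) (h₁ : Exec P s t₁ s₁) (h₂ : Exec (.loop b P) s₁ t₂ s₂) :
      Exec (.loop b P) s (t₁ + t₂ + 1) s₂
  | loop_false {b : Test} {P : Prog} {s : State}
      (hb : ¬ b.Holds s) : Exec (.loop b P) s 1 s

/-- The law of an infinite sequence of independent fair random bits. -/
noncomputable def coinMeasure : MeasureTheory.Measure (ℕ → Bool) :=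
  MeasureTheory.Measure.infinitePi fun _ => (PMF.uniformOfFintype Bool).toMeasure

/-- The arrays `off` and `adj` are an adjacency-list representation of the graph `G` with vertices
`0, …, n - 1`: the neighbours of the vertex `v` are listed, in any order and without repetition, in
the cells of `adj` with indices `off v ≤ i < off (v + 1)`. All the other cells are `0`. -/
structure IsAdjacencyLists {n : ℕ} (G : SimpleGraph (Fin n)) (off adj : ℕ → ℕ) : Prop where
  off_zero : off 0 = 0
  off_le : ∀ v < n, off v ≤ off (v + 1)
  off_eq_zero : ∀ v > n, off v = 0
  bijOn : ∀ v : Fin n,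
    Set.BijOn adj (Set.Ico (off v) (off (v + 1))) {x | ∃ w : Fin n, G.Adj v w ∧ (w : ℕ) = x}
  adj_eq_zero : ∀ i ≥ off n, adj i = 0

/-- The initial configuration: register `0` holds the number `n` of vertices, the arrays `0` and `1`
hold the adjacency lists, all the rest of the memory is `0`, and `ω` is the sequence of the random
bits that the computation will draw. -/
def initialState (n : ℕ) (off adj : ℕ → ℕ) (ω : ℕ → Bool) : State where
  reg := Function.update (fun _ => 0) 0 n
  arr := Function.update (Function.update (fun _ _ => 0) 0 off) 1 adj
  coins := ω

/-- The output in the configuration `s` is correct for `G`: the registers `0` and `1` hold a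
diametral pair of `G`, i.e. two vertices whose distance is the diameter of `G`, and the register
`2` holds the diameter. -/
def State.HoldsDiametralPair {n : ℕ} (s : State) (G : SimpleGraph (Fin n)) : Prop :=
  (∃ u v : Fin n, s.reg 0 = u ∧ s.reg 1 = v ∧ G.dist u v = G.diam) ∧ s.reg 2 = G.diam

end RandRAM

/-! The program draws no random bit. It finds a diametral pair deterministically in `O(m √n)` steps,
so the success probability is one and the logarithmic factor is not needed.

In a connected graph two balls meet exactly when the distance of their centres is at most the sum of
their radii. The Helly property therefore says that pairwise compatible upper bounds on distances
can be met by one vertex (`IsHellyGraph.exists_forall_dist_le`), and each structural fact below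
applies this to a suitable family of balls. It is enough to find a vertex of largest eccentricity,
since one breadth-first search from it yields the pair. Let `r` be the radius and `L` about `√(2n)`.
Two candidates are tried: one is right if `r ≤ 3L + 2`, the other if `r ≥ 3L + 3`.

Small radius. The center is computed exactly. For a radius `j`, keep disjoint nonempty cores, each
the intersection of the balls of radius `j` around some set of vertices, so that every vertex is
used as a centre of a ball. By the Helly property the closed neighbourhood of a core is the
intersection of the balls of radius `j + 1` around the same vertices (`IsHellyGraph.exists_near`).
Growing all cores and intersecting those that meet takes linear time, because the cores are
disjoint. At `j = r` a central vertex lies in every core, so one core remains and it is the center.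
A vertex farthest from the center has the largest eccentricity
(`IsHellyGraph.dist_le_vertexEcc_of_center`).

Large radius. A greedy net of at most `L` vertices contains a vertex `z` of eccentricity at most `r
+ L`. Among `L + 1` consecutive layers around `z`, one has at most `L` vertices. Searches from these
give for every `v` beyond that layer the estimate `min (ecc x + dist x v)`, which is never below
`ecc v`. If `ecc y ≤ 2r - p` with `p ≤ 2`, there is a central vertex near `z` at distance at most `r
- p` from `y`; a shortest path between the two crosses the layer, so the estimate is at most `2r -
p` as well. As the largest eccentricity is `2r - 1` or `2r`, a vertex that maximizes the estimate
attains it (`IsHellyGraph.dist_le_vertexEcc_of_layer`).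

Both parts use `O(L)` computations of linear cost. -/

namespace RandRAM

-- Rules for correctness and running time of programs

infixr:60 ";;" => Prog.seq

/-- The registers that a program may write. -/
def Prog.regs : Prog → List ℕ
  | .skip => []
  | .const x _ => [x]
  | .copy x _ => [x]
  | .succ x _ => [x]
  | .pred x _ => [x]
  | .load x _ _ => [x]
  | .store _ _ _ => []
  | .flip x => [x]
  | .seq P Q => P.regs ++ Q.regs
  | .ite _ P Q => P.regs ++ Q.regs
  | .loop _ P => P.regs

/-- The arrays that a program may write. -/
def Prog.arrs : Prog → List ℕ
  | .store a _ _ => [a]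
  | .seq P Q => P.arrs ++ Q.arrs
  | .ite _ P Q => P.arrs ++ Q.arrs
  | .loop _ P => P.arrs
  | _ => []

/-- `s'` agrees with `s` on all the memory that `P` cannot write. -/
def Frame (P : Prog) (s s' : State) : Prop :=
  (∀ x, x ∉ P.regs → s'.reg x = s.reg x) ∧ ∀ a, a ∉ P.arrs → s'.arr a = s.arr a

theorem Frame.refl (P : Prog) (s : State) : Frame P s s := ⟨fun _ _ => rfl, fun _ _ => rfl⟩

theorem Frame.trans {P : Prog} {s s₁ s₂ : State} (h : Frame P s s₁) (h' : Frame P s₁ s₂) :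
    Frame P s s₂ :=
  ⟨fun x hx => (h'.1 x hx).trans (h.1 x hx), fun a ha => (h'.2 a ha).trans (h.2 a ha)⟩

theorem Frame.mono {P Q : Prog} {s s' : State} (h : Frame P s s')
    (hr : ∀ x ∈ P.regs, x ∈ Q.regs) (ha : ∀ a ∈ P.arrs, a ∈ Q.arrs) : Frame Q s s' :=
  ⟨fun x hx => h.1 x fun h' => hx (hr x h'), fun a hx => h.2 a fun h' => hx (ha a h')⟩

@[simp] theorem setReg_reg (s : State) (x k y : ℕ) :
    (s.setReg x k).reg y = if y = x then k else s.reg y := by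
  simp [State.setReg, Function.update_apply]

@[simp] theorem setReg_arr (s : State) (x k : ℕ) : (s.setReg x k).arr = s.arr := rfl

@[simp] theorem setArr_reg (s : State) (a i k : ℕ) : (s.setArr a i k).reg = s.reg := rfl

@[simp] theorem setArr_arr (s : State) (a i k b : ℕ) :
    (s.setArr a i k).arr b = if b = a then Function.update (s.arr a) i k else s.arr b := by
  simp [State.setArr, Function.update_apply]

/-- The written registers and arrays are read off the program text, so for a concrete program the
invariance of any other cell is settled by `decide`. -/
theorem Exec.frame {P : Prog} {s s' : State} {t : ℕ} (h : Exec P s t s') : Frame P s s' := by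
  induction h with
  | skip s => exact Frame.refl _ _
  | const s x k => exact ⟨fun y hy => by simp_all [Prog.regs], fun _ _ => rfl⟩
  | copy s x k => exact ⟨fun y hy => by simp_all [Prog.regs], fun _ _ => rfl⟩
  | succ s x k => exact ⟨fun y hy => by simp_all [Prog.regs], fun _ _ => rfl⟩
  | pred s x k => exact ⟨fun y hy => by simp_all [Prog.regs], fun _ _ => rfl⟩
  | load s x a y => exact ⟨fun y hy => by simp_all [Prog.regs], fun _ _ => rfl⟩
  | store s a x y => exact ⟨fun _ _ => rfl, fun b hb => by simp_all [Prog.arrs]⟩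
  | flip s x =>
    refine ⟨fun y hy => ?_, fun _ _ => rfl⟩
    have : y ≠ x := by simpa [Prog.regs] using hy
    simp [State.setReg, this]
  | seq _ _ ih₁ ih₂ =>
    exact (ih₁.mono (by simp +contextual [Prog.regs]) (by simp +contextual [Prog.arrs])).trans
      (ih₂.mono (by simp +contextual [Prog.regs]) (by simp +contextual [Prog.arrs]))
  | ite_true _ _ ih =>
    exact ih.mono (by simp +contextual [Prog.regs]) (by simp +contextual [Prog.arrs])
  | ite_false _ _ ih =>
    exact ih.mono (by simp +contextual [Prog.regs]) (by simp +contextual [Prog.arrs])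
  | loop_true _ _ _ ih₁ ih₂ => exact Frame.trans ih₁ ih₂
  | loop_false _ => exact Frame.refl _ _

/-- Started in `s`, the program `P` halts in a configuration `s'` after `t` steps with `Q s' t`. -/
def Runs (P : Prog) (s : State) (Q : State → ℕ → Prop) : Prop :=
  ∃ t s', Exec P s t s' ∧ Q s' t

theorem Runs.mono {P : Prog} {s : State} {Q R : State → ℕ → Prop} (h : Runs P s Q)
    (hQR : ∀ s' t, Frame P s s' → Q s' t → R s' t) : Runs P s R := by
  obtain ⟨t, s', he, hq⟩ := h
  exact ⟨t, s', he, hQR s' t he.frame hq⟩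

theorem Runs.seq {P P' : Prog} {s : State} {Q R : State → ℕ → Prop} (h : Runs P s Q)
    (h' : ∀ s₁ t₁, Frame P s s₁ → Q s₁ t₁ → Runs P' s₁ fun s₂ t₂ => R s₂ (t₁ + t₂)) :
    Runs (P;;P') s R := by
  obtain ⟨t, s', he, hq⟩ := h
  obtain ⟨t₂, s₂, he₂, hr⟩ := h' s' t he.frame hq
  exact ⟨_, _, .seq he he₂, hr⟩

/-- This and the equivalences that follow compute weakest preconditions; rewriting with them
executes straight-line code symbolically, including the step count. -/
theorem runs_seq {P P' : Prog} {s : State} {R : State → ℕ → Prop} :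
    Runs (P;;P') s R ↔ Runs P s fun s₁ t₁ => Runs P' s₁ fun s₂ t₂ => R s₂ (t₁ + t₂) := by
  constructor
  · rintro ⟨t, s', he, hr⟩
    cases he with
    | seq h₁ h₂ => exact ⟨_, _, h₁, _, _, h₂, hr⟩
  · rintro ⟨t, s', he, t₂, s₂, he₂, hr⟩
    exact ⟨_, _, .seq he he₂, hr⟩

theorem runs_skip {s : State} {R : State → ℕ → Prop} : Runs .skip s R ↔ R s 1 :=
  ⟨by rintro ⟨t, s', he, hr⟩; cases he; exact hr, fun h => ⟨_, _, .skip s, h⟩⟩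

theorem runs_const {s : State} {R : State → ℕ → Prop} {x k : ℕ} :
    Runs (.const x k) s R ↔ R (s.setReg x k) 1 :=
  ⟨by rintro ⟨t, s', he, hr⟩; cases he; exact hr, fun h => ⟨_, _, .const s x k, h⟩⟩

theorem runs_copy {s : State} {R : State → ℕ → Prop} {x y : ℕ} :
    Runs (.copy x y) s R ↔ R (s.setReg x (s.reg y)) 1 :=
  ⟨by rintro ⟨t, s', he, hr⟩; cases he; exact hr, fun h => ⟨_, _, .copy s x y, h⟩⟩

theorem runs_succ {s : State} {R : State → ℕ → Prop} {x y : ℕ} :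
    Runs (.succ x y) s R ↔ R (s.setReg x (s.reg y + 1)) 1 :=
  ⟨by rintro ⟨t, s', he, hr⟩; cases he; exact hr, fun h => ⟨_, _, .succ s x y, h⟩⟩

theorem runs_pred {s : State} {R : State → ℕ → Prop} {x y : ℕ} :
    Runs (.pred x y) s R ↔ R (s.setReg x (s.reg y - 1)) 1 :=
  ⟨by rintro ⟨t, s', he, hr⟩; cases he; exact hr, fun h => ⟨_, _, .pred s x y, h⟩⟩

theorem runs_load {s : State} {R : State → ℕ → Prop} {x a y : ℕ} :
    Runs (.load x a y) s R ↔ R (s.setReg x (s.arr a (s.reg y))) 1 :=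
  ⟨by rintro ⟨t, s', he, hr⟩; cases he; exact hr, fun h => ⟨_, _, .load s x a y, h⟩⟩

theorem runs_store {s : State} {R : State → ℕ → Prop} {a x y : ℕ} :
    Runs (.store a x y) s R ↔ R (s.setArr a (s.reg x) (s.reg y)) 1 :=
  ⟨by rintro ⟨t, s', he, hr⟩; cases he; exact hr, fun h => ⟨_, _, .store s a x y, h⟩⟩

theorem runs_ite {s : State} {R : State → ℕ → Prop} {b : Test} {P Q : Prog} :
    Runs (.ite b P Q) s R ↔ (b.Holds s → Runs P s fun s' t => R s' (t + 1)) ∧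
      (¬ b.Holds s → Runs Q s fun s' t => R s' (t + 1)) := by
  constructor
  · rintro ⟨t, s', he, hr⟩
    cases he with
    | ite_true hb h => exact ⟨fun _ => ⟨_, _, h, hr⟩, fun hn => absurd hb hn⟩
    | ite_false hb h => exact ⟨fun hn => absurd hn hb, fun _ => ⟨_, _, h, hr⟩⟩
  · rintro ⟨h₁, h₂⟩
    by_cases hb : b.Holds s
    · obtain ⟨t, s', he, hr⟩ := h₁ hb
      exact ⟨_, _, .ite_true hb he, hr⟩
    · obtain ⟨t, s', he, hr⟩ := h₂ hb
      exact ⟨_, _, .ite_false hb he, hr⟩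

/-- The rule for loops: `I s e` is the invariant, where `e` is the number of steps so far, and `μ`
bounds the number of iterations. -/
theorem runs_loop {b : Test} {P : Prog} {s : State} (I : State → ℕ → Prop) (μ : State → ℕ)
    (h0 : I s 0)
    (step : ∀ s' e, Frame (.loop b P) s s' → I s' e → b.Holds s' →
      Runs P s' fun s'' t => I s'' (e + t + 1) ∧ μ s'' < μ s') :
    Runs (.loop b P) s fun s' t => ∃ e, t = e + 1 ∧ I s' e ∧ ¬ b.Holds s' := by
  suffices H : ∀ N s' e, μ s' < N → Frame (.loop b P) s s' → I s' e →
      Runs (.loop b P) s' fun s'' t => ∃ e', e + t = e' + 1 ∧ I s'' e' ∧ ¬ b.Holds s'' by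
    simpa using H _ s 0 (Nat.lt_succ_self _) (Frame.refl _ _) h0
  intro N
  induction N with
  | zero => intro s' e h; omega
  | succ N ih =>
    intro s' e hN hf hI
    by_cases hb : b.Holds s'
    · obtain ⟨t, s₁, he, hI₁, hlt⟩ := step s' e hf hI hb
      obtain ⟨t₂, s₂, he₂, e', heq, hI₂, hnb⟩ :=
        ih s₁ (e + t + 1) (by omega) (hf.trans he.frame) hI₁
      exact ⟨_, _, .loop_true hb he he₂, e', by omega, hI₂, hnb⟩
    · exact ⟨_, _, .loop_false hb, e, rfl, hI, hb⟩

/-- `for i := 0 to lim - 1 do P` -/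
def Prog.forUp (i lim : ℕ) (P : Prog) : Prog :=
  .const i 0;;.loop (.lt i lim) (P;;.succ i i)

/-- The invariant carries the index and the elapsed time. The initial `1` pays for the assignment to
`i`, the `2` in each round for the test and the increment, and the final `1` for the failing test.
-/
theorem runs_forUp {i lim N : ℕ} {P : Prog} {s : State} (I : ℕ → State → ℕ → Prop)
    (hN : s.reg lim = N) (hi : i ∉ P.regs) (hlim : lim ∉ (Prog.forUp i lim P).regs)
    (h0 : I 0 (s.setReg i 0) 1)
    (step : ∀ k s' e, k < N → s'.reg i = k → Frame (.forUp i lim P) s s' → I k s' e →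
      Runs P s' fun s'' t => I (k + 1) (s''.setReg i (k + 1)) (e + t + 2)) :
    Runs (.forUp i lim P) s fun s' t => ∃ e, t = e + 1 ∧ I N s' e := by
  have hil : lim ≠ i := by
    rintro rfl
    exact hlim (by simp [Prog.forUp, Prog.regs])
  rw [Prog.forUp, runs_seq, runs_const]
  refine (runs_loop (fun s' e => s'.reg i ≤ N ∧ Frame (.forUp i lim P) s s' ∧
    I (s'.reg i) s' (e + 1)) (fun s' => N - s'.reg i) ?_ ?_).mono ?_
  · refine ⟨by simp, ⟨fun x hx => ?_, fun _ _ => rfl⟩, by simpa using h0⟩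
    have : x ≠ i := by
      rintro rfl
      exact hx (by simp [Prog.forUp, Prog.regs])
    simp [this]
  · rintro s' e - ⟨-, hf, hI⟩ hb
    have hlt : s'.reg i < N := by
      have := hf.1 lim hlim
      rw [hN] at this
      simpa [Test.Holds, this] using hb
    refine (step _ s' _ hlt rfl hf hI).seq ?_
    intro s₁ t₁ hf₁ hI₁
    rw [runs_succ]
    have hi₁ : s₁.reg i = s'.reg i := hf₁.1 i hi
    refine ⟨⟨by simp; omega, hf.trans ⟨fun x hx => ?_, fun a ha => ?_⟩, ?_⟩, by simp; omega⟩
    · have h1 : x ≠ i := by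
        rintro rfl
        exact hx (by simp [Prog.forUp, Prog.regs])
      simp only [setReg_reg, h1, if_false]
      exact hf₁.1 x fun h => hx (by simp [Prog.forUp, Prog.regs, h])
    · simp only [setReg_arr]
      exact hf₁.2 a fun h => ha (by simp [Prog.forUp, Prog.arrs, h])
    · simp only [setReg_reg, if_true, hi₁]
      convert hI₁ using 1
      omega
  · rintro s' t - ⟨e, rfl, ⟨hle, hf, hI⟩, hb⟩
    have hN' : s'.reg i = N := by
      have := hf.1 lim hlim
      rw [hN] at this
      have h2 : ¬ s'.reg i < N := by simpa [Test.Holds, this] using hb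
      omega
    rw [hN'] at hI
    exact ⟨_, by omega, hI⟩

/-- For the vertex `u` in the register `u`, let `w` run through its neighbours and do `P`. -/
def Prog.forNb (u k e w : ℕ) (P : Prog) : Prog :=
  .load k 0 u;;.succ e u;;.load e 0 e;;.loop (.lt k e) (.load w 1 k;;P;;.succ k k)

/-- The initial `3` pays for finding the two ends of the list, and the `3` in each round for the
test, the load of the neighbour and the increment. The state `s₀` is the one before this load, where
the invariant is known. -/
theorem runs_forNb {u k e w : ℕ} {P : Prog} {s : State} (I : ℕ → State → ℕ → Prop)
    (hle : s.arr 0 (s.reg u) ≤ s.arr 0 (s.reg u + 1))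
    (hk : k ∉ P.regs) (he : e ∉ P.regs) (hke : k ≠ e) (hwk : w ≠ k) (hwe : w ≠ e) (hku : k ≠ u)
    (ha1 : 1 ∉ P.arrs)
    (h0 : ∀ s', Frame (.forNb u k e w P) s s' → s'.arr = s.arr →
      (∀ x, x ≠ k → x ≠ e → s'.reg x = s.reg x) → I (s.arr 0 (s.reg u)) s' 3)
    (step : ∀ i s' t', s.arr 0 (s.reg u) ≤ i → i < s.arr 0 (s.reg u + 1) → s'.reg k = i →
      s'.reg w = s.arr 1 i → Frame (.forNb u k e w P) s s' →
      (∃ s₀, I i s₀ t' ∧ s' = s₀.setReg w (s.arr 1 i)) →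
      Runs P s' fun s'' t => I (i + 1) (s''.setReg k (i + 1)) (t' + t + 3)) :
    Runs (.forNb u k e w P) s fun s' t =>
      ∃ e, t = e + 1 ∧ I (s.arr 0 (s.reg u + 1)) s' e := by
  have mem_k : k ∈ (Prog.forNb u k e w P).regs := by simp [Prog.forNb, Prog.regs]
  have mem_e : e ∈ (Prog.forNb u k e w P).regs := by simp [Prog.forNb, Prog.regs]
  have mem_w : w ∈ (Prog.forNb u k e w P).regs := by simp [Prog.forNb, Prog.regs]
  have mem_P : ∀ x ∈ P.regs, x ∈ (Prog.forNb u k e w P).regs := by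
    intro x hx; simp [Prog.forNb, Prog.regs, hx]
  have arrs_eq : (Prog.forNb u k e w P).arrs = P.arrs := by simp [Prog.forNb, Prog.arrs]
  rw [Prog.forNb]
  simp only [runs_seq, runs_load, runs_succ, setReg_reg, setReg_arr, if_true, hku.symm, if_false]
  set s₀ := (((s.setReg k (s.arr 0 (s.reg u))).setReg e (s.reg u + 1)).setReg e
    (s.arr 0 (s.reg u + 1))) with hs₀
  have f₀ : Frame (.forNb u k e w P) s s₀ := by
    refine ⟨fun x hx => ?_, fun _ _ => rfl⟩
    have h1 : x ≠ k := by rintro rfl; exact hx mem_k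
    have h2 : x ≠ e := by rintro rfl; exact hx mem_e
    simp [hs₀, h1, h2]
  refine (runs_loop (fun s' t => s'.reg k ≤ s.arr 0 (s.reg u + 1) ∧ s.arr 0 (s.reg u) ≤ s'.reg k ∧
    s'.reg e = s.arr 0 (s.reg u + 1) ∧ Frame (.forNb u k e w P) s s' ∧
    I (s'.reg k) s' (t + 3)) (fun s' => s.arr 0 (s.reg u + 1) - s'.reg k) ?_ ?_).mono ?_
  · have : s₀.reg k = s.arr 0 (s.reg u) := by simp [hs₀, hke]
    refine ⟨by rw [this]; exact hle, this.ge, by simp [hs₀], f₀, ?_⟩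
    rw [this]
    refine h0 _ f₀ rfl ?_
    intro x h1 h2
    simp [hs₀, h1, h2]
  · rintro s' t - ⟨-, h1, h2, hf, hI⟩ hb
    have hlt : s'.reg k < s.arr 0 (s.reg u + 1) := by simpa [Test.Holds, h2] using hb
    have hadj : s'.arr 1 = s.arr 1 := hf.2 1 (by rwa [arrs_eq])
    rw [runs_seq, runs_load, hadj]
    set s₁ := s'.setReg w (s.arr 1 (s'.reg k)) with hs₁
    have f₁ : Frame (.forNb u k e w P) s s₁ := by
      refine ⟨fun x hx => ?_, fun a h => by rw [hs₁, setReg_arr]; exact hf.2 a h⟩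
      have h1 : x ≠ w := by rintro rfl; exact hx mem_w
      simp only [hs₁, setReg_reg, h1, if_false]
      exact hf.1 x hx
    refine (step (s'.reg k) s₁ _ h1 hlt (by simp [hs₁, hwk.symm]) (by simp [hs₁]) f₁
      ⟨s', hI, rfl⟩).seq ?_
    intro s₂ t₂ hf₂ hI₂
    rw [runs_succ]
    have hk₂ : s₂.reg k = s'.reg k := by rw [hf₂.1 k hk]; simp [hs₁, hwk.symm]
    have he₂ : s₂.reg e = s'.reg e := by rw [hf₂.1 e he]; simp [hs₁, hwe.symm]
    have f₂ := f₁.trans (hf₂.mono (Q := .forNb u k e w P) mem_P (by rw [arrs_eq]; simp))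
    refine ⟨⟨by simp; omega, by simp; omega, by simp [hke.symm, he₂, h2],
      ⟨fun x hx => ?_, fun a h => f₂.2 a h⟩, ?_⟩, by simp; omega⟩
    · have h1 : x ≠ k := by rintro rfl; exact hx mem_k
      simp only [setReg_reg, h1, if_false]
      exact f₂.1 x hx
    · simp only [setReg_reg, if_true, hk₂]
      convert hI₂ using 1
      omega
  · rintro s' t - ⟨t', rfl, ⟨h1, h2, h3, hf, hI⟩, hb⟩
    have : s'.reg k = s.arr 0 (s.reg u + 1) := by
      have : ¬ s'.reg k < s.arr 0 (s.reg u + 1) := by simpa [Test.Holds, h3] using hb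
      omega
    rw [this] at hI
    exact ⟨_, by omega, hI⟩

end RandRAM

/-! ### Breadth-first search -/

namespace RandRAM

/-- Adjacency arrays of some graph with vertices `0, …, n - 1`. -/
structure AdjArrays (n : ℕ) (off adj : ℕ → ℕ) : Prop where
  off_zero : off 0 = 0
  off_le : ∀ u < n, off u ≤ off (u + 1)
  adj_lt : ∀ u < n, ∀ l, off u ≤ l → l < off (u + 1) → adj l < n

/-- `ρ` behaves like the distance to the set of its zeros. -/
structure IsLevel (n : ℕ) (off adj ρ : ℕ → ℕ) : Prop where
  lip : ∀ u < n, ∀ l, off u ≤ l → l < off (u + 1) → ρ (adj l) ≤ ρ u + 1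
  pred : ∀ v < n, 0 < ρ v → ∃ u < n, ∃ l, off u ≤ l ∧ l < off (u + 1) ∧ adj l = v ∧ ρ u + 1 = ρ v

theorem AdjArrays.sum_deg {n : ℕ} {off adj : ℕ → ℕ} (hA : AdjArrays n off adj) :
    ∑ v ∈ Finset.range n, (off (v + 1) - off v) = off n := by
  have : ∀ k ≤ n, ∑ v ∈ Finset.range k, (off (v + 1) - off v) = off k := by
    intro k
    induction k with
    | zero => intro _; simp [hA.off_zero]
    | succ k ih =>
      intro hk
      rw [Finset.sum_range_succ, ih (by omega)]
      have := hA.off_le k (by omega)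
      omega
  exact this n le_rfl

/-- Amortization over the queue: with `f = 1` it bounds the length of the queue, with `f` the degree
it bounds the number of scanned adjacency entries. -/
theorem sum_comp_le_of_inj {n m : ℕ} {Q : ℕ → ℕ} (hlt : ∀ i < m, Q i < n)
    (hinj : ∀ i < m, ∀ j < m, Q i = Q j → i = j) (f : ℕ → ℕ) :
    ∑ i ∈ Finset.range m, f (Q i) ≤ ∑ v ∈ Finset.range n, f v := by
  have hinj' : Set.InjOn Q (Finset.range m) := by
    intro i hi j hj
    exact hinj i (by simpa using hi) j (by simpa using hj)
  rw [← Finset.sum_image hinj']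
  apply Finset.sum_le_sum_of_subset
  intro v hv
  obtain ⟨i, hi, rfl⟩ := Finset.mem_image.1 hv
  simpa using hlt i (by simpa using hi)

/-- The state of a breadth-first search: `D` holds the labels, the vertices `Q 0, …, Q (m - 1)` have
been visited, the first `h` of them have been processed, and the vertex `Q h` has been processed up
to the index `k` in the adjacency array. -/
structure BfsInv (n : ℕ) (off adj ρ : ℕ → ℕ) (lam : ℕ) (D Q : ℕ → ℕ) (m h k : ℕ) : Prop where
  h_le : h ≤ m
  pos : 0 < m
  lt : ∀ i < m, Q i < n
  lab : ∀ i < m, D (Q i) = lam + ρ (Q i)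
  inj : ∀ i < m, ∀ j < m, Q i = Q j → i = j
  vis : ∀ v < n, D v ≠ 0 → ∃ i < m, Q i = v
  mono : ∀ i j, i ≤ j → j < m → ρ (Q i) ≤ ρ (Q j)
  top : h < m → ∀ i < m, ρ (Q i) ≤ ρ (Q h) + 1
  proc : ∀ i < h, ∀ l, off (Q i) ≤ l → l < off (Q i + 1) → D (adj l) ≠ 0
  part : h < m → ∀ l, off (Q h) ≤ l → l < k → D (adj l) ≠ 0
  src : ∀ v < n, ρ v = 0 → D v ≠ 0

section Bfs

variable {n : ℕ} {off adj ρ : ℕ → ℕ} {lam : ℕ} {D Q : ℕ → ℕ} {m h k : ℕ}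

/-- Follow a predecessor `u` of `v`, one level lower. If `u` is unvisited, induct on the level.
Otherwise `u` is in the queue but not yet processed, since processed vertices have only labelled
neighbours; as the queue is sorted by level, the head is no higher than `u`. -/
theorem BfsInv.unvisited (hI : BfsInv n off adj ρ lam D Q m h k) (hρ : IsLevel n off adj ρ) :
    ∀ v < n, D v = 0 → h < m ∧ ρ (Q h) < ρ v := by
  intro v
  induction hv : ρ v using Nat.strong_induction_on generalizing v with
  | _ r ih =>
    intro hvn hD
    have h0 : 0 < ρ v := by
      by_contra h0
      exact hI.src v hvn (by omega) hD
    obtain ⟨u, hu, l, hl₁, hl₂, hl₃, hl₄⟩ := hρ.pred v hvn h0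
    by_cases hDu : D u = 0
    · have := ih (ρ u) (by omega) u rfl hu hDu
      exact ⟨this.1, by omega⟩
    · obtain ⟨i, hi, rfl⟩ := hI.vis u hu hDu
      have hih : h ≤ i := by
        by_contra hlt
        exact hI.proc i (by omega) l hl₁ hl₂ (by rwa [hl₃])
      have := hI.mono h i hih hi
      exact ⟨by omega, by omega⟩

theorem BfsInv.old (hI : BfsInv n off adj ρ lam D Q m h k) (hk : D (adj k) ≠ 0) :
    BfsInv n off adj ρ lam D Q m h (k + 1) :=
  { hI with
    part := fun hm l h₁ h₂ => by
      rcases Nat.lt_succ_iff_lt_or_eq.1 h₂ with h | rfl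
      · exact hI.part hm l h₁ h
      · exact hk }

/-- The level of the new vertex is forced: it is at most one more than that of the head along the
edge, and larger than that of the head because the vertex was unvisited. Hence its label is right
and appending it keeps the queue sorted. -/
theorem BfsInv.new (hI : BfsInv n off adj ρ lam D Q m h k) (hρ : IsLevel n off adj ρ)
    (hA : AdjArrays n off adj) (hm : h < m) (h₁ : off (Q h) ≤ k) (h₂ : k < off (Q h + 1))
    (hk : D (adj k) = 0) :
    BfsInv n off adj ρ lam (Function.update D (adj k) (D (Q h) + 1)) (Function.update Q m (adj k))
      (m + 1) h (k + 1) := by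
  set w := adj k with hw
  have hwn : w < n := hA.adj_lt _ (hI.lt h hm) k h₁ h₂
  have hρw : ρ w = ρ (Q h) + 1 := by
    have e₁ := hρ.lip _ (hI.lt h hm) k h₁ h₂
    rw [← hw] at e₁
    have e₂ := hI.unvisited hρ w hwn hk
    omega
  have hQw : ∀ i < m, Q i ≠ w := by
    intro i hi hiw
    have := hI.lab i hi
    have h3 := hI.unvisited hρ w hwn hk
    rw [hiw, hk] at this
    omega
  have hQ : ∀ i < m, Function.update Q m w i = Q i := fun i hi => by
    simp [(show i ≠ m by omega)]
  have hQm : Function.update Q m w m = w := by simp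
  have hDne : ∀ v, D v ≠ 0 → Function.update D w (D (Q h) + 1) v ≠ 0 := by
    intro v hv
    by_cases hvw : v = w <;> simp [hvw, hv]
  refine ⟨by omega, by omega, ?_, ?_, ?_, ?_, ?_, ?_, ?_, ?_, ?_⟩
  · intro i hi
    rcases Nat.lt_succ_iff_lt_or_eq.1 hi with hi | rfl
    · rw [hQ i hi]; exact hI.lt i hi
    · rwa [hQm]
  · intro i hi
    rcases Nat.lt_succ_iff_lt_or_eq.1 hi with hi | rfl
    · rw [hQ i hi, Function.update_apply, if_neg (hQw i hi)]; exact hI.lab i hi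
    · rw [hQm, Function.update_self, hI.lab h hm, hρw]; omega
  · intro i hi j hj hij
    rcases Nat.lt_succ_iff_lt_or_eq.1 hi with hi | rfl <;>
      rcases Nat.lt_succ_iff_lt_or_eq.1 hj with hj | rfl
    · rw [hQ i hi, hQ j hj] at hij; exact hI.inj i hi j hj hij
    · rw [hQ i hi, hQm] at hij; exact absurd hij (hQw i hi)
    · rw [hQ j hj, hQm] at hij; exact absurd hij.symm (hQw j hj)
    · rfl
  · intro v hv hD
    by_cases hvw : v = w
    · exact ⟨m, by omega, by rw [hQm, hvw]⟩
    · rw [Function.update_apply, if_neg hvw] at hD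
      obtain ⟨i, hi, rfl⟩ := hI.vis v hv hD
      exact ⟨i, by omega, hQ i hi⟩
  · intro i j hij hj
    rcases Nat.lt_succ_iff_lt_or_eq.1 hj with hj | rfl
    · rw [hQ i (by omega), hQ j hj]; exact hI.mono i j hij hj
    · rw [hQm, hρw]
      rcases hij.lt_or_eq with hi | rfl
      · rw [hQ i hi]; exact hI.top hm i hi
      · rw [hQm, hρw]
  · intro _ i hi
    rw [hQ h hm]
    rcases Nat.lt_succ_iff_lt_or_eq.1 hi with hi | rfl
    · rw [hQ i hi]; exact hI.top hm i hi
    · rw [hQm, hρw]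
  · intro i hi l
    rw [hQ i (by omega)]
    intro h₁ h₂
    exact hDne _ (hI.proc i hi l h₁ h₂)
  · intro _ l
    rw [hQ h hm]
    intro h₁ h₂
    rcases Nat.lt_succ_iff_lt_or_eq.1 h₂ with h | rfl
    · exact hDne _ (hI.part hm l h₁ h)
    · simp [← hw]
  · intro v hv h0
    exact hDne _ (hI.src v hv h0)

theorem BfsInv.next (hI : BfsInv n off adj ρ lam D Q m h (off (Q h + 1))) (hm : h < m) :
    BfsInv n off adj ρ lam D Q m (h + 1) (off (Q (h + 1))) :=
  { hI with
    h_le := hm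
    top := fun h1 i hi => (hI.top hm i hi).trans (by
      have := hI.mono h (h + 1) (by omega) h1
      omega)
    proc := fun i hi l h₁ h₂ => by
      rcases Nat.lt_succ_iff_lt_or_eq.1 hi with hi | rfl
      · exact hI.proc i hi l h₁ h₂
      · exact hI.part hm l h₁ h₂
    part := fun _ l h₁ h₂ => by omega }

theorem BfsInv.card_le (hI : BfsInv n off adj ρ lam D Q m h k) : m ≤ n := by
  simpa using sum_comp_le_of_inj hI.lt hI.inj fun _ => 1

theorem BfsInv.sum_le (hI : BfsInv n off adj ρ lam D Q m h k) (hA : AdjArrays n off adj) :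
    ∑ i ∈ Finset.range m, (off (Q i + 1) - off (Q i)) ≤ off n :=
  (sum_comp_le_of_inj hI.lt hI.inj fun v => off (v + 1) - off v).trans hA.sum_deg.le

end Bfs

/-- The memory that all subprograms share: the input, and the constants `0` and `1`. -/
structure Env (n : ℕ) (off adj : ℕ → ℕ) (s : State) : Prop where
  reg_zero : s.reg 0 = n
  reg_three : s.reg 3 = 0
  reg_four : s.reg 4 = 1
  arr_zero : s.arr 0 = off
  arr_one : s.arr 1 = adj

theorem Env.frame {n : ℕ} {off adj : ℕ → ℕ} {s s' : State} (h : Env n off adj s) {P : Prog}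
    (hf : Frame P s s') (h0 : 0 ∉ P.regs) (h3 : 3 ∉ P.regs) (h4 : 4 ∉ P.regs) (ha0 : 0 ∉ P.arrs)
    (ha1 : 1 ∉ P.arrs) : Env n off adj s' :=
  ⟨(hf.1 _ h0).trans h.1, (hf.1 _ h3).trans h.2, (hf.1 _ h4).trans h.3, (hf.2 _ ha0).trans h.4,
    (hf.2 _ ha1).trans h.5⟩

/-- Breadth-first search from the vertices in the queue (array `3`, of length `reg 10`), whose
labels in the array `a` are positive. -/
def bfsLoop (a : ℕ) : Prog :=
  .const 9 0;;
  .loop (.lt 9 10)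
    (.load 11 3 9;;.load 16 a 11;;.succ 16 16;;
    .forNb 11 12 13 14
      (.load 15 a 14;;
        .ite (.eq 15 3) (.store a 14 16;;.store 3 10 14;;.succ 10 10) .skip);;
    .succ 9 9);;
  .pred 18 10;;.load 18 3 18;;.load 17 a 18

/-- The result of a breadth-first search with initial label `lam`: the labels are `lam + ρ v`, the
register `18` holds a vertex with the largest label, and the register `17` holds its label. -/
structure BfsPost (n : ℕ) (ρ : ℕ → ℕ) (a lam : ℕ) (s : State) : Prop where
  lab : ∀ v < n, s.arr a v = lam + ρ v
  last_lt : s.reg 18 < n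
  le_last : ∀ v < n, ρ v ≤ ρ (s.reg 18)
  last_lab : s.reg 17 = lam + ρ (s.reg 18)

/-- When the queue is exhausted no vertex can be unvisited, and by sortedness the last vertex of the
queue has the largest level. Each vertex is charged `10` steps and each adjacency entry `8`. -/
theorem runs_bfsLoop {n : ℕ} {off adj ρ : ℕ → ℕ} {lam a m : ℕ} {s : State}
    (hE : Env n off adj s) (hA : AdjArrays n off adj) (hρ : IsLevel n off adj ρ)
    (ha0 : a ≠ 0) (ha1 : a ≠ 1) (ha3 : a ≠ 3) (hm : s.reg 10 = m)
    (hI : BfsInv n off adj ρ lam (s.arr a) (s.arr 3) m 0 (off (s.arr 3 0))) :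
    Runs (bfsLoop a) s fun s' t => BfsPost n ρ a lam s' ∧ t ≤ 10 * n + 8 * off n + 10 := by
  simp only [bfsLoop, runs_seq, runs_const]
  refine (runs_loop (fun s' e => BfsInv n off adj ρ lam (s'.arr a) (s'.arr 3) (s'.reg 10) (s'.reg 9)
      (off (s'.arr 3 (s'.reg 9))) ∧
      e ≤ 10 * s'.reg 9 +
        8 * ∑ i ∈ Finset.range (s'.reg 9), (off (s'.arr 3 i + 1) - off (s'.arr 3 i)))
    (fun s' => n - s'.reg 9) ?_ ?_).mono ?_
  · simpa [hm] using hI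
  · rintro s₁ e hf ⟨hI₁, he⟩ hb
    have hlt : s₁.reg 9 < s₁.reg 10 := hb
    have hE₁ : Env n off adj s₁ := (show Env n off adj (s.setReg 9 0) from
      ⟨by simp [hE.1], by simp [hE.2], by simp [hE.3], by simp [hE.4], by simp [hE.5]⟩).frame hf
      (by simp [Prog.forNb, Prog.regs]) (by simp [Prog.forNb, Prog.regs])
      (by simp [Prog.forNb, Prog.regs])
      (by simp [Prog.forNb, Prog.arrs, ha0.symm]) (by simp [Prog.forNb, Prog.arrs, ha1.symm])
    set h := s₁.reg 9 with hh
    set m₁ := s₁.reg 10 with hm₁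
    set u := s₁.arr 3 h with hu
    have hun : u < n := hI₁.lt h hlt
    have hle := hA.off_le u hun
    have hcard := hI₁.card_le
    simp only [runs_seq, runs_load, runs_succ]
    refine (runs_forNb (fun k s' t => Env n off adj s' ∧ s'.reg 9 = h ∧ s'.reg 16 = s₁.arr a u + 1 ∧
        BfsInv n off adj ρ lam (s'.arr a) (s'.arr 3) (s'.reg 10) h k ∧
        (∀ i < m₁, s'.arr 3 i = s₁.arr 3 i) ∧ s'.arr a u = s₁.arr a u ∧ m₁ ≤ s'.reg 10 ∧
        t ≤ 3 + 8 * (k - off u)) ?_ (by simp [Prog.regs])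
        (by simp [Prog.regs]) (by decide) (by decide) (by decide) (by decide) (by simp [Prog.arrs, ha1.symm]) ?_ ?_).mono ?_
    · simpa [hE₁.4, ← hh, ← hu] using hle
    · intro s' hf' harr hreg
      simp [hE₁.4, ← hh, ← hu] at hreg ⊢
      refine ⟨⟨?_, ?_, ?_, ?_, ?_⟩, ?_, ?_, ?_, ?_, ?_, ?_⟩
      · rw [hreg 0] <;> simp [hE₁.1]
      · rw [hreg 3] <;> simp [hE₁.2]
      · rw [hreg 4] <;> simp [hE₁.3]
      · rw [harr]; simp [hE₁.4]
      · rw [harr]; simp [hE₁.5]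
      · rw [hreg 9] <;> simp [hh]
      · rw [hreg 16] <;> simp
      · rw [hreg 10 (by simp) (by simp), harr]; simpa [← hm₁] using hI₁
      · intro i hi; rw [harr]; simp
      · rw [harr]; simp
      · rw [hreg 10 (by simp) (by simp)]; simp [hm₁]
    · rintro k s' t' h₁ h₂ hk hw hf' ⟨s₀, ⟨hE₀, h9, h16, hI₀, hQ, hau, hm₀, ht₀⟩, rfl⟩
      simp [hE₁.4, hE₁.5, ← hh, ← hu] at h₁ h₂ ⊢
      have hQu : s₀.arr 3 h = u := by rw [hQ h hlt]
      simp only [runs_seq, runs_load, runs_ite, runs_store, runs_succ, runs_skip, Test.Holds]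
      constructor
      · intro hb'
        simp [hE₀.2] at hb'
        simp [ha3, Ne.symm ha3]
        refine ⟨⟨?_, ?_, ?_, ?_, ?_⟩, h9, h16, ?_, ?_, ?_, by omega, by omega⟩
        · simp [hE₀.1]
        · simp [hE₀.2]
        · simp [hE₀.3]
        · simp [hE₀.4, ha0.symm]
        · simp [hE₀.5, ha1.symm]
        · have := hI₀.new hρ hA (by omega) (by rw [hQu]; exact h₁) (by rw [hQu]; exact h₂) hb'
          rw [hQu, hau, ← h16] at this
          exact this
        · intro i hi
          rw [Function.update_apply, if_neg (by omega), hQ i hi]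
        · have : u ≠ adj k := by
            rintro h0
            rw [← h0] at hb'
            have := hI₀.lab h (by omega)
            have h3 := hI₀.unvisited hρ u hun hb'
            rw [hQu] at h3
            omega
          simp [this, hau]
      · intro hb'
        simp [hE₀.2] at hb'
        simp
        refine ⟨⟨?_, ?_, ?_, ?_, ?_⟩, h9, h16, hI₀.old hb', hQ, hau, hm₀, by omega⟩
        · simp [hE₀.1]
        · simp [hE₀.2]
        · simp [hE₀.3]
        · simp [hE₀.4]
        · simp [hE₀.5]
    · rintro s₂ t₂ hf₂ ⟨t', rfl, hE₂, h9, h16, hI₂, hQ, hau, hm₂, ht⟩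
      simp [hE₁.4, ← hh, ← hu] at ht hI₂
      have hQu : s₂.arr 3 h = u := by rw [hQ h hlt]
      rw [← hQu] at hI₂
      have hI₃ := hI₂.next (by omega)
      simp [h9]
      refine ⟨⟨hI₃, ?_⟩, by omega⟩
      rw [Finset.sum_range_succ, hQu]
      have hs : ∑ i ∈ Finset.range h, (off (s₂.arr 3 i + 1) - off (s₂.arr 3 i)) =
          ∑ i ∈ Finset.range h, (off (s₁.arr 3 i + 1) - off (s₁.arr 3 i)) := by
        refine Finset.sum_congr rfl fun i hi => ?_
        rw [hQ i (by have := Finset.mem_range.1 hi; omega)]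
      rw [hs]
      omega
  · rintro s' t hf ⟨e, rfl, ⟨hI', he⟩, hb⟩
    have hle : s'.reg 10 ≤ s'.reg 9 := by simpa [Test.Holds] using hb
    have heq : s'.reg 9 = s'.reg 10 := le_antisymm hI'.h_le hle
    have hvis : ∀ v < n, s'.arr a v ≠ 0 := by
      intro v hv h0
      have := hI'.unvisited hρ v hv h0
      omega
    have hpos := hI'.pos
    simp [runs_pred, runs_load]
    refine ⟨⟨?_, ?_, ?_, ?_⟩, ?_⟩
    · intro v hv
      obtain ⟨i, hi, rfl⟩ := hI'.vis v hv (hvis v hv)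
      exact hI'.lab i hi
    · simpa using hI'.lt _ (by omega)
    · intro v hv
      obtain ⟨i, hi, rfl⟩ := hI'.vis v hv (hvis v hv)
      simpa using hI'.mono i (s'.reg 10 - 1) (by omega) (by omega)
    · simpa using hI'.lab _ (by omega)
    · rw [heq] at he
      have h1 := hI'.card_le
      have h2 := hI'.sum_le hA
      omega

end RandRAM

/-! ### Distances in connected graphs -/

section SetDist

variable {V : Type*} {G : SimpleGraph V}

/-- The distance of `v` to the set `S`. -/
noncomputable def setDist (G : SimpleGraph V) (S : Set V) (v : V) : ℕ :=
  sInf ((fun s => G.dist s v) '' S)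

theorem setDist_le {S : Set V} {s : V} (hs : s ∈ S) (v : V) : setDist G S v ≤ G.dist s v :=
  Nat.sInf_le ⟨s, hs, rfl⟩

theorem exists_setDist_eq {S : Set V} (hS : S.Nonempty) (v : V) :
    ∃ s ∈ S, G.dist s v = setDist G S v :=
  Nat.sInf_mem (hS.image fun s => G.dist s v)

theorem setDist_singleton (s v : V) : setDist G {s} v = G.dist s v := by
  simp [setDist]

theorem setDist_eq_zero_iff (hG : G.Connected) {S : Set V} (hS : S.Nonempty) {v : V} :
    setDist G S v = 0 ↔ v ∈ S := by
  constructor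
  · intro h
    obtain ⟨s, hs, he⟩ := exists_setDist_eq (G := G) hS v
    rw [h, hG.dist_eq_zero_iff] at he
    exact he ▸ hs
  · intro h
    simpa using setDist_le (G := G) h v

theorem setDist_le_succ_of_adj (hG : G.Connected) {S : Set V} (hS : S.Nonempty) {u v : V}
    (h : G.Adj u v) : setDist G S v ≤ setDist G S u + 1 := by
  obtain ⟨s, hs, he⟩ := exists_setDist_eq (G := G) hS u
  have h1 := hG.dist_triangle (u := s) (v := u) (w := v)
  rw [SimpleGraph.dist_eq_one_iff_adj.2 h] at h1
  exact (setDist_le hs v).trans (by omega)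

/-- On a shortest path, any number up to the distance is the distance to some vertex. -/
theorem SimpleGraph.Connected.exists_dist_eq (hG : G.Connected) {u v : V} {k : ℕ}
    (hk : k ≤ G.dist u v) : ∃ x, G.dist u x = k ∧ k + G.dist x v = G.dist u v := by
  obtain ⟨p, hp⟩ := hG.exists_walk_length_eq_dist u v
  have h1 : G.dist u (p.getVert k) ≤ k := by
    have := SimpleGraph.dist_le (p.take k)
    rw [SimpleGraph.Walk.take_length] at this
    omega
  have h2 : G.dist (p.getVert k) v ≤ p.length - k := by
    have := SimpleGraph.dist_le (p.drop k)
    rwa [SimpleGraph.Walk.drop_length] at this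
  have h3 := hG.dist_triangle (u := u) (v := p.getVert k) (w := v)
  exact ⟨p.getVert k, by omega, by omega⟩

theorem exists_adj_setDist (hG : G.Connected) {S : Set V} (hS : S.Nonempty) {v : V}
    (hv : 0 < setDist G S v) : ∃ u, G.Adj u v ∧ setDist G S u + 1 = setDist G S v := by
  obtain ⟨s, hs, he⟩ := exists_setDist_eq (G := G) hS v
  obtain ⟨u, hu₁, hu₂⟩ := hG.exists_dist_eq (u := s) (v := v) (k := G.dist s v - 1) (by omega)
  have hadj : G.Adj u v := SimpleGraph.dist_eq_one_iff_adj.1 (by omega)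
  have h1 := setDist_le (G := G) hs u
  have h2 := setDist_le_succ_of_adj hG hS hadj
  exact ⟨u, hadj, by omega⟩

/-- The eccentricity of a vertex of a finite graph. -/
noncomputable def vertexEcc [Fintype V] (G : SimpleGraph V) (v : V) : ℕ :=
  Finset.univ.sup (G.dist v)

theorem dist_le_vertexEcc [Fintype V] (v w : V) : G.dist v w ≤ vertexEcc G v :=
  Finset.le_sup (f := G.dist v) (Finset.mem_univ w)

theorem vertexEcc_le_iff [Fintype V] {v : V} {k : ℕ} :
    vertexEcc G v ≤ k ↔ ∀ w, G.dist v w ≤ k := by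
  simp [vertexEcc]

theorem vertexEcc_eq [Fintype V] {v x : V} (h : ∀ w, G.dist v w ≤ G.dist v x) :
    vertexEcc G v = G.dist v x :=
  le_antisymm (vertexEcc_le_iff.2 h) (dist_le_vertexEcc v x)

/-- A set of vertices at pairwise distances larger than `L` is small. -/
theorem card_mul_le_of_pairwise_dist [Fintype V] (hG : G.Connected) {S : Finset V} {L : ℕ}
    (hS : ∀ s ∈ S, ∀ t ∈ S, s ≠ t → L < G.dist s t) (h2 : 1 < S.card) :
    S.card * (L + 1) ≤ 2 * Fintype.card V := by
  classical
  -- Balls of radius `⌊L / 2⌋` around the points of `S` are disjoint, and each contains the first `h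
  -- + 1` vertices of a shortest path towards another point of `S`.
  set h := L / 2 with hh
  let B : V → Finset V := fun s => Finset.univ.filter fun x => G.dist s x ≤ h
  have hB : ∀ s ∈ S, h + 1 ≤ (B s).card := by
    intro s hs
    obtain ⟨t, ht, hst⟩ := Finset.exists_mem_ne h2 s
    have hd := hS s hs t ht hst.symm
    have : ∀ k : Fin (h + 1), ∃ x, G.dist s x = k := fun k => by
      obtain ⟨x, hx, -⟩ := hG.exists_dist_eq (u := s) (v := t) (k := k) (by omega)
      exact ⟨x, hx⟩
    choose f hf using this
    have hinj : Function.Injective f := fun a b hab => by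
      apply Fin.ext
      rw [← hf a, ← hf b, hab]
    calc h + 1 = (Finset.univ.image f).card := by
          rw [Finset.card_image_of_injective _ hinj]; simp
      _ ≤ (B s).card := Finset.card_le_card fun x hx => by
          obtain ⟨k, -, rfl⟩ := Finset.mem_image.1 hx
          simp only [B, Finset.mem_filter, Finset.mem_univ, true_and, hf]
          omega
  have hdisj : (S : Set V).PairwiseDisjoint B := by
    intro s hs t ht hst
    rw [Function.onFun, Finset.disjoint_left]
    intro x hx hx'
    simp only [B, Finset.mem_filter, Finset.mem_univ, true_and] at hx hx'
    have h1 := hG.dist_triangle (u := s) (v := x) (w := t)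
    have h2 := hS s hs t ht hst
    rw [G.dist_comm (u := x)] at h1
    omega
  have h3 : S.card * (h + 1) ≤ Fintype.card V := by
    calc S.card * (h + 1) ≤ ∑ s ∈ S, (B s).card := by
          rw [← smul_eq_mul]; exact Finset.card_nsmul_le_sum _ _ _ hB
      _ = (S.biUnion B).card := (Finset.card_biUnion hdisj).symm
      _ ≤ Fintype.card V := Finset.card_le_univ _
  have h4 : L + 1 ≤ 2 * (h + 1) := by omega
  nlinarith

end SetDist

/-! ### Adjacency lists and distance levels -/

namespace RandRAM

/-- The distance to a set of vertices, as a function of the number of the vertex. -/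
noncomputable def levelOf {n : ℕ} (G : SimpleGraph (Fin n)) (S : Set (Fin n)) (v : ℕ) : ℕ :=
  if h : v < n then setDist G S ⟨v, h⟩ else 0

@[simp] theorem levelOf_val {n : ℕ} (G : SimpleGraph (Fin n)) (S : Set (Fin n)) (v : Fin n) :
    levelOf G S v = setDist G S v := by
  simp [levelOf]

section

variable {n : ℕ} {G : SimpleGraph (Fin n)} {off adj : ℕ → ℕ}

theorem IsAdjacencyLists.adjArrays (hL : IsAdjacencyLists G off adj) : AdjArrays n off adj where
  off_zero := hL.off_zero
  off_le := hL.off_le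
  adj_lt u hu l h₁ h₂ := by
    obtain ⟨w, -, hw⟩ := (hL.bijOn ⟨u, hu⟩).mapsTo (show l ∈ Set.Ico _ _ from ⟨h₁, h₂⟩)
    rw [← hw]; exact w.2

/-- The entries of the adjacency list of `u` are the neighbours of `u`. -/
theorem IsAdjacencyLists.adj_of_mem (hL : IsAdjacencyLists G off adj) {u : Fin n} {l : ℕ}
    (h₁ : off u ≤ l) (h₂ : l < off (u + 1)) : ∃ w : Fin n, G.Adj u w ∧ (w : ℕ) = adj l :=
  (hL.bijOn u).mapsTo (show l ∈ Set.Ico _ _ from ⟨h₁, h₂⟩)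

theorem IsAdjacencyLists.exists_mem (hL : IsAdjacencyLists G off adj) {u w : Fin n}
    (h : G.Adj u w) : ∃ l, off u ≤ l ∧ l < off (u + 1) ∧ adj l = w := by
  obtain ⟨l, hl, he⟩ := (hL.bijOn u).surjOn (show (w : ℕ) ∈ _ from ⟨w, h, rfl⟩)
  exact ⟨l, hl.1, hl.2, he⟩

theorem IsAdjacencyLists.isLevel (hL : IsAdjacencyLists G off adj) (hG : G.Connected)
    {S : Set (Fin n)} (hS : S.Nonempty) : IsLevel n off adj (levelOf G S) where
  lip u hu l h₁ h₂ := by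
    obtain ⟨w, hw, he⟩ := hL.adj_of_mem (u := ⟨u, hu⟩) h₁ h₂
    have := setDist_le_succ_of_adj hG hS hw
    rw [← he, levelOf_val]
    simpa [levelOf, hu] using this
  pred v hv h0 := by
    have h0' : 0 < setDist G S ⟨v, hv⟩ := by simpa [levelOf, hv] using h0
    obtain ⟨u, hu, he⟩ := exists_adj_setDist hG hS h0'
    obtain ⟨l, h₁, h₂, h₃⟩ := hL.exists_mem hu
    exact ⟨u, u.2, l, h₁, h₂, h₃, by rw [levelOf_val, he]; simp [levelOf, hv]⟩

theorem IsAdjacencyLists.off_eq (hL : IsAdjacencyLists G off adj) :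
    off n = 2 * G.edgeSet.ncard := by
  classical
  have hdeg : ∀ v : Fin n, off (v + 1) - off v = G.degree v := by
    intro v
    have h1 := (hL.bijOn v).ncard_eq
    have h2 : {x | ∃ w : Fin n, G.Adj v w ∧ (w : ℕ) = x} =
        ((G.neighborFinset v).map Fin.valEmbedding : Finset ℕ) := by
      ext x; simp
    rw [h2, Set.ncard_coe_finset, Finset.card_map, SimpleGraph.card_neighborFinset_eq_degree] at h1
    rw [← h1, Set.ncard_eq_toFinset_card']
    simp
  have h3 : G.edgeSet.ncard = G.edgeFinset.card := by
    rw [Set.ncard_eq_toFinset_card']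
    rfl
  rw [h3, ← G.sum_degrees_eq_twice_card_edges, ← hL.adjArrays.sum_deg, Finset.sum_range]
  exact Finset.sum_congr rfl fun v _ => hdeg v

end

end RandRAM

/-! ### Search from one vertex, and an integer square root -/

namespace RandRAM

variable {n : ℕ} {G : SimpleGraph (Fin n)} {off adj : ℕ → ℕ}

theorem BfsInv.init {ρ : ℕ → ℕ} {lam m : ℕ} {D Q : ℕ → ℕ} (hlam : 0 < lam) (hm : 0 < m)
    (hlt : ∀ i < m, Q i < n) (hz : ∀ i < m, ρ (Q i) = 0)
    (hinj : ∀ i < m, ∀ j < m, Q i = Q j → i = j) (hsrc : ∀ v < n, ρ v = 0 → ∃ i < m, Q i = v)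
    (hD : ∀ v < n, D v = if ρ v = 0 then lam else 0) :
    BfsInv n off adj ρ lam D Q m 0 (off (Q 0)) where
  h_le := Nat.zero_le _
  pos := hm
  lt := hlt
  lab i hi := by rw [hD _ (hlt i hi), if_pos (hz i hi), hz i hi]; rfl
  inj := hinj
  vis v hv h := by
    rw [hD v hv] at h
    exact hsrc v hv (by by_contra h0; exact h (if_neg h0))
  mono i j hij hj := by rw [hz i (by omega), hz j hj]
  top _ i hi := by rw [hz i hi]; omega
  proc i hi := absurd hi (Nat.not_lt_zero i)
  part _ l h₁ h₂ := by omega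
  src v hv h0 := by rw [hD v hv, if_pos h0]; omega

/-- Set the cells `0, …, n - 1` of the array `a` to zero. -/
def clear (a : ℕ) : Prog := .forUp 9 0 (.store a 9 3)

theorem runs_clear {s : State} {a : ℕ} (hn : s.reg 0 = n) (h3 : s.reg 3 = 0) :
    Runs (clear a) s fun s' t => (∀ v < n, s'.arr a v = 0) ∧ t = 3 * n + 2 := by
  refine (runs_forUp (fun k s' e => (∀ v < k, s'.arr a v = 0) ∧ e = 3 * k + 1) hn
    (by simp [Prog.regs]) (by simp [Prog.forUp, Prog.regs]) (by simp) ?_).mono ?_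
  · rintro k s' e hk h9 hf ⟨h1, h2⟩
    have h3' : s'.reg 3 = 0 := (hf.1 3 (by simp [Prog.forUp, Prog.regs])).trans h3
    simp only [runs_store, setReg_arr, setArr_arr, if_true, h9, h3']
    refine ⟨fun v hv => ?_, by omega⟩
    by_cases hvk : v = k
    · simp [hvk]
    · simpa [hvk] using h1 v (by omega)
  · rintro s' t - ⟨e, rfl, h1, h2⟩
    exact ⟨h1, by omega⟩

/-- Breadth-first search from the vertex in the register `8`, with the initial label in the
register `7`, and with labels in the array `a`. -/
def bfsFrom (a : ℕ) : Prog :=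
  clear a;;.store a 8 7;;.store 3 3 8;;.const 10 1;;bfsLoop a

theorem runs_bfsFrom {s : State} {a lam : ℕ} {u : Fin n} (hL : IsAdjacencyLists G off adj)
    (hG : G.Connected) (hE : Env n off adj s) (ha0 : a ≠ 0) (ha1 : a ≠ 1) (ha3 : a ≠ 3)
    (hu : s.reg 8 = u) (hlam : s.reg 7 = lam) (hpos : 0 < lam) :
    Runs (bfsFrom a) s fun s' t =>
      (∀ v : Fin n, s'.arr a v = lam + G.dist u v) ∧
      (∃ x : Fin n, s'.reg 18 = x ∧ s'.reg 17 = lam + G.dist u x ∧ vertexEcc G u = G.dist u x) ∧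
      t ≤ 28 * (n + off n) := by
  have hn : 0 < n := u.pos
  refine (runs_clear hE.1 hE.2).seq ?_
  rintro s₁ t₁ hf ⟨hc, rfl⟩
  have hE₁ := hE.frame hf (by simp [clear, Prog.forUp, Prog.regs])
    (by simp [clear, Prog.forUp, Prog.regs]) (by simp [clear, Prog.forUp, Prog.regs])
    (by simp [clear, Prog.forUp, Prog.arrs, ha0.symm])
    (by simp [clear, Prog.forUp, Prog.arrs, ha1.symm])
  have h8 : s₁.reg 8 = u := (hf.1 8 (by simp [clear, Prog.forUp, Prog.regs])).trans hu
  have h7 : s₁.reg 7 = lam := (hf.1 7 (by simp [clear, Prog.forUp, Prog.regs])).trans hlam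
  simp only [runs_seq, runs_store, runs_const, setArr_reg, hE₁.2, h8, h7]
  have hρ := hL.isLevel hG (Set.singleton_nonempty u)
  have hz : ∀ v < n, levelOf G {u} v = 0 ↔ v = u := by
    intro v hv
    have := setDist_eq_zero_iff hG (Set.singleton_nonempty u) (v := ⟨v, hv⟩)
    rw [← levelOf_val] at this
    simpa [Fin.ext_iff] using this
  refine (runs_bfsLoop (ρ := levelOf G {u}) (lam := lam) (m := 1) ?_ hL.adjArrays hρ ha0 ha1 ha3
    (by simp) ?_).mono ?_
  · exact ⟨by simp [hE₁.1], by simp [hE₁.2], by simp [hE₁.3], by simp [hE₁.4, ha0.symm],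
      by simp [hE₁.5, ha1.symm]⟩
  · simp [ha3, ha3.symm]
    have := BfsInv.init (n := n) (off := off) (adj := adj) (ρ := levelOf G {u}) (lam := lam) (m := 1)
      (D := Function.update (s₁.arr a) u lam) (Q := Function.update (s₁.arr 3) 0 u) hpos
      Nat.one_pos ?_ ?_ ?_ ?_ ?_
    · simpa using this
    · intro i hi
      obtain rfl : i = 0 := by omega
      simp
    · intro i hi
      obtain rfl : i = 0 := by omega
      simp [setDist_singleton]
    · intro i hi j hj _
      omega
    · intro v hv h0
      exact ⟨0, by omega, by simpa using ((hz v hv).1 h0).symm⟩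
    · intro v hv
      by_cases hvu : v = u
      · simp [hvu, setDist_singleton]
      · have : levelOf G {u} v ≠ 0 := fun h0 => hvu ((hz v hv).1 h0)
        simp [hvu, this, hc v hv]
  · rintro s' t - ⟨⟨h1, h2, h3, h4⟩, ht⟩
    have hval : ∀ v : Fin n, levelOf G {u} v = G.dist u v := fun v => by
      rw [levelOf_val, setDist_singleton]
    refine ⟨fun v => by rw [h1 v v.2, hval], ⟨⟨_, h2⟩, rfl, ?_, vertexEcc_eq fun w => ?_⟩, by omega⟩
    · rw [h4, ← hval]
    · rw [← hval, ← hval]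
      exact h3 w w.2

/-- Replace the pair in the registers `40`, `41` by a farthest pair with the vertex in the register
`8`, if the latter pair is farther apart. The register `42` holds the distance plus `1`, or `0` if
there is no pair yet. -/
def tryVertex : Prog :=
  .const 7 1;;bfsFrom 2;;.ite (.lt 42 17) (.copy 40 8;;.copy 41 18;;.copy 42 17) .skip

/-- The registers `40` and `41` hold a pair of vertices, and `42` its distance plus `1`. -/
def HoldsPair (G : SimpleGraph (Fin n)) (s : State) : Prop :=
  ∃ u v : Fin n, s.reg 40 = u ∧ s.reg 41 = v ∧ s.reg 42 = G.dist u v + 1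

/-- The stored pair is always genuine, so its distance never exceeds the diameter. Trying a wrong
vertex is harmless, and trying a vertex of largest eccentricity once is enough. -/
theorem runs_tryVertex {s : State} {u : Fin n} (hL : IsAdjacencyLists G off adj)
    (hG : G.Connected) (hE : Env n off adj s) (hu : s.reg 8 = u)
    (hs : s.reg 42 = 0 ∨ HoldsPair G s) :
    Runs tryVertex s fun s' t => HoldsPair G s' ∧ s.reg 42 ≤ s'.reg 42 ∧
      vertexEcc G u < s'.reg 42 ∧ t ≤ 33 * (n + off n) := by
  have hn : 0 < n := u.pos
  simp only [tryVertex, runs_seq, runs_const]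
  refine (runs_bfsFrom (u := u) (lam := 1) hL hG
    ⟨by simp [hE.1], by simp [hE.2], by simp [hE.3], by simp [hE.4], by simp [hE.5]⟩
    (by decide) (by decide) (by decide) (by simp [hu]) (by simp) Nat.one_pos).mono ?_
  rintro s₁ t₁ hf ⟨-, ⟨x, h18, h17, hx⟩, ht⟩
  have h8 : s₁.reg 8 = u := by rw [hf.1 8 (by decide)]; simp [hu]
  have h40 : s₁.reg 40 = s.reg 40 := by rw [hf.1 40 (by decide)]; simp
  have h41 : s₁.reg 41 = s.reg 41 := by rw [hf.1 41 (by decide)]; simp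
  have h42 : s₁.reg 42 = s.reg 42 := by rw [hf.1 42 (by decide)]; simp
  simp only [runs_ite, runs_seq, runs_copy, runs_skip, Test.Holds]
  constructor
  · intro hb
    refine ⟨⟨u, x, by simp [h8], by simp [h18], by simp [h17]; omega⟩, ?_, ?_, by omega⟩
    · simp; omega
    · simp; omega
  · intro hb
    refine ⟨?_, by omega, by omega, by omega⟩
    rcases hs with h0 | ⟨a, b, e1, e2, e3⟩
    · omega
    · exact ⟨a, b, by omega, by omega, by omega⟩

/-- Compute `L ≈ √(2 n)` in the register `5`, and `3 L + 2` in the register `6`. -/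
def root : Prog :=
  .const 4 1;;.const 5 1;;.const 6 5;;.const 23 0;;
  .forUp 21 0
    (.succ 23 23;;
      .ite (.le 5 23)
        (.succ 5 5;;.succ 6 6;;.succ 6 6;;.succ 6 6;;.const 23 0) .skip)

/-- `L` is raised each time the counter reaches `L`, so after `k` increments `k` is the triangular
number `L (L - 1) / 2` plus the counter. This avoids multiplication. -/
theorem runs_root {s : State} (hn : s.reg 0 = n) :
    Runs root s fun s' t => ∃ L, s'.reg 4 = 1 ∧ s'.reg 5 = L ∧ s'.reg 6 = 3 * L + 2 ∧ 1 ≤ L ∧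
      L * (L - 1) ≤ 2 * n ∧ 2 * n < L * (L + 1) ∧ t ≤ 9 * n + 6 := by
  simp only [root, runs_seq, runs_const]
  refine (runs_forUp (N := n) (fun k s' e => ∃ L, s'.reg 4 = 1 ∧ s'.reg 5 = L ∧ s'.reg 6 = 3 * L + 2 ∧ 1 ≤ L ∧
    s'.reg 23 < L ∧ 2 * k = L * (L - 1) + 2 * s'.reg 23 ∧ e ≤ 9 * k + 1) (by simp [hn]) (by decide)
    (by decide) ?_ ?_).mono ?_
  · exact ⟨1, by simp⟩
  · rintro k s' e hk h21 - ⟨L, h4, h5, h6, h1, h23, hk2, he⟩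
    simp only [runs_seq, runs_ite, runs_succ, runs_const, runs_skip, Test.Holds]
    obtain ⟨M, rfl⟩ : ∃ M, L = M + 1 := ⟨L - 1, by omega⟩
    simp at hk2
    constructor
    · intro hb
      simp [h5] at hb
      refine ⟨M + 2, by simp [h4], by simp [h5], by simp [h6]; omega, by omega, by simp, ?_,
        by omega⟩
      simp
      have : s'.reg 23 = M := by omega
      rw [this] at hk2
      nlinarith
    · intro hb
      simp [h5] at hb
      refine ⟨M + 1, by simp [h4], by simp [h5], by simp [h6], by omega, by simp; omega, ?_,
        by omega⟩
      simp
      omega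
  · rintro s' t - ⟨e, rfl, L, h4, h5, h6, h1, h23, hk, he⟩
    refine ⟨L, h4, h5, h6, h1, by omega, ?_, by omega⟩
    obtain ⟨M, rfl⟩ : ∃ M, L = M + 1 := ⟨L - 1, by omega⟩
    simp at hk
    nlinarith

end RandRAM

/-! ### A greedy net and an almost central vertex -/

namespace RandRAM

variable {n : ℕ} {G : SimpleGraph (Fin n)} {off adj : ℕ → ℕ}

/-- Process a vertex (in the register `21`) of the net: keep the best vertex in the register `19`,
and mark the vertices at distance less than `reg 23` in the array `4`. -/
def netVertex : Prog :=
  .copy 8 21;;.const 7 1;;bfsFrom 2;;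
  .ite (.eq 20 3) (.copy 19 8;;.copy 20 17) (.ite (.lt 17 20) (.copy 19 8;;.copy 20 17) .skip);;
  .forUp 22 0 (.load 15 2 22;;.ite (.le 15 23) (.store 4 22 4) .skip)

/-- Register `20` holds the best eccentricity plus one, so that `0` can mean that no vertex has been
examined. The labels are also distances plus one, hence the comparison with `L + 1`. -/
theorem runs_netVertex {s : State} {v : Fin n} {L : ℕ} (hL : IsAdjacencyLists G off adj)
    (hG : G.Connected) (hE : Env n off adj s) (hv : s.reg 21 = v) (h23 : s.reg 23 = L + 1) :
    Runs netVertex s fun s' t =>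
      ((s'.reg 19 = v ∧ s'.reg 20 = vertexEcc G v + 1 ∧
          (s.reg 20 = 0 ∨ vertexEcc G v + 1 ≤ s.reg 20)) ∨
        (s'.reg 19 = s.reg 19 ∧ s'.reg 20 = s.reg 20 ∧ s.reg 20 ≠ 0 ∧
          s.reg 20 ≤ vertexEcc G v + 1)) ∧
      (∀ w : Fin n, s'.arr 4 w = if G.dist v w ≤ L then 1 else s.arr 4 w) ∧
      t ≤ 45 * (n + off n) := by
  have hn : 0 < n := v.pos
  simp only [netVertex]
  rw [runs_seq, runs_copy, runs_seq, runs_const]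
  refine (runs_bfsFrom (u := v) (lam := 1) hL hG
    ⟨by simp [hE.1], by simp [hE.2], by simp [hE.3], by simp [hE.4], by simp [hE.5]⟩
    (by decide) (by decide) (by decide) (by simp [hv]) (by simp) Nat.one_pos).seq ?_
  rintro s₁ t₁ hf ⟨hlab, ⟨x, h18, h17, hx⟩, ht⟩
  have h8 : s₁.reg 8 = v := by rw [hf.1 8 (by decide)]; simp [hv]
  have h19 : s₁.reg 19 = s.reg 19 := by rw [hf.1 19 (by decide)]; simp
  have h20 : s₁.reg 20 = s.reg 20 := by rw [hf.1 20 (by decide)]; simp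
  have h3 : s₁.reg 3 = 0 := by rw [hf.1 3 (by decide)]; simp [hE.2]
  have h4 : s₁.arr 4 = s.arr 4 := by rw [hf.2 4 (by decide)]; simp
  have h0 : s₁.reg 0 = n := by rw [hf.1 0 (by decide)]; simp [hE.1]
  have hr4 : s₁.reg 4 = 1 := by rw [hf.1 4 (by decide)]; simp [hE.3]
  have h23' : s₁.reg 23 = L + 1 := by rw [hf.1 23 (by decide)]; simp [h23]
  rw [← hx] at h17
  refine Runs.seq (Q := fun s' t => ((s'.reg 19 = v ∧ s'.reg 20 = vertexEcc G v + 1 ∧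
          (s.reg 20 = 0 ∨ vertexEcc G v + 1 ≤ s.reg 20)) ∨
        (s'.reg 19 = s.reg 19 ∧ s'.reg 20 = s.reg 20 ∧ s.reg 20 ≠ 0 ∧
          s.reg 20 ≤ vertexEcc G v + 1)) ∧ t ≤ 4) ?_ ?_
  · simp only [runs_ite, runs_seq, runs_copy, runs_skip, Test.Holds]
    refine ⟨fun hb => ⟨Or.inl ?_, by omega⟩, fun hb => ⟨fun hb' => ⟨Or.inl ?_, by omega⟩,
      fun hb' => ⟨Or.inr ?_, by omega⟩⟩⟩
    · simp [h8]; omega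
    · simp [h8]; omega
    · omega
  · rintro s₂ t₂ hf₂ ⟨hbest, ht₂⟩
    have e4 : s₂.arr 4 = s.arr 4 := by rw [hf₂.2 4 (by decide), h4]
    have e2 : s₂.arr 2 = s₁.arr 2 := by rw [hf₂.2 2 (by decide)]
    have e23 : s₂.reg 23 = L + 1 := by rw [hf₂.1 23 (by decide), h23']
    have er4 : s₂.reg 4 = 1 := by rw [hf₂.1 4 (by decide), hr4]
    refine (runs_forUp (N := n) (fun k s' e =>
      (∀ w : Fin n, s'.arr 4 w = if (w : ℕ) < k ∧ G.dist v w ≤ L then 1 else s.arr 4 w) ∧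
      e ≤ 1 + 6 * k) ?_ (by decide) (by decide) ?_ ?_).mono ?_
    · rw [hf₂.1 0 (by decide), h0]
    · simp [e4]
    · rintro k s' e hk h22 hf' ⟨hI, he⟩
      have a2 : s'.arr 2 = s₁.arr 2 := by rw [hf'.2 2 (by decide), e2]
      have a23 : s'.reg 23 = L + 1 := by rw [hf'.1 23 (by decide), e23]
      have ar4 : s'.reg 4 = 1 := by rw [hf'.1 4 (by decide), er4]
      have hlab' := hlab ⟨k, hk⟩
      simp only [runs_ite, runs_seq, runs_load, runs_store, runs_skip, Test.Holds]
      simp [h22, a2, a23, ar4]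
      simp at hlab'
      constructor
      · intro hb
        refine ⟨fun w => ?_, by omega⟩
        by_cases hw : (w : ℕ) = k
        · have : w = ⟨k, hk⟩ := Fin.ext hw
          rw [if_pos ⟨by omega, by rw [this]; omega⟩, hw]
          simp
        · rw [Function.update_apply, if_neg hw, hI w]
          refine if_congr ?_ rfl rfl
          constructor <;> rintro ⟨h1, h2⟩ <;> exact ⟨by omega, h2⟩
      · intro hb
        refine ⟨fun w => ?_, by omega⟩
        rw [hI w]
        refine if_congr ?_ rfl rfl
        constructor
        · rintro ⟨h1, h2⟩
          exact ⟨by omega, h2⟩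
        · rintro ⟨h1, h2⟩
          refine ⟨?_, h2⟩
          by_contra h3
          have : w = ⟨k, hk⟩ := Fin.ext (show (w : ℕ) = k by omega)
          rw [this] at h2
          omega
    · rintro s₃ t₃ hf₃ ⟨e, rfl, hI, he⟩
      have c19 : s₃.reg 19 = s₂.reg 19 := hf₃.1 19 (by decide)
      have c20 : s₃.reg 20 = s₂.reg 20 := hf₃.1 20 (by decide)
      refine ⟨by rwa [c19, c20], fun w => ?_, by omega⟩
      rw [hI w]
      simp [w.2]

/-- Choose greedily a set of vertices at pairwise distances larger than `L = reg 5`, and store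
a vertex of it that has the smallest eccentricity in the register `19`. -/
def net : Prog :=
  .succ 23 5;;.forUp 21 0 (.load 15 4 21;;.ite (.eq 15 3) netVertex .skip)

/-- A vertex is taken into the net only if no earlier net vertex is within `L`, and otherwise it is
covered already. So the net is sparse, hence small, and every vertex, in particular a central one,
has a net vertex within `L`. -/
theorem runs_net {s : State} {L : ℕ} (hL : IsAdjacencyLists G off adj)
    (hG : G.Connected) (hE : Env n off adj s) (h5 : s.reg 5 = L) (hn : 0 < n)
    (hL1 : 1 ≤ L) (hLn : 2 * n < L * (L + 1))
    (h20 : s.reg 20 = 0) (h4 : ∀ v, s.arr 4 v = 0) :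
    Runs net s fun s' t => (∃ z : Fin n, s'.reg 19 = z ∧
      ∀ c, ∃ x, G.dist x c ≤ L ∧ vertexEcc G z ≤ vertexEcc G x) ∧
      t ≤ 60 * (L + 1) * (n + off n) := by
  rw [net, runs_seq, runs_succ]
  refine (runs_forUp (N := n) (fun k s' e => ∃ S : Finset (Fin n),
    (∀ x ∈ S, (x : ℕ) < k) ∧ (∀ x ∈ S, ∀ y ∈ S, x ≠ y → L < G.dist x y) ∧
    (∀ v : Fin n, s'.arr 4 v ≠ 0 ↔ ∃ x ∈ S, G.dist x v ≤ L) ∧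
    (∀ v : Fin n, (v : ℕ) < k → s'.arr 4 v ≠ 0) ∧
    ((S = ∅ ∧ s'.reg 20 = 0) ∨ ∃ z : Fin n, s'.reg 19 = z ∧ s'.reg 20 = vertexEcc G z + 1 ∧
      ∀ x ∈ S, vertexEcc G z ≤ vertexEcc G x) ∧
    e ≤ 2 + 5 * k + 45 * (n + off n) * S.card) ?_ (by decide) (by decide) ?_ ?_).mono ?_
  · simp [hE.1]
  · exact ⟨∅, by simp [h4, h20]⟩
  · rintro k s' e hk h21 hf ⟨S, hSk, hSd, hS4, hcov, hbest, he⟩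
    have hE' : Env n off adj s' := Env.frame (P := .forUp 21 0 _) (s := s.setReg 23 (s.reg 5 + 1))
      ⟨by simp [hE.1], by simp [hE.2], by simp [hE.3], by simp [hE.4], by simp [hE.5]⟩ hf
      (by decide) (by decide) (by decide) (by decide) (by decide)
    have h23 : s'.reg 23 = L + 1 := by rw [hf.1 23 (by decide)]; simp [h5]
    simp only [runs_ite, runs_seq, runs_load, runs_skip, Test.Holds]
    constructor
    · intro hb
      simp [h21, hE'.2] at hb
      refine (runs_netVertex (v := ⟨k, hk⟩) (L := L) hL hG
        ⟨by simp [hE'.1], by simp [hE'.2], by simp [hE'.3], by simp [hE'.4], by simp [hE'.5]⟩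
        (by simp [h21]) (by simp [h23])).mono ?_
      rintro s₂ t₂ hf₂ ⟨hb₂, h4₂, ht₂⟩
      simp at hb₂ h4₂
      have hnot : ∀ x ∈ S, L < G.dist x ⟨k, hk⟩ := by
        intro x hx
        by_contra hle
        exact (hS4 ⟨k, hk⟩).2 ⟨x, hx, by omega⟩ hb
      have hkS : (⟨k, hk⟩ : Fin n) ∉ S := fun h => absurd (hSk _ h) (lt_irrefl k)
      refine ⟨insert ⟨k, hk⟩ S, ?_, ?_, ?_, ?_, Or.inr ?_, ?_⟩
      · intro x hx
        rcases Finset.mem_insert.1 hx with rfl | hx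
        · simp
        · have := hSk x hx; omega
      · intro x hx y hy hxy
        rcases Finset.mem_insert.1 hx with rfl | hx <;>
          rcases Finset.mem_insert.1 hy with rfl | hy
        · exact absurd rfl hxy
        · rw [G.dist_comm]; exact hnot y hy
        · exact hnot x hx
        · exact hSd x hx y hy hxy
      · intro v
        simp only [setReg_arr, h4₂]
        by_cases hd : G.dist ⟨k, hk⟩ v ≤ L
        · simp [hd]
        · simp only [hd, if_false, hS4, Finset.mem_insert, exists_eq_or_imp, false_or]
      · intro v hv
        simp only [setReg_arr, h4₂]
        by_cases hvk : (v : ℕ) = k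
        · have : v = ⟨k, hk⟩ := Fin.ext hvk
          simp [this]
        · have := hcov v (by omega)
          split_ifs <;> simp [this]
      · rcases hb₂ with ⟨e1, e2, e3⟩ | ⟨e1, e2, e3, e4⟩
        · refine ⟨⟨k, hk⟩, by simp [e1], by simp [e2], ?_⟩
          intro x hx
          rcases Finset.mem_insert.1 hx with rfl | hx
          · exact le_rfl
          · rcases hbest with ⟨rfl, -⟩ | ⟨z, -, f2, f3⟩
            · simp at hx
            · have := f3 x hx
              omega
        · rcases hbest with ⟨-, f⟩ | ⟨z, f1, f2, f3⟩
          · exact absurd f e3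
          · refine ⟨z, by simp [e1, f1], by simp [e2, f2], ?_⟩
            intro x hx
            rcases Finset.mem_insert.1 hx with rfl | hx
            · omega
            · exact f3 x hx
      · rw [Finset.card_insert_of_notMem hkS]
        nlinarith
    · intro hb
      simp [h21, hE'.2] at hb
      refine ⟨S, fun x hx => (hSk x hx).trans (by omega), hSd, hS4, ?_, by simpa using hbest,
        by omega⟩
      intro v hv
      by_cases hvk : (v : ℕ) = k
      · simpa [hvk] using hb
      · exact hcov v (by omega)
  · rintro s' t - ⟨e, rfl, S, hSk, hSd, hS4, hcov, hbest, he⟩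
    -- Packing gives `S.card * (L + 1) ≤ 2 * n < L * (L + 1)`; a net with at most one vertex is
    -- covered by `1 ≤ L`.
    have hcard : S.card ≤ L := by
      rcases Nat.lt_or_ge 1 S.card with h | h
      · have := card_mul_le_of_pairwise_dist hG hSd h
        rw [Fintype.card_fin] at this
        nlinarith
      · omega
    refine ⟨?_, ?_⟩
    · rcases hbest with ⟨rfl, -⟩ | ⟨z, f1, -, f3⟩
      · have := (hS4 ⟨0, hn⟩).1 (hcov ⟨0, hn⟩ hn)
        simp at this
      · refine ⟨z, f1, fun c => ?_⟩
        obtain ⟨x, hx, hd⟩ := (hS4 c).1 (hcov c c.2)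
        exact ⟨x, hd, f3 x hx⟩
    · have h1 : 45 * (n + off n) * S.card ≤ 45 * (n + off n) * L := Nat.mul_le_mul_left _ hcard
      nlinarith [Nat.zero_le (off n)]

end RandRAM

/-! ### Estimates of eccentricities through a small layer -/

namespace RandRAM

variable {n : ℕ} {G : SimpleGraph (Fin n)} {off adj : ℕ → ℕ}

/-- The vertices at distance `j` from `z`. -/
noncomputable def layer (G : SimpleGraph (Fin n)) (z : Fin n) (j : ℕ) : Finset (Fin n) :=
  Finset.univ.filter fun v => G.dist z v = j

theorem mem_layer {z v : Fin n} {j : ℕ} : v ∈ layer G z j ↔ G.dist z v = j := by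
  simp [layer]

/-- Store the distances from the vertex in the register `19`, plus `1`, in the array `5`, and the
sizes of the layers in the array `6`. -/
def layerCount : Prog :=
  .copy 8 19;;.const 7 1;;bfsFrom 5;;
  .forUp 21 0 (.load 15 5 21;;.load 16 6 15;;.succ 16 16;;.store 6 15 16)

theorem runs_layerCount {s : State} {z : Fin n} (hL : IsAdjacencyLists G off adj)
    (hG : G.Connected) (hE : Env n off adj s) (hz : s.reg 19 = z) (h6 : ∀ i, s.arr 6 i = 0) :
    Runs layerCount s fun s' t => (∀ v : Fin n, s'.arr 5 v = G.dist z v + 1) ∧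
      (∀ j, s'.arr 6 (j + 1) = (layer G z j).card) ∧ t ≤ 40 * (n + off n) := by
  have hn : 0 < n := z.pos
  simp only [layerCount]
  rw [runs_seq, runs_copy, runs_seq, runs_const]
  refine (runs_bfsFrom (u := z) (lam := 1) hL hG
    ⟨by simp [hE.1], by simp [hE.2], by simp [hE.3], by simp [hE.4], by simp [hE.5]⟩
    (by decide) (by decide) (by decide) (by simp [hz]) (by simp) Nat.one_pos).seq ?_
  rintro s₁ t₁ hf ⟨hlab, -, ht⟩
  have e6 : ∀ i, s₁.arr 6 i = 0 := by rw [hf.2 6 (by decide)]; exact h6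
  have e0 : s₁.reg 0 = n := by rw [hf.1 0 (by decide)]; simp [hE.1]
  refine (runs_forUp (N := n) (fun k s' e =>
    (∀ j, s'.arr 6 (j + 1) = ((layer G z j).filter fun v : Fin n => (v : ℕ) < k).card) ∧
    e ≤ 1 + 6 * k) e0 (by decide) (by decide) ?_ ?_).mono ?_
  · simp [e6]
  · rintro k s' e hk h21 hf' ⟨hI, he⟩
    have a5 : s'.arr 5 k = G.dist z ⟨k, hk⟩ + 1 := by
      rw [hf'.2 5 (by decide)]
      exact (hlab ⟨k, hk⟩).trans (add_comm _ _)
    simp only [runs_seq, runs_load, runs_store, runs_succ]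
    simp [h21, a5]
    refine ⟨fun j => ?_, by omega⟩
    rw [hI]
    by_cases hj : j = G.dist z ⟨k, hk⟩
    · have : (layer G z j).filter (fun v : Fin n => (v : ℕ) ≤ k) =
          insert ⟨k, hk⟩ ((layer G z j).filter fun v : Fin n => (v : ℕ) < k) := by
        ext v
        simp only [Finset.mem_filter, Finset.mem_insert, mem_layer, Fin.ext_iff]
        constructor
        · rintro ⟨h1, h2⟩
          by_cases hvk : (v : ℕ) = k
          · exact Or.inl hvk
          · exact Or.inr ⟨h1, by omega⟩
        · rintro (h1 | ⟨h1, h2⟩)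
          · have : v = ⟨k, hk⟩ := Fin.ext h1
            exact ⟨by rw [this, hj], by omega⟩
          · exact ⟨h1, by omega⟩
      rw [this, Finset.card_insert_of_notMem (by simp), hj]
      simp
    · rw [Function.update_apply, if_neg (by omega), hI]
      congr 1
      apply Finset.filter_congr
      intro v hv
      rw [mem_layer] at hv
      constructor
      · intro h; omega
      · intro h
        by_contra h'
        have : v = ⟨k, hk⟩ := Fin.ext (show (v : ℕ) = k by omega)
        rw [this] at hv
        exact hj hv.symm
  · rintro s₂ t₂ hf₂ ⟨e, rfl, hI, he⟩
    refine ⟨fun v => ?_, fun j => ?_, by omega⟩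
    · rw [hf₂.2 5 (by decide), hlab, add_comm]
    · rw [hI]
      congr 1
      exact Finset.filter_true_of_mem fun v _ => v.2

/-- Store in the register `25` the number `j + 1` for a small layer with index `j > L + 1`. -/
def layerFind : Prog :=
  .copy 25 5;;.succ 25 25;;.succ 25 25;;.succ 25 25;;.load 15 6 25;;
  .loop (.lt 5 15) (.succ 25 25;;.load 15 6 25)

/-- The layers are disjoint, so `L + 1` of them with more than `L` vertices each would exceed `n`;
the scan stops within the indices `L + 2, …, 2 L + 2`. The layer found may be empty. -/
theorem runs_layerFind {s : State} {z : Fin n} {L : ℕ} (h5 : s.reg 5 = L)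
    (hLn : n < (L + 1) * (L + 1)) (h6 : ∀ j, s.arr 6 (j + 1) = (layer G z j).card) :
    Runs layerFind s fun s' t => (∃ j, s'.reg 25 = j + 1 ∧ L + 2 ≤ j ∧ j ≤ 2 * L + 2 ∧
      (layer G z j).card ≤ L) ∧ t ≤ 3 * L + 6 := by
  simp only [layerFind, runs_seq, runs_copy, runs_succ, runs_load]
  refine (runs_loop (fun s' e => ∃ i, i ≤ L ∧ s'.reg 25 = L + 3 + i ∧ s'.reg 5 = L ∧
    s'.reg 15 = (layer G z (L + 2 + i)).card ∧ s'.arr 6 = s.arr 6 ∧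
    (∀ i' < i, L < (layer G z (L + 2 + i')).card) ∧ e ≤ 3 * i)
    (fun s' => 2 * L + 3 - s'.reg 25) ?_ ?_).mono ?_
  · refine ⟨0, by simp [h5, ← h6]⟩
  · rintro s' e - ⟨i, hi, e25, e5, e15, e6, hI, he⟩ hb
    have hlt : L < (layer G z (L + 2 + i)).card := by
      simpa [Test.Holds, e5, e15] using hb
    have hI' : ∀ i' ∈ Finset.range (i + 1), L + 1 ≤ (layer G z (L + 2 + i')).card := by
      intro i' hi'
      rcases Nat.lt_succ_iff_lt_or_eq.1 (Finset.mem_range.1 hi') with h | rfl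
      · exact hI i' h
      · exact hlt
    have hiL : i < L := by
      by_contra hge
      have hsum := Finset.card_nsmul_le_sum _ _ _ hI'
      have hdisj : ((Finset.range (i + 1) : Finset ℕ) : Set ℕ).PairwiseDisjoint
          fun i' => layer G z (L + 2 + i') := by
        intro a _ b _ hab
        rw [Function.onFun, Finset.disjoint_left]
        intro v hv hv'
        rw [mem_layer] at hv hv'
        omega
      have h2 := Finset.card_le_univ ((Finset.range (i + 1)).biUnion
        fun i' => layer G z (L + 2 + i'))
      rw [Finset.card_biUnion hdisj, Fintype.card_fin] at h2
      rw [Finset.card_range, smul_eq_mul] at hsum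
      have : (L + 1) * (L + 1) ≤ (i + 1) * (L + 1) := Nat.mul_le_mul_right _ (by omega)
      omega
    simp only [runs_seq, runs_succ, runs_load]
    refine ⟨⟨i + 1, hiL, by simp [e25]; omega, by simp [e5], ?_, by simp [e6], ?_, by omega⟩,
      by simp [e25]; omega⟩
    · simp [e25, e6]
      rw [← h6, show L + 3 + i + 1 = L + 2 + (i + 1) + 1 by omega]
    · intro i' hi'
      exact hI' i' (Finset.mem_range.2 hi')
  · rintro s' t - ⟨e, rfl, ⟨i, hi, e25, e5, e15, -, -, he⟩, hb⟩
    have hle : (layer G z (L + 2 + i)).card ≤ L := by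
      simpa [Test.Holds, e5, e15] using hb
    exact ⟨⟨L + 2 + i, by omega, by omega, by omega, hle⟩, by omega⟩

/-- For the vertex `x` in the register `21`, update in the array `7` the minima of
`ecc x + dist x v + 1`. -/
def layerVertex : Prog :=
  .copy 8 21;;.const 7 1;;bfsFrom 2;;.copy 7 17;;bfsFrom 2;;
  .forUp 22 0 (.load 15 2 22;;.load 16 7 22;;
    .ite (.eq 16 3) (.store 7 22 15) (.ite (.lt 15 16) (.store 7 22 15) .skip))

/-- The first search yields the eccentricity of `x`. The second one starts with this value plus one
as its label, so that its labels are the wanted sums and no addition is needed. A zero cell has no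
value yet. -/
theorem runs_layerVertex {s : State} {x : Fin n} (hL : IsAdjacencyLists G off adj)
    (hG : G.Connected) (hE : Env n off adj s) (hx : s.reg 21 = x) :
    Runs layerVertex s fun s' t =>
      (∀ v : Fin n, s'.arr 7 v ≠ 0 ∧ s'.arr 7 v ≤ vertexEcc G x + G.dist x v + 1 ∧
        (s.arr 7 v ≠ 0 → s'.arr 7 v ≤ s.arr 7 v) ∧
        (s'.arr 7 v = s.arr 7 v ∨ s'.arr 7 v = vertexEcc G x + G.dist x v + 1)) ∧
      t ≤ 80 * (n + off n) := by
  have hn : 0 < n := x.pos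
  simp only [layerVertex]
  rw [runs_seq, runs_copy, runs_seq, runs_const]
  have hE₀ : Env n off adj ((s.setReg 8 (s.reg 21)).setReg 7 1) :=
    ⟨by simp [hE.1], by simp [hE.2], by simp [hE.3], by simp [hE.4], by simp [hE.5]⟩
  refine (runs_bfsFrom (u := x) (lam := 1) hL hG hE₀
    (by decide) (by decide) (by decide) (by simp [hx]) (by simp) Nat.one_pos).seq ?_
  rintro s₁ t₁ hf ⟨-, ⟨y, h18, h17, hy⟩, ht⟩
  have hE₁ := hE₀.frame hf (by decide) (by decide) (by decide) (by decide) (by decide)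
  have h8 : s₁.reg 8 = x := by rw [hf.1 8 (by decide)]; simp [hx]
  have h7 : s₁.arr 7 = s.arr 7 := by rw [hf.2 7 (by decide)]; simp
  rw [runs_seq, runs_copy]
  have hE₁' : Env n off adj (s₁.setReg 7 (s₁.reg 17)) :=
    ⟨by simp [hE₁.1], by simp [hE₁.2], by simp [hE₁.3], by simp [hE₁.4], by simp [hE₁.5]⟩
  refine (runs_bfsFrom (u := x) (lam := 1 + vertexEcc G x) hL hG hE₁'
    (by decide) (by decide) (by decide) (by simp [h8]) (by simp [h17, hy]) (by omega)).seq ?_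
  rintro s₂ t₂ hf₂ ⟨hlab, -, ht₂⟩
  have hE₂ := hE₁'.frame hf₂ (by decide) (by decide) (by decide) (by decide) (by decide)
  have h7₂ : s₂.arr 7 = s.arr 7 := by rw [hf₂.2 7 (by decide)]; simp [h7]
  refine (runs_forUp (N := n) (fun k s' e =>
    (∀ v : Fin n, (v : ℕ) < k →
      s'.arr 7 v ≠ 0 ∧ s'.arr 7 v ≤ vertexEcc G x + G.dist x v + 1 ∧
        (s.arr 7 v ≠ 0 → s'.arr 7 v ≤ s.arr 7 v) ∧
        (s'.arr 7 v = s.arr 7 v ∨ s'.arr 7 v = vertexEcc G x + G.dist x v + 1)) ∧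
    (∀ v : Fin n, k ≤ (v : ℕ) → s'.arr 7 v = s.arr 7 v) ∧
    e ≤ 1 + 8 * k) hE₂.1 (by decide) (by decide) ?_ ?_).mono ?_
  · simp [h7₂]
  · rintro k s' e hk h22 hf' ⟨hI, hI', he⟩
    have a2 : s'.arr 2 k = vertexEcc G x + G.dist x ⟨k, hk⟩ + 1 := by
      rw [hf'.2 2 (by decide)]
      have := hlab ⟨k, hk⟩
      simp at this
      omega
    have a3 : s'.reg 3 = 0 := by rw [hf'.1 3 (by decide), hE₂.2]
    have a7 : s'.arr 7 k = s.arr 7 k := hI' ⟨k, hk⟩ le_rfl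
    have key : ∀ A : ℕ → ℕ, (∀ i, i ≠ k → A i = s'.arr 7 i) →
        (A k ≠ 0 ∧ A k ≤ vertexEcc G x + G.dist x ⟨k, hk⟩ + 1 ∧
          (s.arr 7 k ≠ 0 → A k ≤ s.arr 7 k) ∧
          (A k = s.arr 7 k ∨ A k = vertexEcc G x + G.dist x ⟨k, hk⟩ + 1)) →
        (∀ v : Fin n, (v : ℕ) ≤ k →
          A v ≠ 0 ∧ A v ≤ vertexEcc G x + G.dist x v + 1 ∧ (s.arr 7 v ≠ 0 → A v ≤ s.arr 7 v) ∧
            (A v = s.arr 7 v ∨ A v = vertexEcc G x + G.dist x v + 1)) ∧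
        (∀ v : Fin n, k < (v : ℕ) → A v = s.arr 7 v) := by
      intro A hA hk'
      refine ⟨fun v hv => ?_, fun v hv => ?_⟩
      · by_cases hvk : (v : ℕ) = k
        · obtain rfl : v = ⟨k, hk⟩ := Fin.ext hvk
          exact hk'
        · rw [hA v hvk]
          exact hI v (by omega)
      · rw [hA v (by omega)]
        exact hI' v (by omega)
    simp only [runs_seq, runs_load, runs_store, runs_ite, runs_skip, Test.Holds]
    simp [h22, a2, a3, a7]
    refine ⟨fun hb => ?_, fun hb => ⟨fun hb' => ?_, fun hb' => ?_⟩⟩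
    · rw [← and_assoc]
      exact ⟨key _ (fun i hi => by simp [hi]) (by simp [hb]), by omega⟩
    · rw [← and_assoc]
      exact ⟨key _ (fun i hi => by simp [hi]) (by simp; omega), by omega⟩
    · rw [← and_assoc]
      exact ⟨key _ (fun i hi => rfl) (by rw [a7]; simp [hb]; omega), by omega⟩
  · rintro s₃ t₃ - ⟨e, rfl, hI, -, he⟩
    exact ⟨fun v => hI v v.2, by omega⟩

/-- Process all the vertices of the layer that was found. -/
def layerSearch : Prog :=
  .forUp 21 0 (.load 15 5 21;;.ite (.eq 15 25) layerVertex .skip)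

theorem runs_layerSearch {s : State} {z : Fin n} {j : ℕ} (hL : IsAdjacencyLists G off adj)
    (hG : G.Connected) (hE : Env n off adj s) (h25 : s.reg 25 = j + 1)
    (h5 : ∀ v : Fin n, s.arr 5 v = G.dist z v + 1) (h7 : ∀ v, s.arr 7 v = 0) :
    Runs layerSearch s fun s' t =>
      (∀ v : Fin n, (∀ x ∈ layer G z j, s'.arr 7 v ≠ 0 ∧
          s'.arr 7 v ≤ vertexEcc G x + G.dist x v + 1) ∧
        (s'.arr 7 v ≠ 0 → ∃ x ∈ layer G z j, s'.arr 7 v = vertexEcc G x + G.dist x v + 1)) ∧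
      t ≤ 2 + 5 * n + 80 * (n + off n) * (layer G z j).card := by
  refine (runs_forUp (N := n) (fun k s' e =>
    (∀ v : Fin n, (∀ x ∈ layer G z j, (x : ℕ) < k → s'.arr 7 v ≠ 0 ∧
          s'.arr 7 v ≤ vertexEcc G x + G.dist x v + 1) ∧
        (s'.arr 7 v ≠ 0 → ∃ x ∈ layer G z j, s'.arr 7 v = vertexEcc G x + G.dist x v + 1)) ∧
    e ≤ 1 + 5 * k + 80 * (n + off n) * ((layer G z j).filter fun v : Fin n => (v : ℕ) < k).card)
    hE.1 (by decide) (by decide) ?_ ?_).mono ?_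
  · simp [h7]
  · rintro k s' e hk h21 hf ⟨hI, he⟩
    have hE' := hE.frame hf (by decide) (by decide) (by decide) (by decide) (by decide)
    have a5 : s'.arr 5 k = G.dist z ⟨k, hk⟩ + 1 := by
      rw [hf.2 5 (by decide)]
      exact h5 ⟨k, hk⟩
    have a25 : s'.reg 25 = j + 1 := by rw [hf.1 25 (by decide), h25]
    simp only [runs_seq, runs_load, runs_ite, runs_skip, Test.Holds]
    simp [h21, a5, a25]
    constructor
    · intro hj
      refine (runs_layerVertex (x := ⟨k, hk⟩) hL hG
        ⟨by simp [hE'.1], by simp [hE'.2], by simp [hE'.3], by simp [hE'.4], by simp [hE'.5]⟩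
        (by simp [h21])).mono ?_
      rintro s₂ t₂ hf₂ ⟨h, ht₂⟩
      simp at h
      refine ⟨fun v => ⟨fun x hx hxk => ?_, fun hv => ?_⟩, ?_⟩
      · obtain ⟨h1, h2, h3, h4⟩ := h v
        by_cases hxk' : (x : ℕ) = k
        · obtain rfl : x = ⟨k, hk⟩ := Fin.ext hxk'
          exact ⟨h1, h2⟩
        · obtain ⟨g1, g2⟩ := (hI v).1 x hx (by omega)
          exact ⟨h1, (h3 g1).trans g2⟩
      · obtain ⟨h1, h2, h3, h4 | h4⟩ := h v
        · rw [h4]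
          exact (hI v).2 (by rwa [← h4])
        · exact ⟨⟨k, hk⟩, mem_layer.2 hj, h4⟩
      · have : insert (⟨k, hk⟩ : Fin n) ((layer G z j).filter fun v : Fin n => (v : ℕ) < k) ⊆
            (layer G z j).filter (fun v : Fin n => (v : ℕ) ≤ k) := by
          intro v hv
          rcases Finset.mem_insert.1 hv with rfl | hv
          · simp [mem_layer, hj]
          · rw [Finset.mem_filter] at hv ⊢
            exact ⟨hv.1, by omega⟩
        have := Finset.card_le_card this
        rw [Finset.card_insert_of_notMem (by simp)] at this
        have := Nat.mul_le_mul_left (80 * (n + off n)) this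
        rw [Nat.mul_add] at this
        omega
    · intro hj
      refine ⟨fun v => ⟨fun x hx hxk => ?_, (hI v).2⟩, ?_⟩
      · by_cases hxk' : (x : ℕ) = k
        · obtain rfl : x = ⟨k, hk⟩ := Fin.ext hxk'
          exact absurd (mem_layer.1 hx) hj
        · exact (hI v).1 x hx (by omega)
      · have : (layer G z j).filter (fun v : Fin n => (v : ℕ) < k) ⊆
            (layer G z j).filter (fun v : Fin n => (v : ℕ) ≤ k) := by
          intro v hv
          rw [Finset.mem_filter] at hv ⊢
          exact ⟨hv.1, by omega⟩
        have := Nat.mul_le_mul_left (80 * (n + off n)) (Finset.card_le_card this)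
        omega
  · rintro s' t - ⟨e, rfl, hI, he⟩
    refine ⟨fun v => ⟨fun x hx => (hI v).1 x hx x.2, (hI v).2⟩, ?_⟩
    have := Nat.mul_le_mul_left (80 * (n + off n))
      (Finset.card_filter_le (layer G z j) fun v : Fin n => (v : ℕ) < n)
    omega

/-- Store in the register `26` a vertex in or beyond the layer that maximizes the value in the
array `7`. -/
def layerMax : Prog :=
  .const 26 0;;.const 27 0;;
  .forUp 21 0 (.load 15 5 21;;
    .ite (.le 25 15)
      (.load 16 7 21;;.ite (.lt 27 16) (.copy 26 21;;.copy 27 16) .skip)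
      .skip)

theorem runs_layerMax {s : State} {z : Fin n} {j : ℕ} (h0 : s.reg 0 = n)
    (h25 : s.reg 25 = j + 1) (h5 : ∀ v : Fin n, s.arr 5 v = G.dist z v + 1) :
    Runs layerMax s fun s' t =>
      (∃ y : Fin n, s'.reg 26 = y ∧ ∀ v : Fin n, j ≤ G.dist z v → s.arr 7 v ≠ 0 →
        j ≤ G.dist z y ∧ s.arr 7 v ≤ s.arr 7 y) ∧ t ≤ 9 * n + 5 := by
  have hn : 0 < n := z.pos
  simp only [layerMax, runs_seq, runs_const]
  refine (runs_forUp (N := n) (fun k s' e =>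
    (∃ y : Fin n, s'.reg 26 = y ∧ (s'.reg 27 ≠ 0 → j ≤ G.dist z y ∧ s'.reg 27 = s.arr 7 y) ∧
      ∀ v : Fin n, (v : ℕ) < k → j ≤ G.dist z v → s.arr 7 v ≤ s'.reg 27) ∧
    e ≤ 1 + 8 * k) (by simp [h0]) (by decide) (by decide) ?_ ?_).mono ?_
  · exact ⟨⟨⟨0, hn⟩, by simp⟩, by omega⟩
  · rintro k s' e hk h21 hf ⟨⟨y, hy, hI, hI'⟩, he⟩
    have a5 : s'.arr 5 k = G.dist z ⟨k, hk⟩ + 1 := by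
      rw [hf.2 5 (by decide)]
      exact h5 ⟨k, hk⟩
    have a7 : s'.arr 7 = s.arr 7 := by rw [hf.2 7 (by decide)]; simp
    have a25 : s'.reg 25 = j + 1 := by rw [hf.1 25 (by decide)]; simp [h25]
    have key : ∀ M, s'.reg 27 ≤ M → (j ≤ G.dist z ⟨k, hk⟩ → s.arr 7 k ≤ M) →
        ∀ v : Fin n, (v : ℕ) ≤ k → j ≤ G.dist z v → s.arr 7 v ≤ M := by
      intro M hM hM' v hv hj
      by_cases hvk : (v : ℕ) = k
      · obtain rfl : v = ⟨k, hk⟩ := Fin.ext hvk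
        exact hM' hj
      · exact (hI' v (by omega) hj).trans hM
    simp only [runs_seq, runs_load, runs_copy, runs_ite, runs_skip, Test.Holds]
    simp [h21, a5, a7, a25]
    refine ⟨fun hb => ⟨fun hb' => ⟨⟨⟨k, hk⟩, rfl, fun _ => ⟨hb, rfl⟩, ?_⟩, by omega⟩,
      fun hb' => ⟨⟨y, hy, hI, ?_⟩, by omega⟩⟩, fun hb => ⟨⟨y, hy, hI, ?_⟩, by omega⟩⟩
    · exact key _ hb'.le fun _ => le_rfl
    · exact key _ le_rfl fun _ => hb'
    · exact key _ le_rfl fun h => absurd h (by omega)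
  · rintro s' t - ⟨e, rfl, ⟨y, hy, hI, hI'⟩, he⟩
    refine ⟨⟨y, hy, fun v hj hv => ?_⟩, by omega⟩
    have h1 := hI' v v.2 hj
    obtain ⟨h2, h3⟩ := hI (by omega)
    exact ⟨h2, by omega⟩

/-- Estimate the eccentricities by means of a small layer around the vertex in the register `19`,
and store a vertex with the largest estimate in the register `26`. -/
def layers : Prog := layerCount;;layerFind;;layerSearch;;layerMax

/-- The number `a` stands for the estimate of `y`. It is a lower bound for all sums at `y` through
the layer, being their minimum, and it dominates some sum at `v`, because `y` maximizes the
estimate. -/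
theorem runs_layers {s : State} {z : Fin n} {L : ℕ} (hL : IsAdjacencyLists G off adj)
    (hG : G.Connected) (hE : Env n off adj s) (h5 : s.reg 5 = L) 
    (hLn : n < (L + 1) * (L + 1)) (hz : s.reg 19 = z) (h6 : ∀ i, s.arr 6 i = 0)
    (h7 : ∀ i, s.arr 7 i = 0) (hLn' : L ≤ 2 * n) :
    Runs layers s fun s' t => (∃ (y : Fin n) (j : ℕ), s'.reg 26 = y ∧ L + 2 ≤ j ∧ j ≤ 2 * L + 2 ∧
      ∀ v, j ≤ G.dist z v → ∃ a, j ≤ G.dist z y ∧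
        (∀ x, G.dist z x = j → a ≤ vertexEcc G x + G.dist x y) ∧
        ∃ x, vertexEcc G x + G.dist x v ≤ a) ∧
      t ≤ 160 * (L + 1) * (n + off n) := by
  have hn : 0 < n := z.pos
  refine (runs_layerCount hL hG hE hz h6).seq ?_
  rintro s₁ t₁ hf₁ ⟨h5₁, h6₁, ht₁⟩
  have hE₁ := hE.frame hf₁ (by decide) (by decide) (by decide) (by decide) (by decide)
  refine (runs_layerFind (L := L) (by rw [hf₁.1 5 (by decide), h5]) hLn h6₁).seq ?_
  rintro s₂ t₂ hf₂ ⟨⟨j, h25, hj₁, hj₂, hcard⟩, ht₂⟩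
  have hE₂ := hE₁.frame hf₂ (by decide) (by decide) (by decide) (by decide) (by decide)
  have h5₂ : ∀ v : Fin n, s₂.arr 5 v = G.dist z v + 1 := by
    rw [hf₂.2 5 (by decide)]; exact h5₁
  refine (runs_layerSearch hL hG hE₂ h25 h5₂
    (by rw [hf₂.2 7 (by decide), hf₁.2 7 (by decide)]; exact h7)).seq ?_
  rintro s₃ t₃ hf₃ ⟨h7₃, ht₃⟩
  refine (runs_layerMax (z := z) (j := j) (by rw [hf₃.1 0 (by decide), hE₂.1])
    (by rw [hf₃.1 25 (by decide), h25]) (by rw [hf₃.2 5 (by decide)]; exact h5₂)).mono ?_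
  rintro s₄ t₄ - ⟨⟨y, hy, hmax⟩, ht₄⟩
  refine ⟨⟨y, j, hy, hj₁, hj₂, fun v hv => ?_⟩, ?_⟩
  -- A shortest path from `z` to `v` meets the layer, so the layer is nonempty and the estimate at
  -- `v` has been set. The cells hold estimates plus one, whence the subtraction in the witness.
  · obtain ⟨x, hx, -⟩ := hG.exists_dist_eq hv
    have hv0 := ((h7₃ v).1 x (mem_layer.2 hx)).1
    obtain ⟨h1, h2⟩ := hmax v hv hv0
    obtain ⟨x', -, hx'⟩ := (h7₃ v).2 hv0
    refine ⟨s₃.arr 7 y - 1, h1, fun x'' hx'' => ?_, x', by omega⟩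
    have := ((h7₃ y).1 x'' (mem_layer.2 hx'')).2
    omega
  · have h1 : 80 * (n + off n) * (layer G z j).card ≤ 80 * (n + off n) * L :=
      Nat.mul_le_mul_left _ hcard
    nlinarith [Nat.zero_le (off n), Nat.zero_le (L * off n)]

end RandRAM

/-! ### Growing one core and merging it into the classes -/

namespace RandRAM

variable {n : ℕ} {G : SimpleGraph (Fin n)} {off adj : ℕ → ℕ}

/-- Loops along a linked list are verified by induction on the list, for which one unfolding is more
convenient than an invariant. -/
theorem runs_loop_unfold {b : Test} {P : Prog} {s : State} {Q : State → ℕ → Prop}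
    (h₁ : b.Holds s → Runs P s fun s₁ t₁ => Runs (.loop b P) s₁ fun s₂ t₂ => Q s₂ (t₁ + t₂ + 1))
    (h₂ : ¬ b.Holds s → Q s 1) : Runs (.loop b P) s Q := by
  by_cases hb : b.Holds s
  · obtain ⟨t, s', he, t₂, s₂, he₂, hq⟩ := h₁ hb
    exact ⟨_, _, .loop_true hb he he₂, hq⟩
  · exact ⟨_, _, .loop_false hb, h₂ hb⟩

/-- The linked list with head `h` and successor function `nxt` is `l`; the vertex `z` is
represented by `z + 1`, and `0` marks the end. -/
def IsList (nxt : ℕ → ℕ) : ℕ → List (Fin n) → Prop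
  | h, [] => h = 0
  | h, z :: l => h = z + 1 ∧ IsList nxt (nxt z) l

theorem IsList.update {nxt : ℕ → ℕ} {y c : ℕ} {l : List (Fin n)} :
    ∀ {h : ℕ}, IsList nxt h l → (∀ z ∈ l, (z : ℕ) ≠ y) → IsList (Function.update nxt y c) h l := by
  induction l with
  | nil => exact fun h _ => h
  | cons z l ih =>
    rintro h ⟨h1, h2⟩ hy
    refine ⟨h1, ?_⟩
    rw [Function.update_apply, if_neg (hy z (by simp))]
    exact ih h2 fun w hw => hy w (by simp [hw])

/-- The closed neighbourhood of a set. -/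
def closedNbhd (G : SimpleGraph (Fin n)) (S : Set (Fin n)) : Set (Fin n) :=
  {v | ∃ z ∈ S, z = v ∨ G.Adj z v}

/-- With the register `14`, run through the closed neighbourhood of the linked list with head
`reg 32`, and do `P`. -/
def coreNb (P : Prog) : Prog :=
  .loop (.ne 32 3) (.pred 33 32;;.copy 14 33;;P;;.forNb 33 12 13 14 P;;.load 32 9 33)

/-- The time for a list of vertices, up to a constant factor. -/
def listCost (off : ℕ → ℕ) (l : List (Fin n)) : ℕ :=
  (l.map fun z : Fin n => off (z + 1) - off z + 1).sum

/-- The invariant depends only on the set `M` of vertices treated so far. A vertex may be met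
several times, as a neighbour of several list members, so `step` also has to hold when `v` is in `M`
already. The cost is proportional to the degrees in the list plus its length. -/
theorem runs_coreNb {P : Prog} {β : ℕ} (hL : IsAdjacencyLists G off adj)
    (I : Set (Fin n) → (ℕ → ℕ → ℕ) → ℕ → Prop)
    (hregs : ∀ x ∈ [0, 3, 4, 12, 13, 32, 33], x ∉ P.regs) (harrs : ∀ a ∈ [0, 1, 9], a ∉ P.arrs)
    (l : List (Fin n)) :
    ∀ {s : State} {M : Set (Fin n)}, Env n off adj s → IsList (s.arr 9) (s.reg 32) l →
      I M s.arr (s.reg 31) →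
      (∀ (M : Set (Fin n)) (s' : State) (v : Fin n), s'.reg 14 = v → Frame (coreNb P) s s' →
        I M s'.arr (s'.reg 31) →
        Runs P s' fun s'' t => I (insert v M) s''.arr (s''.reg 31) ∧ t ≤ β) →
      Runs (coreNb P) s fun s' t => I (M ∪ closedNbhd G {z | z ∈ l}) s'.arr (s'.reg 31) ∧
        t ≤ 1 + (β + 9) * listCost off l := by
  have r0 : 0 ∉ P.regs := hregs 0 (by simp)
  have r3 : 3 ∉ P.regs := hregs 3 (by simp)
  have r4 : 4 ∉ P.regs := hregs 4 (by simp)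
  have r12 : 12 ∉ P.regs := hregs 12 (by simp)
  have r13 : 13 ∉ P.regs := hregs 13 (by simp)
  have r33 : 33 ∉ P.regs := hregs 33 (by simp)
  have a0 : 0 ∉ P.arrs := harrs 0 (by simp)
  have a1 : 1 ∉ P.arrs := harrs 1 (by simp)
  have a9 : 9 ∉ P.arrs := harrs 9 (by simp)
  have sub_r : ∀ x ∈ P.regs, x ∈ (coreNb P).regs := by
    intro x hx; simp [coreNb, Prog.regs, hx]
  have arrs_eq : ∀ a, a ∈ (coreNb P).arrs ↔ a ∈ P.arrs := by
    intro a; simp [coreNb, Prog.arrs, Prog.forNb]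
  have sub_nb : ∀ x ∈ (Prog.forNb 33 12 13 14 P).regs, x ∈ (coreNb P).regs := by
    intro x hx
    simp only [coreNb, Prog.regs, List.mem_append]
    tauto
  have nb_arrs : ∀ a, a ∈ (Prog.forNb 33 12 13 14 P).arrs ↔ a ∈ P.arrs := by
    intro a; simp [Prog.arrs, Prog.forNb]
  have mem14 : 14 ∈ (coreNb P).regs := by simp [coreNb, Prog.regs]
  have mem33 : 33 ∈ (coreNb P).regs := by simp [coreNb, Prog.regs]
  have mem32 : 32 ∈ (coreNb P).regs := by simp [coreNb, Prog.regs]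
  induction l with
  | nil =>
    intro s M hE hl hM step
    refine runs_loop_unfold (fun hb => absurd hb ?_) fun _ => ⟨?_, by omega⟩
    · have : s.reg 32 = 0 := hl
      simp [Test.Holds, this, hE.2]
    · convert hM using 1
      simp [closedNbhd]
  | cons z l ih =>
    rintro s M hE ⟨h32, hl⟩ hM step
    refine runs_loop_unfold (fun _ => ?_) fun hb => absurd ?_ hb
    swap
    · simp [Test.Holds, h32, hE.2]
    rw [runs_seq, runs_pred, runs_seq, runs_copy]
    set s₁ := (s.setReg 33 (s.reg 32 - 1)).setReg 14 ((s.setReg 33 (s.reg 32 - 1)).reg 33) with hs₁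
    have f₁ : Frame (coreNb P) s s₁ := by
      refine ⟨fun x hx => ?_, fun _ _ => rfl⟩
      have h1 : x ≠ 14 := by rintro rfl; exact hx mem14
      have h2 : x ≠ 33 := by rintro rfl; exact hx mem33
      simp [hs₁, h1, h2]
    have hE₁ : Env n off adj s₁ :=
      ⟨by simp [hs₁, hE.1], by simp [hs₁, hE.2], by simp [hs₁, hE.3], by simp [hs₁, hE.4],
        by simp [hs₁, hE.5]⟩
    refine (step M s₁ z (by simp [hs₁, h32]) f₁ (by simpa [hs₁] using hM)).seq ?_
    rintro s₂ t₂ hf₂ ⟨hI₂, ht₂⟩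
    have f₂ : Frame (coreNb P) s s₂ :=
      f₁.trans (hf₂.mono sub_r fun a ha => (arrs_eq a).2 ha)
    have hE₂ : Env n off adj s₂ := hE₁.frame hf₂ r0 r3 r4 a0 a1
    have e33 : s₂.reg 33 = z := by rw [hf₂.1 33 r33]; simp [hs₁, h32]
    have h9 : s₂.arr 9 = s.arr 9 := by rw [hf₂.2 9 a9]; simp [hs₁]
    let N : ℕ → Set (Fin n) := fun k => insert z M ∪ {w | ∃ i, off z ≤ i ∧ i < k ∧ adj i = w}
    have hNs : N (off (z + 1)) = insert z M ∪ {w | G.Adj z w} := by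
      ext w
      simp only [N, Set.mem_union, Set.mem_ofPred_eq]
      refine or_congr Iff.rfl ⟨?_, fun h => hL.exists_mem h⟩
      rintro ⟨i, h1, h2, h3⟩
      obtain ⟨w', hw', he⟩ := hL.adj_of_mem h1 h2
      rw [h3] at he
      rwa [← Fin.ext he]
    refine Runs.seq (Q := fun s' t => I (N (off (z + 1))) s'.arr (s'.reg 31) ∧
      t ≤ 4 + (β + 3) * (off (z + 1) - off z)) ?_ ?_
    · refine (runs_forNb (fun k s' t => I (N k) s'.arr (s'.reg 31) ∧
        t ≤ 3 + (β + 3) * (k - off z)) ?_ r12 r13 (by decide) (by decide) (by decide) (by decide)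
        a1 ?_ ?_).mono ?_
      · rw [hE₂.4, e33]; exact hL.off_le z z.2
      · intro s' hf' harr hreg
        rw [hE₂.4, e33]
        refine ⟨?_, by simp⟩
        rw [harr, hreg 31 (by decide) (by decide)]
        convert hI₂ using 1
        ext w
        simp only [N, Set.mem_union, Set.mem_ofPred_eq]
        constructor
        · rintro (h | ⟨i, h1, h2, -⟩)
          · exact h
          · omega
        · exact Or.inl
      · rintro k s' t' h₁ h₂ h12 h14 hf' ⟨s₀, ⟨hI₀, ht₀⟩, rfl⟩
        rw [hE₂.4, e33] at h₁ h₂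
        obtain ⟨w, -, hw⟩ := hL.adj_of_mem h₁ h₂
        rw [hE₂.5, ← hw] at h14 hf'
        have f₃ := f₂.trans (hf'.mono sub_nb fun a ha => (arrs_eq a).2 ((nb_arrs a).1 ha))
        rw [hE₂.5, ← hw]
        refine (step (N k) _ w h14 f₃ (by simpa using hI₀)).mono ?_
        rintro s₄ t₄ - ⟨hI₄, ht₄⟩
        refine ⟨?_, ?_⟩
        · have : N (k + 1) = insert w (N k) := by
            ext x
            simp only [N, Set.mem_union, Set.mem_ofPred_eq, Set.mem_insert_iff]
            constructor
            · rintro (h | ⟨i, h1, h2, h3⟩)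
              · exact Or.inr (Or.inl h)
              · rcases Nat.lt_succ_iff_lt_or_eq.1 h2 with h2 | rfl
                · exact Or.inr (Or.inr ⟨i, h1, h2, h3⟩)
                · exact Or.inl (Fin.ext (by omega))
            · rintro (rfl | h | ⟨i, h1, h2, h3⟩)
              · exact Or.inr ⟨k, h₁, by omega, hw.symm⟩
              · exact Or.inl h
              · exact Or.inr ⟨i, h1, by omega, h3⟩
          rw [this]
          simpa using hI₄
        · rw [show k + 1 - off z = k - off z + 1 by omega, Nat.mul_succ]
          omega
      · rintro s' t - ⟨e, rfl, hI, ht⟩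
        rw [hE₂.4, e33] at ht hI
        exact ⟨hI, by omega⟩
    · rintro s₃ t₃ hf₃ ⟨hI₃, ht₃⟩
      have f₃ := f₂.trans (hf₃.mono sub_nb fun a ha => (arrs_eq a).2 ((nb_arrs a).1 ha))
      have hE₃ : Env n off adj s₃ := by
        refine hE₂.frame hf₃ ?_ ?_ ?_ ?_ ?_
        · simpa [Prog.forNb, Prog.regs] using r0
        · simpa [Prog.forNb, Prog.regs] using r3
        · simpa [Prog.forNb, Prog.regs] using r4
        · simpa [nb_arrs] using a0
        · simpa [nb_arrs] using a1
      have e33' : s₃.reg 33 = z := by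
        rw [hf₃.1 33 (by simpa [Prog.forNb, Prog.regs] using r33), e33]
      have h9' : s₃.arr 9 = s.arr 9 := by
        rw [hf₃.2 9 (by simpa [nb_arrs] using a9), h9]
      rw [runs_load, e33', h9']
      have f₄ : Frame (coreNb P) s (s₃.setReg 32 (s.arr 9 z)) := by
        refine f₃.trans ⟨fun x hx => ?_, fun _ _ => rfl⟩
        have h1 : x ≠ 32 := by rintro rfl; exact hx mem32
        simp [h1]
      refine (ih (M := N (off (z + 1)))
        ⟨by simp [hE₃.1], by simp [hE₃.2], by simp [hE₃.3], by simp [hE₃.4], by simp [hE₃.5]⟩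
        (by simpa [h9'] using hl) (by simpa using hI₃)
        (fun M' s' v hv hf' hI' => step M' s' v hv (f₄.trans hf') hI')).mono ?_
      rintro s₅ t₅ - ⟨hI₅, ht₅⟩
      refine ⟨?_, ?_⟩
      · convert hI₅ using 1
        rw [hNs]
        ext w
        simp only [closedNbhd, Set.mem_union, Set.mem_ofPred_eq, List.mem_cons, Set.mem_insert_iff,
          exists_eq_or_imp, @eq_comm _ w z]
        have : ∀ a b c d : Prop, (a ∨ (b ∨ c) ∨ d) ↔ ((b ∨ a) ∨ c) ∨ d := by tauto
        exact this _ _ _ _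
      · simp only [listCost, List.map_cons, List.sum_cons] at ht₅ ⊢
        rw [Nat.mul_add (β + 9) (off (z + 1) - off z + 1)]
        have : (β + 9) * (off (z + 1) - off z + 1) =
          (β + 3) * (off (z + 1) - off z) + 6 * (off (z + 1) - off z) + β + 9 := by ring
        omega

/-- The set of vertices that the arrays `10`, `11` and `12` assign to the class `f`. -/
def coreOf (n : ℕ) (A : ℕ → ℕ → ℕ) (f : ℕ) : Set (Fin n) :=
  {y | A 10 y = f ∧ A 11 y = A 12 f}

/-- If the vertex in the register `14` is in the core of a class, put the class in the
register `31`. -/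
def findBody : Prog :=
  .load 15 10 14;;
  .ite (.ne 15 3) (.load 16 11 14;;.load 17 12 15;;.ite (.eq 16 17) (.copy 31 15) .skip) .skip

/-- Put the vertex in the register `14` in the core of the class in the register `29`. -/
def addBody : Prog := .store 10 14 29;;.store 11 14 4

/-- Keep the vertex in the register `14` in the core of the class in the register `31`, if it is
there. -/
def keepBody : Prog :=
  .load 15 10 14;;
  .ite (.eq 15 31) (.load 16 11 14;;.ite (.eq 16 35) (.store 11 14 36) .skip) .skip

/-- Replace the class `reg 30` by its neighbourhood, and merge it with a new class that it meets,
or make it a new class. -/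
def classStep : Prog :=
  .load 32 8 30;;.const 31 0;;coreNb findBody;;
  .ite (.eq 31 3)
    (.succ 29 29;;.store 12 29 4;;.load 32 8 30;;coreNb addBody)
    (.load 35 12 31;;.succ 36 35;;.load 32 8 30;;coreNb keepBody;;.store 12 31 36)

/-- Validity of the class numbers and of the counters. -/
structure ClassInv (n : ℕ) (s : State) : Prop where
  le : ∀ y : Fin n, s.arr 10 y ≤ s.reg 29
  cnt_le : ∀ y : Fin n, s.arr 10 y ≠ 0 → s.arr 11 y ≤ s.arr 12 (s.arr 10 y)

/-- Intersecting a core with the grown set `M` must not cost time for the vertices that drop out. So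
each vertex has a counter, and it belongs to the core only if this equals the counter of its class.
The vertices of the core in `M` are raised by one, then the class is; all others become stale
without being touched. If `M` meets several cores it is merged with one of them and the others stay
as they are, so the cores remain disjoint. -/
theorem runs_classStep {s : State} {i : ℕ} {l : List (Fin n)} (hL : IsAdjacencyLists G off adj)
    (hE : Env n off adj s) (hi : s.reg 30 = i) (hl : IsList (s.arr 9) (s.arr 8 i) l)
    (hI : ClassInv n s) :
    Runs classStep s fun s' t => ClassInv n s' ∧
      ((∃ f, 1 ≤ f ∧ f ≤ s.reg 29 ∧ s'.reg 29 = s.reg 29 ∧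
          (coreOf n s.arr f ∩ closedNbhd G {z | z ∈ l}).Nonempty ∧
          coreOf n s'.arr f = coreOf n s.arr f ∩ closedNbhd G {z | z ∈ l} ∧
          ∀ f', 1 ≤ f' → f' ≠ f → coreOf n s'.arr f' = coreOf n s.arr f') ∨
        (s'.reg 29 = s.reg 29 + 1 ∧
          coreOf n s'.arr (s.reg 29 + 1) = closedNbhd G {z | z ∈ l} ∧
          ∀ f', 1 ≤ f' → f' ≤ s.reg 29 → coreOf n s'.arr f' = coreOf n s.arr f')) ∧
      t ≤ 10 + 32 * listCost off l := by
  set M := closedNbhd G {z | z ∈ l} with hM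
  simp only [classStep]
  rw [runs_seq, runs_load, runs_seq, runs_const]
  have hE₀ : Env n off adj ((s.setReg 32 (s.arr 8 (s.reg 30))).setReg 31 0) :=
    ⟨by simp [hE.1], by simp [hE.2], by simp [hE.3], by simp [hE.4], by simp [hE.5]⟩
  refine (runs_coreNb (β := 7) hL (fun S A r => A = s.arr ∧
    (r = 0 → ∀ y ∈ S, ∀ f, 1 ≤ f → y ∉ coreOf n s.arr f) ∧
    (r ≠ 0 → ∃ y ∈ S, y ∈ coreOf n s.arr r)) (by decide) (by decide) l (M := ∅) hE₀
    (by simpa [hi] using hl) ⟨rfl, by simp⟩ ?_).seq ?_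
  · rintro S s' v h14 hf' ⟨hA, hI₁, hI₂⟩
    have h3 : s'.reg 3 = 0 := by rw [hf'.1 3 (by decide), hE₀.2]
    have keep : (∀ f, 1 ≤ f → v ∉ coreOf n s.arr f) →
        (s'.reg 31 = 0 → ∀ y ∈ insert v S, ∀ f, 1 ≤ f → y ∉ coreOf n s.arr f) ∧
        (s'.reg 31 ≠ 0 → ∃ y ∈ insert v S, y ∈ coreOf n s.arr (s'.reg 31)) := by
      intro hv
      refine ⟨fun h0 y hy => ?_, fun h0 => ?_⟩
      · rcases hy with rfl | hy
        · exact hv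
        · exact hI₁ h0 y hy
      · obtain ⟨y, hy, h⟩ := hI₂ h0
        exact ⟨y, Set.mem_insert_of_mem _ hy, h⟩
    simp only [findBody, runs_seq, runs_load, runs_ite, runs_copy, runs_skip, Test.Holds]
    simp only [h14, hA, h3, setReg_reg, setReg_arr]
    norm_num
    refine ⟨fun hb => ⟨fun hb' => ⟨?_, ?_⟩, fun hb' => ?_⟩, fun hb => ?_⟩
    · intro h0; exact absurd h0 hb
    · intro _
      exact Or.inl ⟨rfl, hb'⟩
    · have := keep fun f hf hv => hb' (by rw [hv.1, hv.2])
      simpa using this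
    · have := keep fun f hf hv => by
        have := hv.1
        omega
      simpa using this
  · rintro s₁ t₁ hf₁ ⟨⟨hA, hI₁, hI₂⟩, ht₁⟩
    rw [Set.empty_union] at hI₁ hI₂
    have hE₁ := hE₀.frame hf₁ (by decide) (by decide) (by decide) (by decide) (by decide)
    have e29 : s₁.reg 29 = s.reg 29 := by rw [hf₁.1 29 (by decide)]; simp
    have e30 : s₁.reg 30 = i := by rw [hf₁.1 30 (by decide)]; simp [hi]
    rw [runs_ite]
    constructor
    · intro hb
      have h31 : s₁.reg 31 = 0 := by simpa [Test.Holds, hE₁.2] using hb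
      have hdisj := hI₁ h31
      rw [runs_seq, runs_succ, runs_seq, runs_store, runs_seq, runs_load]
      simp only [setReg_reg, setReg_arr, setArr_reg, setArr_arr, e29, e30, hA, hE₁.3]
      norm_num
      refine (runs_coreNb (β := 2) hL (fun S A r =>
        (∀ y : Fin n, A 10 y ≠ s.reg 29 + 1 → A 10 y = s.arr 10 y ∧ A 11 y = s.arr 11 y) ∧
        (∀ y : Fin n, A 10 y = s.reg 29 + 1 ↔ y ∈ S) ∧ (∀ y ∈ S, A 11 y = 1) ∧
        A 12 = Function.update (s.arr 12) (s.reg 29 + 1) 1) (by decide) (by decide) l (M := ∅)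
        ⟨by simp [hE₁.1], by simp [hE₁.2], by simp [hE₁.3], by simp [hA, hE.4], by simp [hA, hE.5]⟩
        (by simpa [hA] using hl) ?_ ?_).mono ?_
      · simp only [setReg_arr, setArr_arr, hA]
        norm_num
        intro y
        have := hI.le y
        omega
      · rintro S s' v h14 hf' ⟨g1, g2, g3, g4⟩
        have h29 : s'.reg 29 = s.reg 29 + 1 := by rw [hf'.1 29 (by decide)]; simp
        have h4 : s'.reg 4 = 1 := by rw [hf'.1 4 (by decide)]; simp [hE₁.3]
        simp only [addBody, runs_seq, runs_store, setArr_reg, setArr_arr, h14, h29, h4]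
        norm_num
        refine ⟨fun y hy => ?_, fun y => ?_, ?_, g4⟩
        · by_cases hyv : (y : ℕ) = v
          · simp [hyv] at hy
          · simp only [Function.update_apply, hyv, if_false] at hy ⊢
            exact g1 y hy
        · by_cases hyv : y = v
          · simp [hyv]
          · have hyv' : (y : ℕ) ≠ v := fun h => hyv (Fin.ext h)
            simp only [Function.update_apply, hyv', hyv, if_false, false_or]
            exact g2 y
        · intro y hy
          by_cases hyv : (y : ℕ) = v
          · simp [hyv]
          · simp only [Function.update_apply, hyv, if_false]
            exact g3 y hy
      · rintro s₂ t₂ hf₂ ⟨⟨g1, g2, g3, g4⟩, ht₂⟩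
        rw [Set.empty_union, ← hM] at g2 g3
        have h29 : s₂.reg 29 = s.reg 29 + 1 := by rw [hf₂.1 29 (by decide)]; simp
        refine ⟨⟨fun y => ?_, fun y hy => ?_⟩, Or.inr ⟨h29, ?_, fun f' h1 h2 => ?_⟩, by omega⟩
        · by_cases h : s₂.arr 10 y = s.reg 29 + 1
          · omega
          · rw [(g1 y h).1, h29]
            exact (hI.le y).trans (by omega)
        · rw [g4]
          by_cases h : s₂.arr 10 y = s.reg 29 + 1
          · rw [h, g3 y ((g2 y).1 h)]; simp
          · rw [Function.update_apply, if_neg h, (g1 y h).1, (g1 y h).2]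
            exact hI.cnt_le y (by rwa [← (g1 y h).1])
        · ext y
          simp only [coreOf, Set.mem_ofPred_eq, g4, Function.update_self]
          rw [g2]
          exact ⟨fun h => h.1, fun h => ⟨h, g3 y h⟩⟩
        · ext y
          simp only [coreOf, Set.mem_ofPred_eq, g4, Function.update_apply,
            if_neg (show f' ≠ s.reg 29 + 1 by omega)]
          by_cases h : s₂.arr 10 y = s.reg 29 + 1
          · have hyM := (g2 y).1 h
            constructor
            · intro h'; omega
            · intro h'
              exact absurd h' (hdisj y hyM f' h1)
          · rw [(g1 y h).1, (g1 y h).2]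
    · intro hb
      have h31 : s₁.reg 31 ≠ 0 := by simpa [Test.Holds, hE₁.2] using hb
      obtain ⟨y₀, hy₀, hc₀⟩ := hI₂ h31
      set f := s₁.reg 31 with hf
      have hfle : f ≤ s.reg 29 := by rw [← hc₀.1]; exact hI.le y₀
      rw [runs_seq, runs_load, runs_seq, runs_succ, runs_seq, runs_load]
      simp only [setReg_reg, setReg_arr, e30, hA, ← hf]
      norm_num
      refine (runs_coreNb (β := 5) hL (fun S A r =>
        A 10 = s.arr 10 ∧ A 12 = s.arr 12 ∧
        (∀ y : Fin n, (y ∈ S ∧ y ∈ coreOf n s.arr f → A 11 y = s.arr 12 f + 1) ∧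
          (¬ (y ∈ S ∧ y ∈ coreOf n s.arr f) → A 11 y = s.arr 11 y))) (by decide) (by decide) l
        (M := ∅)
        ⟨by simp [hE₁.1], by simp [hE₁.2], by simp [hE₁.3], by simp [hA, hE.4], by simp [hA, hE.5]⟩
        (by simpa [hA] using hl) ?_ ?_).seq ?_
      · simp [hA]
      · rintro S s' v h14 hf' ⟨g1, g2, g3⟩
        have h31' : s'.reg 31 = f := by rw [hf'.1 31 (by decide)]; simp [hf]
        have h35 : s'.reg 35 = s.arr 12 f := by rw [hf'.1 35 (by decide)]; simp
        have h36 : s'.reg 36 = s.arr 12 f + 1 := by rw [hf'.1 36 (by decide)]; simp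
        -- If the test fails for a core vertex, its counter was raised at an earlier visit; repeated
        -- visits therefore change nothing.
        have same : (v ∈ coreOf n s.arr f → s'.arr 11 v ≠ s.arr 12 f) →
            ∀ y : Fin n, (y ∈ insert v S ∧ y ∈ coreOf n s.arr f → s'.arr 11 y = s.arr 12 f + 1) ∧
              (¬ (y ∈ insert v S ∧ y ∈ coreOf n s.arr f) → s'.arr 11 y = s.arr 11 y) := by
          intro hv y
          have h1 := g3 y
          by_cases hyv : y = v
          · subst hyv
            constructor
            · rintro ⟨-, h2⟩
              by_contra h3
              by_cases h4 : y ∈ S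
              · exact h3 (h1.1 ⟨h4, h2⟩)
              · have h5 := h1.2 fun h => h4 h.1
                exact hv h2 (h5.trans h2.2)
            · intro h2
              exact h1.2 fun h => h2 ⟨Set.mem_insert _ _, h.2⟩
          · rw [Set.mem_insert_iff, or_iff_right hyv]
            exact h1
        simp only [keepBody, runs_seq, runs_load, runs_ite, runs_store, runs_skip, Test.Holds]
        simp only [h14, h31', h35, h36, g1, g2, setReg_reg, setReg_arr, setArr_arr]
        norm_num
        refine ⟨fun hb => ⟨fun hb' => ?_, fun hb' => ?_⟩, fun hb => ?_⟩
        · intro y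
          by_cases hyv : y = v
          · subst hyv
            have hy : y ∈ coreOf n s.arr f := by
              refine ⟨hb, ?_⟩
              by_cases h4 : y ∈ S ∧ y ∈ coreOf n s.arr f
              · exact h4.2.2
              · rw [← (g3 y).2 h4, hb']
            simp [hy]
          · have hyv' : (y : ℕ) ≠ v := fun h => hyv (Fin.ext h)
            have h1 := g3 y
            simp only [Function.update_apply, hyv', hyv, if_false, false_or]
            refine ⟨fun h2 h3 => h1.1 ⟨h2, h3⟩, fun h2 => h1.2 fun h3 => h2 h3.1 h3.2⟩
        · have := same fun _ => hb'
          simpa [g1, g2] using this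
        · have := same fun h => absurd h.1 hb
          simpa [g1, g2] using this
      · rintro s₂ t₂ hf₂ ⟨⟨g1, g2, g3⟩, ht₂⟩
        rw [Set.empty_union, ← hM] at g3
        have h29 : s₂.reg 29 = s.reg 29 := by rw [hf₂.1 29 (by decide)]; simp [e29]
        have h31' : s₂.reg 31 = f := by rw [hf₂.1 31 (by decide)]; simp [hf]
        have h36 : s₂.reg 36 = s.arr 12 f + 1 := by rw [hf₂.1 36 (by decide)]; simp
        rw [runs_store, h31', h36]
        refine ⟨⟨fun y => ?_, fun y hy => ?_⟩,
          Or.inl ⟨f, by omega, hfle, by simp [h29], ⟨y₀, hc₀, hy₀⟩, ?_, fun f' h1 h2 => ?_⟩, by omega⟩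
        · simp [h29, g1]
          exact hI.le y
        · simp [g1, g2] at hy ⊢
          have h1 := hI.cnt_le y hy
          by_cases h2 : y ∈ M ∧ y ∈ coreOf n s.arr f
          · rw [(g3 y).1 h2, h2.2.1]; simp
          · rw [(g3 y).2 h2]
            by_cases h3 : s.arr 10 y = f
            · rw [h3] at h1 ⊢; simp; omega
            · rwa [Function.update_apply, if_neg h3]
        · ext y
          simp only [coreOf, Set.mem_ofPred_eq, setArr_arr, g1, g2, Set.mem_inter_iff]
          norm_num
          by_cases h2 : y ∈ M ∧ y ∈ coreOf n s.arr f
          · rw [(g3 y).1 h2]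
            have := h2.2
            simp only [coreOf, Set.mem_ofPred_eq] at this
            simp [h2.1, this]
          · rw [(g3 y).2 h2]
            constructor
            · rintro ⟨h3, h4⟩
              -- A vertex that was not raised has a counter at most the old counter of the class, so
              -- it cannot equal the new one.
              have := hI.cnt_le y (by omega)
              rw [h3] at this
              omega
            · rintro ⟨⟨h3, h4⟩, h5⟩
              exact absurd ⟨h5, h3, h4⟩ h2
        · ext y
          simp only [coreOf, Set.mem_ofPred_eq, setArr_arr, g1, g2]
          norm_num
          rw [Function.update_apply, if_neg h2]
          by_cases h3 : s.arr 10 y = f'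
          · rw [(g3 y).2 fun h => h2 (h3.symm.trans h.2.1)]
            exact fun _ => Iff.rfl
          · simp [h3]

end RandRAM

/-! ### Metric consequences of the Helly property -/

section Helly

variable {V : Type*} {G : SimpleGraph V}

/-- Two balls whose radii sum to at least the distance of the centres share a vertex: one on a
shortest path, or a centre if one radius is already large enough. -/
theorem IsHellyGraph.exists_forall_dist_le (hH : IsHellyGraph G) (hG : G.Connected) {ι : Type*}
    (c : ι → V) (r : ι → ℕ) (h : ∀ i j, G.dist (c i) (c j) ≤ r i + r j) :
    ∃ x, ∀ i, G.dist (c i) x ≤ r i := by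
  have hball : ∀ (v x : V) (k : ℕ), x ∈ graphBall G v k ↔ G.dist v x ≤ k := by
    intro v x k
    rw [graphBall, Set.mem_ofPred_eq, ← (hG v x).coe_dist_eq_edist]
    exact Nat.cast_le
  obtain ⟨x, hx⟩ := hH (Set.range fun i => (c i, r i)) (by
    rintro _ ⟨i, rfl⟩ _ ⟨j, rfl⟩
    rcases le_total (r i) (G.dist (c i) (c j)) with hle | hle
    · obtain ⟨x, hx₁, hx₂⟩ := hG.exists_dist_eq hle
      have := h i j
      rw [G.dist_comm (u := x)] at hx₂
      exact ⟨x, (hball _ _ _).2 hx₁.le, (hball _ _ _).2 (by dsimp only; omega)⟩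
    · exact ⟨c j, (hball _ _ _).2 hle, (hball _ _ _).2 (by simp)⟩)
  refine ⟨x, fun i => (hball _ _ _).1 ?_⟩
  simp only [Set.mem_iInter] at hx
  exact hx (c i, r i) ⟨i, rfl⟩

/-- In a Helly graph, if the balls of radius `j` with centres in `A` have a common vertex, then
the common vertices of the balls of radius `j + 1` are those near a common vertex of the former. -/
theorem IsHellyGraph.exists_near (hH : IsHellyGraph G) (hG : G.Connected) {A : Set V} {j : ℕ}
    (hne : ∃ y, ∀ a ∈ A, G.dist y a ≤ j) {x : V} (hx : ∀ a ∈ A, G.dist x a ≤ j + 1) :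
    ∃ z, (∀ a ∈ A, G.dist z a ≤ j) ∧ G.dist z x ≤ 1 := by
  obtain ⟨y, hy⟩ := hne
  obtain ⟨z, hz⟩ := hH.exists_forall_dist_le hG (ι := Option A) (fun i => i.elim x Subtype.val)
    (fun i => i.elim 1 fun _ => j) (by
      rintro (_ | ⟨a, ha⟩) (_ | ⟨b, hb⟩)
      · simp
      · have := hx b hb
        simp; omega
      · have := hx a ha
        rw [G.dist_comm] at this
        simp; omega
      · have h1 := hG.dist_triangle (u := a) (v := y) (w := b)
        have h2 := hy a ha
        have h3 := hy b hb
        rw [G.dist_comm] at h2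
        simp; omega)
  refine ⟨z, fun a ha => ?_, ?_⟩
  · rw [G.dist_comm]; exact hz (some ⟨a, ha⟩)
  · rw [G.dist_comm]; exact hz none

variable [Fintype V] {r : ℕ}

/-- In a Helly graph of radius `r`, a vertex at the largest distance from the center has the
largest eccentricity. -/
theorem IsHellyGraph.dist_le_vertexEcc_of_center (hH : IsHellyGraph G) (hG : G.Connected)
    (hne : {x | vertexEcc G x ≤ r}.Nonempty) (hr : ∀ x, r ≤ vertexEcc G x) {v : V}
    (hv : ∀ x, setDist G {x | vertexEcc G x ≤ r} x ≤ setDist G {x | vertexEcc G x ≤ r} v)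
    (x y : V) : G.dist x y ≤ vertexEcc G v := by
  set C := {x | vertexEcc G x ≤ r} with hC
  -- Otherwise the ball around `v` of radius `setDist G C v - 1` and all balls of radius `r` meet
  -- pairwise, and a common vertex would be a central vertex closer to `v` than `C` is.
  have h1 : r + setDist G C v ≤ vertexEcc G v := by
    by_contra hlt
    have h0 : 0 < setDist G C v := by have := hr v; omega
    obtain ⟨c, hc⟩ := hne
    have hc' : ∀ w, G.dist c w ≤ r := vertexEcc_le_iff.1 hc
    obtain ⟨z, hz⟩ := hH.exists_forall_dist_le hG (ι := Option V) (fun i => i.elim v id)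
      (fun i => i.elim (setDist G C v - 1) fun _ => r) (by
        have hvw : ∀ w, G.dist v w ≤ setDist G C v - 1 + r := fun w => by
          have := dist_le_vertexEcc (G := G) v w
          omega
        rintro (_ | a) (_ | b)
        · simp
        · simpa using hvw b
        · rw [G.dist_comm, add_comm]; simpa using hvw a
        · have h1 := hG.dist_triangle (u := a) (v := c) (w := b)
          have h2 := hc' a
          have h3 := hc' b
          rw [G.dist_comm] at h2
          simp; omega)
    have hzC : z ∈ C := vertexEcc_le_iff.2 fun w => by rw [G.dist_comm]; exact hz (some w)
    have h2 := setDist_le (G := G) hzC v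
    have h3 : G.dist v z ≤ setDist G C v - 1 := hz none
    rw [G.dist_comm] at h3
    omega
  obtain ⟨c, hc, hcx⟩ := exists_setDist_eq (G := G) hne x
  have h2 := hG.dist_triangle (u := x) (v := c) (w := y)
  have h3 : G.dist c y ≤ r := vertexEcc_le_iff.1 hc y
  have h4 := hv x
  rw [G.dist_comm] at hcx
  omega

/-- In a Helly graph of radius `r`, some eccentricity is at least `2 r - 1`. -/
theorem IsHellyGraph.exists_two_mul_le (hH : IsHellyGraph G) (hG : G.Connected)
    (hr : ∀ x, r ≤ vertexEcc G x) : ∃ v, 2 * r ≤ vertexEcc G v + 1 := by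
  by_contra! hcon
  rcases Nat.eq_zero_or_pos r with rfl | hpos
  · obtain ⟨v⟩ := hG.nonempty
    have := hcon v
    omega
  -- If all distances are at most `2 r - 2`, all balls of radius `r - 1` meet pairwise, which gives
  -- a vertex of eccentricity below `r`.
  obtain ⟨z, hz⟩ := hH.exists_forall_dist_le hG (ι := V) id (fun _ => r - 1) (by
    intro a b
    have h1 := dist_le_vertexEcc (G := G) a b
    have h2 := hcon a
    simp only [id]
    omega)
  have h1 : vertexEcc G z ≤ r - 1 := vertexEcc_le_iff.2 fun w => by rw [G.dist_comm]; exact hz w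
  have h2 := hr z
  omega

/-- If `z` has eccentricity `r + l` in a Helly graph of radius `r`, then for any vertex `v` of
eccentricity at most `2 r - p` there is a central vertex near `z` and at distance at most `r - p`
from `v`. -/
theorem IsHellyGraph.exists_center_near (hH : IsHellyGraph G) (hG : G.Connected)
    (hne : {x | vertexEcc G x ≤ r}.Nonempty) {z v : V} {l p : ℕ} (hz : vertexEcc G z ≤ r + l)
    (hp : p ≤ r) (hv : vertexEcc G v + p ≤ 2 * r) :
    ∃ c, vertexEcc G c ≤ r ∧ G.dist z c ≤ l + p ∧ G.dist v c ≤ r - p := by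
  obtain ⟨c, hc⟩ := hne
  have hc' : ∀ w, G.dist c w ≤ r := vertexEcc_le_iff.1 hc
  have hz' := vertexEcc_le_iff.1 hz
  have hv' := fun w => dist_le_vertexEcc (G := G) v w
  have hww : ∀ a b, G.dist a b ≤ r + r := fun a b => by
    have h1 := hG.dist_triangle (u := a) (v := c) (w := b)
    have h2 := hc' a
    have h3 := hc' b
    rw [G.dist_comm] at h2
    omega
  -- The balls are those of radius `l + p` around `z`, of radius `r - p` around `v`, and of radius
  -- `r` around every vertex; the last ones make the common vertex central.
  obtain ⟨x, hx⟩ := hH.exists_forall_dist_le hG (ι := Option (Option V))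
    (fun i => i.elim z fun i => i.elim v id)
    (fun i => i.elim (l + p) fun i => i.elim (r - p) fun _ => r) (by
      have hzv : G.dist z v ≤ l + p + (r - p) := by have := hz' v; omega
      have hzw : ∀ w, G.dist z w ≤ l + p + r := fun w => by have := hz' w; omega
      have hvw : ∀ w, G.dist v w ≤ r - p + r := fun w => by have := hv' w; omega
      rintro (_ | _ | a) (_ | _ | b)
      · simp
      · simpa using hzv
      · simpa using hzw b
      · rw [G.dist_comm, add_comm]; simpa using hzv
      · simp
      · simpa using hvw b
      · rw [G.dist_comm, add_comm]; simpa using hzw a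
      · rw [G.dist_comm, add_comm]; simpa using hvw a
      · simpa using hww a b)
  exact ⟨x, vertexEcc_le_iff.2 fun w => by rw [G.dist_comm]; exact hx (some (some w)), hx none,
    hx (some none)⟩

/-- In a Helly graph of large radius, a vertex that maximizes the estimate of the eccentricity
through a layer around an almost central vertex has the largest eccentricity. -/
theorem IsHellyGraph.dist_le_vertexEcc_of_layer (hH : IsHellyGraph G) (hG : G.Connected)
    (hne : {x | vertexEcc G x ≤ r}.Nonempty) (hr : ∀ x, r ≤ vertexEcc G x) {z y : V} {L j : ℕ}
    (hz : vertexEcc G z ≤ r + L) (hL : 3 * L + 3 ≤ r) (hj₁ : L + 2 ≤ j) (hj₂ : j ≤ 2 * L + 2)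
    (hy : ∀ v, j ≤ G.dist z v → ∃ a, j ≤ G.dist z y ∧
      (∀ x, G.dist z x = j → a ≤ vertexEcc G x + G.dist x y) ∧
      ∃ x, vertexEcc G x + G.dist x v ≤ a) (u v : V) : G.dist u v ≤ vertexEcc G y := by
  -- The estimate does not overshoot near the top. The central vertex `c` has distance at most `L +
  -- 2 ≤ j` from `z`, while `y` has distance at least `j`, so a shortest path from `c` to `y`
  -- crosses the layer at some `x`; then `a ≤ ecc x + dist x y ≤ r + dist c y ≤ 2 r - p`.
  have upper : ∀ p, p ≤ 2 → ∀ a, j ≤ G.dist z y →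
      (∀ x, G.dist z x = j → a ≤ vertexEcc G x + G.dist x y) → vertexEcc G y + p ≤ 2 * r →
      a + p ≤ 2 * r := by
    intro p hp a hjy ha hyp
    obtain ⟨c, hc, hzc, hyc⟩ := hH.exists_center_near hG hne hz (by omega) hyp
    -- Take the first vertex of the path at distance at least `j` from `z`; along an edge the
    -- distance grows by at most one, so it is exactly `j`.
    have hex : ∃ x, G.dist z x = j ∧ G.dist y x + G.dist x c = G.dist y c := by
      obtain ⟨w, hw⟩ := hG.exists_walk_length_eq_dist c y
      have hlt : ∃ i, j ≤ G.dist z (w.getVert i) := ⟨w.length, by simpa using hjy⟩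
      classical
      have hspec := Nat.find_spec hlt
      have hle : Nat.find hlt ≤ w.length := Nat.find_min' hlt (by simpa using hjy)
      have h1 : G.dist c (w.getVert (Nat.find hlt)) ≤ Nat.find hlt := by
        have := SimpleGraph.dist_le (w.take (Nat.find hlt))
        rw [SimpleGraph.Walk.take_length] at this
        omega
      have h2 : G.dist (w.getVert (Nat.find hlt)) y ≤ w.length - Nat.find hlt := by
        have := SimpleGraph.dist_le (w.drop (Nat.find hlt))
        rwa [SimpleGraph.Walk.drop_length] at this
      have h3 := hG.dist_triangle (u := c) (v := w.getVert (Nat.find hlt)) (w := y)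
      refine ⟨w.getVert (Nat.find hlt), le_antisymm ?_ hspec, ?_⟩
      · rcases Nat.eq_zero_or_pos (Nat.find hlt) with h0 | h0
        · rw [h0] at hspec ⊢
          simp only [SimpleGraph.Walk.getVert_zero] at hspec ⊢
          omega
        · have h4 := Nat.find_min hlt (m := Nat.find hlt - 1) (by omega)
          have h5 : G.Adj (w.getVert (Nat.find hlt - 1)) (w.getVert (Nat.find hlt)) := by
            have := w.adj_getVert_succ (i := Nat.find hlt - 1) (by omega)
            rwa [Nat.sub_add_cancel h0] at this
          have h6 := hG.dist_triangle (u := z) (v := w.getVert (Nat.find hlt - 1))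
            (w := w.getVert (Nat.find hlt))
          rw [SimpleGraph.dist_eq_one_iff_adj.2 h5] at h6
          omega
      · rw [G.dist_comm (u := y), G.dist_comm (v := c), G.dist_comm (u := y)]
        omega
    obtain ⟨x, hx, hxy⟩ := hex
    have h1 := ha x hx
    have h2 : vertexEcc G x ≤ r + G.dist x c := vertexEcc_le_iff.2 fun w => by
      have h3 := hG.dist_triangle (u := x) (v := c) (w := w)
      have h4 := vertexEcc_le_iff.1 hc w
      omega
    rw [G.dist_comm (u := x) (v := y)] at h1
    omega
  -- A vertex of eccentricity at least `2 r - 1` has distance at least `r - 1 - L ≥ 2 L + 2 ≥ j`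
  -- from `z`, so it takes part in the maximization.
  have lower : ∀ v, 2 * r ≤ vertexEcc G v + 1 → vertexEcc G v ≤ vertexEcc G y := by
    intro v hv
    have hvz : j ≤ G.dist z v := by
      have : vertexEcc G v ≤ G.dist z v + (r + L) := vertexEcc_le_iff.2 fun w => by
        have h1 := hG.dist_triangle (u := v) (v := z) (w := w)
        have h2 := dist_le_vertexEcc (G := G) z w
        rw [G.dist_comm (u := v) (v := z)] at h1
        omega
      omega
    obtain ⟨a, hjy, ha, x, hx⟩ := hy v hvz
    have hva : vertexEcc G v ≤ a := (vertexEcc_le_iff.2 fun w => by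
      have h1 := hG.dist_triangle (u := v) (v := x) (w := w)
      have h2 := dist_le_vertexEcc (G := G) x w
      rw [G.dist_comm (u := v) (v := x)] at h1
      omega)
    by_contra! hlt
    have hv2 : vertexEcc G v ≤ 2 * r := by
      obtain ⟨c, hc⟩ := hne
      refine vertexEcc_le_iff.2 fun w => ?_
      have h1 := hG.dist_triangle (u := v) (v := c) (w := w)
      have h2 := vertexEcc_le_iff.1 hc v
      have h3 := vertexEcc_le_iff.1 hc w
      rw [G.dist_comm] at h2
      omega
    -- Here `p` is `1` or `2`, chosen so that an eccentricity of `y` below that of `v` forces `a <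
    -- vertexEcc G v`, against `hva`.
    have := upper (2 * r + 1 - vertexEcc G v) (by omega) a hjy ha (by omega)
    omega
  obtain ⟨v₀, hv₀⟩ := hH.exists_two_mul_le hG hr
  have h0 := lower v₀ hv₀
  rcases Nat.lt_or_ge (vertexEcc G u + 1) (2 * r) with h | h
  · exact (dist_le_vertexEcc u v).trans (by omega)
  · exact (dist_le_vertexEcc u v).trans (lower u h)

end Helly

/-! ### Families of cores -/

section CoreFamily

variable {V : Type*} {G : SimpleGraph V} {j q : ℕ} {B : ℕ → Set V} {U : Set V}

/-- The sets `B 1, …, B q` are nonempty intersections of balls of radius `j`, whose centres include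
all the elements of `U`. -/
def IsCoreFamily (G : SimpleGraph V) (j q : ℕ) (B : ℕ → Set V) (U : Set V) : Prop :=
  ∃ A : ℕ → Set V, (∀ v ∈ U, ∃ i, 1 ≤ i ∧ i ≤ q ∧ v ∈ A i) ∧
    ∀ i, 1 ≤ i → i ≤ q → B i = {x | ∀ a ∈ A i, G.dist x a ≤ j} ∧ (B i).Nonempty

/-- Intersecting two intersections of balls amounts to uniting their sets of centres; nonemptiness
is exactly the condition under which the program merges. -/
theorem IsCoreFamily.merge {A₀ M : Set V} {B' : ℕ → Set V} {f : ℕ} (h : IsCoreFamily G j q B U)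
    (hM : M = {x | ∀ a ∈ A₀, G.dist x a ≤ j}) (h1 : 1 ≤ f) (hq : f ≤ q)
    (hne : (B f ∩ M).Nonempty) (hf : B' f = B f ∩ M)
    (hf' : ∀ f', 1 ≤ f' → f' ≠ f → B' f' = B f') : IsCoreFamily G j q B' (U ∪ A₀) := by
  obtain ⟨A, hU, hA⟩ := h
  refine ⟨fun i => if i = f then A f ∪ A₀ else A i, ?_, fun i hi₁ hi₂ => ?_⟩
  · rintro v (hv | hv)
    · obtain ⟨i, hi₁, hi₂, hi⟩ := hU v hv
      refine ⟨i, hi₁, hi₂, ?_⟩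
      by_cases hif : i = f
      · beta_reduce; rw [if_pos hif, ← hif]; exact Or.inl hi
      · beta_reduce; rwa [if_neg hif]
    · exact ⟨f, h1, hq, by beta_reduce; rw [if_pos rfl]; exact Or.inr hv⟩
  · by_cases hif : i = f
    · subst hif
      refine ⟨?_, by rw [hf]; exact hne⟩
      rw [hf, (hA i hi₁ hi₂).1, hM]
      ext x
      simp only [if_true, Set.mem_inter_iff, Set.mem_ofPred_eq, Set.mem_union]
      exact ⟨fun h a ha => ha.elim (h.1 a) (h.2 a),
        fun h => ⟨fun a ha => h a (Or.inl ha), fun a ha => h a (Or.inr ha)⟩⟩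
    · rw [hf' i hi₁ hif]
      simp only [hif, if_false]
      exact hA i hi₁ hi₂

theorem IsCoreFamily.add {A₀ M : Set V} {B' : ℕ → Set V} (h : IsCoreFamily G j q B U)
    (hM : M = {x | ∀ a ∈ A₀, G.dist x a ≤ j}) (hne : M.Nonempty) (hq : B' (q + 1) = M)
    (hf' : ∀ f', 1 ≤ f' → f' ≤ q → B' f' = B f') : IsCoreFamily G j (q + 1) B' (U ∪ A₀) := by
  obtain ⟨A, hU, hA⟩ := h
  refine ⟨fun i => if i = q + 1 then A₀ else A i, ?_, fun i hi₁ hi₂ => ?_⟩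
  · rintro v (hv | hv)
    · obtain ⟨i, hi₁, hi₂, hi⟩ := hU v hv
      exact ⟨i, hi₁, by omega, by beta_reduce; rwa [if_neg (by omega)]⟩
    · exact ⟨q + 1, by omega, le_rfl, by beta_reduce; rwa [if_pos rfl]⟩
  · by_cases hif : i = q + 1
    · subst hif
      beta_reduce
      rw [hq, if_pos rfl]
      exact ⟨hM, hne⟩
    · rw [hf' i hi₁ (by omega)]
      simp only [hif, if_false]
      exact hA i hi₁ (by omega)

theorem IsCoreFamily.pos [Nonempty V] (h : IsCoreFamily G j q B Set.univ) : 1 ≤ q := by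
  obtain ⟨A, hU, hA⟩ := h
  obtain ⟨v⟩ := ‹Nonempty V›
  obtain ⟨i, h1, h2, -⟩ := hU v trivial
  omega

/-- A family with a single core consists of the vertices of eccentricity at most `j`. -/
theorem IsCoreFamily.eq_of_one [Fintype V] (h : IsCoreFamily G j 1 B Set.univ) :
    B 1 = {x | vertexEcc G x ≤ j} := by
  obtain ⟨A, hU, hA⟩ := h
  rw [(hA 1 le_rfl le_rfl).1]
  ext x
  simp only [Set.mem_ofPred_eq, vertexEcc_le_iff]
  refine ⟨fun hx w => ?_, fun hx a _ => hx a⟩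
  obtain ⟨i, h1, h2, hi⟩ := hU w trivial
  obtain rfl : i = 1 := by omega
  exact hx w hi

/-- From the radius on, a disjoint family has a single core. -/
theorem IsCoreFamily.eq_one [Fintype V] (h : IsCoreFamily G j q B Set.univ) {c : V}
    (hc : vertexEcc G c ≤ j) (hd : ∀ i i', 1 ≤ i → i ≤ q → 1 ≤ i' → i' ≤ q → ∀ x ∈ B i, x ∈ B i' →
      i = i') : q = 1 := by
  have : Nonempty V := ⟨c⟩
  have h1 := h.pos
  obtain ⟨A, hU, hA⟩ := h
  have hcB : ∀ i, 1 ≤ i → i ≤ q → c ∈ B i := fun i hi₁ hi₂ => by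
    rw [(hA i hi₁ hi₂).1]
    exact fun a _ => vertexEcc_le_iff.1 hc a
  exact hd q 1 h1 le_rfl le_rfl h1 c (hcB _ h1 le_rfl) (hcB _ le_rfl h1)

end CoreFamily

/-! ### Computing the center by growing cores -/

namespace RandRAM

variable {n : ℕ} {G : SimpleGraph (Fin n)} {off adj : ℕ → ℕ}

/-- The linked lists with heads in the array `8` hold the sets `B 1, …, B q`. -/
def HoldsLists (s : State) (q : ℕ) (B : ℕ → Set (Fin n)) : Prop :=
  ∀ i, 1 ≤ i → i ≤ q → ∃ l : List (Fin n), IsList (s.arr 9) (s.arr 8 i) l ∧ l.Nodup ∧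
    ∀ y, y ∈ l ↔ y ∈ B i

/-- The vertices in the first `k` of the sets `B 1, B 2, …`. -/
noncomputable def coveredBy (B : ℕ → Set (Fin n)) (k : ℕ) : Finset (Fin n) := by
  classical exact Finset.univ.filter fun y => ∃ i, 1 ≤ i ∧ i ≤ k ∧ y ∈ B i

theorem mem_coveredBy {B : ℕ → Set (Fin n)} {k : ℕ} {y : Fin n} :
    y ∈ coveredBy B k ↔ ∃ i, 1 ≤ i ∧ i ≤ k ∧ y ∈ B i := by
  simp [coveredBy]

/-- Disjointness lets each core pay for its own vertices only; summed over all cores, a round costs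
`O(off n + n)`. -/
theorem listCost_add_le {B : ℕ → Set (Fin n)} {k : ℕ} {l : List (Fin n)} (hl : l.Nodup)
    (hlB : ∀ y, y ∈ l ↔ y ∈ B (k + 1))
    (hd : ∀ i, 1 ≤ i → i ≤ k → ∀ y ∈ B i, y ∉ B (k + 1)) :
    ∑ y ∈ coveredBy B k, (off (y + 1) - off y + 1) + listCost off l ≤
      ∑ y ∈ coveredBy B (k + 1), (off (y + 1) - off y + 1) := by
  classical
  rw [listCost, ← List.sum_toFinset _ hl, ← Finset.sum_union]
  · apply Finset.sum_le_sum_of_subset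
    intro y hy
    rw [mem_coveredBy]
    rcases Finset.mem_union.1 hy with hy | hy
    · obtain ⟨i, h1, h2, h3⟩ := mem_coveredBy.1 hy
      exact ⟨i, h1, by omega, h3⟩
    · exact ⟨k + 1, by omega, le_rfl, (hlB y).1 (List.mem_toFinset.1 hy)⟩
  · rw [Finset.disjoint_left]
    intro y hy hy'
    obtain ⟨i, h1, h2, h3⟩ := mem_coveredBy.1 hy
    exact hd i h1 h2 y h3 ((hlB y).1 (List.mem_toFinset.1 hy'))

theorem sum_coveredBy_le (hA : AdjArrays n off adj) (B : ℕ → Set (Fin n)) (k : ℕ) :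
    ∑ y ∈ coveredBy B k, (off (y + 1) - off y + 1) ≤ off n + n := by
  calc ∑ y ∈ coveredBy B k, (off ((y : ℕ) + 1) - off y + 1)
      ≤ ∑ y : Fin n, (off ((y : ℕ) + 1) - off y + 1) :=
        Finset.sum_le_sum_of_subset (Finset.subset_univ _)
    _ = off n + n := by
        rw [← hA.sum_deg, Finset.sum_range, Finset.sum_add_distrib]
        simp

/-- Let the cores grow by one, and merge them. -/
def classLoop : Prog := .const 29 0;;clear 10;;.forUp 37 28 (.succ 30 37;;classStep)

theorem runs_classLoop {s : State} {j q : ℕ} {B : ℕ → Set (Fin n)}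
    (hL : IsAdjacencyLists G off adj) (hH : IsHellyGraph G) (hG : G.Connected)
    (hE : Env n off adj s) (hq : s.reg 28 = q) (hqn : q ≤ n)
    (hB : IsCoreFamily G j q B Set.univ) (hlist : HoldsLists s q B)
    (hd : ∀ i i', 1 ≤ i → i ≤ q → 1 ≤ i' → i' ≤ q → ∀ x ∈ B i, x ∈ B i' → i = i') :
    Runs classLoop s fun s' t => s'.reg 29 ≤ q ∧
      IsCoreFamily G (j + 1) (s'.reg 29) (coreOf n s'.arr) Set.univ ∧
      t ≤ 50 * n + 32 * off n + 5 := by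
  obtain ⟨A, hU, hA⟩ := hB
  rw [classLoop, runs_seq, runs_const]
  refine (runs_clear (n := n) (by simp [hE.1]) (by simp [hE.2])).seq ?_
  rintro s₁ t₁ hf₁ ⟨hc, rfl⟩
  have e8 : s₁.arr 8 = s.arr 8 := by rw [hf₁.2 8 (by decide)]; rfl
  have e9 : s₁.arr 9 = s.arr 9 := by rw [hf₁.2 9 (by decide)]; rfl
  have hE₁ : Env n off adj s₁ := Env.frame (s := s.setReg 29 0)
    ⟨by simp [hE.1], by simp [hE.2], by simp [hE.3], by simp [hE.4], by simp [hE.5]⟩ hf₁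
    (by decide) (by decide) (by decide) (by decide) (by decide)
  have e29 : s₁.reg 29 = 0 := by rw [hf₁.1 29 (by decide)]; simp
  refine (runs_forUp (N := q) (fun k s' e => s'.reg 29 ≤ k ∧ ClassInv n s' ∧
    s'.arr 8 = s.arr 8 ∧ s'.arr 9 = s.arr 9 ∧
    IsCoreFamily G (j + 1) (s'.reg 29) (coreOf n s'.arr) {v | ∃ i, 1 ≤ i ∧ i ≤ k ∧ v ∈ A i} ∧
    e ≤ 1 + 13 * k + 32 * ∑ y ∈ coveredBy B k, (off (y + 1) - off y + 1)) ?_ (by decide)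
    (by decide) ?_ ?_).mono ?_
  · rw [hf₁.1 28 (by decide)]; simp [hq]
  · refine ⟨by simp [e29], ⟨fun y => by simp [hc], fun y hy => ?_⟩, e8, e9, ⟨fun _ => ∅, ?_, ?_⟩,
      by simp⟩
    · simp [hc] at hy
    · rintro v ⟨i, h1, h2, -⟩
      omega
    · intro i h1 h2
      simp [e29] at h2
      omega
  · rintro k s' e hk h37 hf ⟨h29, hI, h8, h9, hfam, he⟩
    have hE' := hE₁.frame hf (by decide) (by decide) (by decide) (by decide) (by decide)
    obtain ⟨l, hl, hnd, hlB⟩ := hlist (k + 1) (by omega) (by omega)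
    rw [runs_seq, runs_succ]
    refine (runs_classStep (i := k + 1) (l := l) hL
      ⟨by simp [hE'.1], by simp [hE'.2], by simp [hE'.3], by simp [hE'.4], by simp [hE'.5]⟩
      (by simp [h37]) (by simpa [h8, h9] using hl) ⟨by simpa using hI.le, by simpa using hI.cnt_le⟩
      ).mono ?_
    rintro s₂ t₂ hf₂ ⟨hI₂, hcase, ht₂⟩
    obtain ⟨hBA, hBne⟩ := hA (k + 1) (by omega) (by omega)
    have hlB' : {z | z ∈ l} = B (k + 1) := Set.ext hlB
    -- One inclusion is the triangle inequality; the other is where the Helly property enters a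
    -- round.
    have hM : closedNbhd G {z | z ∈ l} = {x | ∀ a ∈ A (k + 1), G.dist x a ≤ j + 1} := by
      rw [hlB']
      ext x
      simp only [closedNbhd, Set.mem_ofPred_eq]
      constructor
      · rintro ⟨z, hz, hzx⟩ a ha
        rw [hBA] at hz
        have h1 := hz a ha
        rcases hzx with rfl | hzx
        · omega
        · have h2 := hG.dist_triangle (u := x) (v := z) (w := a)
          rw [SimpleGraph.dist_eq_one_iff_adj.2 hzx.symm] at h2
          omega
      · intro hx
        obtain ⟨z, hz, hzx⟩ := hH.exists_near hG (by rw [hBA] at hBne; exact hBne) hx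
        refine ⟨z, by rw [hBA]; exact hz, ?_⟩
        rcases Nat.le_one_iff_eq_zero_or_eq_one.1 hzx with h | h
        · exact Or.inl (hG.dist_eq_zero_iff.1 h)
        · exact Or.inr (SimpleGraph.dist_eq_one_iff_adj.1 h)
    have hMne : (closedNbhd G {z | z ∈ l}).Nonempty := by
      rw [hlB']
      obtain ⟨y, hy⟩ := hBne
      exact ⟨y, y, hy, Or.inl rfl⟩
    have hU' : {v | ∃ i, 1 ≤ i ∧ i ≤ k ∧ v ∈ A i} ∪ A (k + 1) =
        {v | ∃ i, 1 ≤ i ∧ i ≤ k + 1 ∧ v ∈ A i} := by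
      ext v
      simp only [Set.mem_union, Set.mem_ofPred_eq]
      constructor
      · rintro (⟨i, h1, h2, h3⟩ | h)
        · exact ⟨i, h1, by omega, h3⟩
        · exact ⟨k + 1, by omega, le_rfl, h⟩
      · rintro ⟨i, h1, h2, h3⟩
        rcases Nat.lt_succ_iff_lt_or_eq.1 (Nat.lt_succ_of_le h2) with h | rfl
        · exact Or.inl ⟨i, h1, by omega, h3⟩
        · exact Or.inr h3
    have hcost := listCost_add_le (off := off) hnd hlB fun i h1 h2 y hy hy' => by
      have := hd i (k + 1) h1 (by omega) (by omega) (by omega) y hy hy'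
      omega
    have g8 : s₂.arr 8 = s.arr 8 := by rw [hf₂.2 8 (by decide)]; simp [h8]
    have g9 : s₂.arr 9 = s.arr 9 := by rw [hf₂.2 9 (by decide)]; simp [h9]
    simp at hcase
    have hgoal : s₂.reg 29 ≤ k + 1 ∧ IsCoreFamily G (j + 1) (s₂.reg 29) (coreOf n s₂.arr)
        {v | ∃ i, 1 ≤ i ∧ i ≤ k + 1 ∧ v ∈ A i} := by
      rw [← hU']
      rcases hcase with ⟨f, h1, h2, h3, h4, h5, h6⟩ | ⟨h1, h2, h3⟩
      · rw [h3]
        exact ⟨by omega, hfam.merge hM h1 h2 h4 h5 h6⟩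
      · rw [h1]
        exact ⟨by omega, hfam.add hM hMne h2 h3⟩
    refine ⟨by simpa using hgoal.1, ⟨by simpa using hI₂.le, by simpa using hI₂.cnt_le⟩, g8, g9,
      by simpa using hgoal.2, by omega⟩
  · rintro s' t - ⟨e, rfl, h29, -, -, -, hfam, he⟩
    have h1 := sum_coveredBy_le hL.adjArrays B q
    refine ⟨h29, ?_, by omega⟩
    convert hfam using 1
    ext v
    simpa using hU v trivial

/-- Store the cores in linked lists. -/
def rebuild : Prog :=
  .forUp 21 0 (.succ 15 21;;.store 8 15 3);;
  .forUp 21 0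
    (.load 15 10 21;;
      .ite (.ne 15 3)
        (.load 16 11 21;;.load 17 12 15;;
          .ite (.eq 16 17)
            (.load 18 8 15;;.store 9 21 18;;.succ 18 21;;.store 8 15 18) .skip)
        .skip)

theorem runs_rebuild {s : State} (h0 : s.reg 0 = n) (h3 : s.reg 3 = 0) :
    Runs rebuild s fun s' t => HoldsLists s' n (coreOf n s.arr) ∧ t ≤ 16 * n + 4 := by
  refine (runs_forUp (N := n) (fun k s' e => (∀ i, 1 ≤ i → i ≤ k → s'.arr 8 i = 0) ∧
    e ≤ 1 + 4 * k) h0 (by decide) (by decide) ?_ ?_).seq ?_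
  · exact ⟨fun i h1 h2 => by omega, by omega⟩
  · rintro k s' e hk h21 hf ⟨hI, he⟩
    have h3' : s'.reg 3 = 0 := by rw [hf.1 3 (by decide), h3]
    simp only [runs_seq, runs_succ, runs_store]
    simp [h21, h3']
    refine ⟨fun i h1 h2 => ?_, by omega⟩
    rcases h2.lt_or_eq with h | rfl
    · rw [Function.update_apply, if_neg (by omega)]
      exact hI i h1 (by omega)
    · simp
  · rintro s₁ t₁ hf₁ ⟨e₁, rfl, hz, he₁⟩
    have hs : ∀ a ∈ [10, 11, 12], s₁.arr a = s.arr a := by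
      intro a ha
      refine hf₁.2 a ?_
      fin_cases ha <;> decide
    refine (runs_forUp (N := n) (fun k s' e => (∀ i, 1 ≤ i → i ≤ n → ∃ l : List (Fin n),
      IsList (s'.arr 9) (s'.arr 8 i) l ∧ l.Nodup ∧
        ∀ y, y ∈ l ↔ y ∈ coreOf n s.arr i ∧ (y : ℕ) < k) ∧
      e ≤ 1 + 12 * k) ?_ (by decide) (by decide) ?_ ?_).mono ?_
    · rw [hf₁.1 0 (by decide), h0]
    · refine ⟨fun i h1 h2 => ⟨[], ?_, by simp, by simp⟩, by omega⟩
      simpa [IsList] using hz i h1 h2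
    · rintro k s' e hk h21 hf ⟨hI, he⟩
      have h3' : s'.reg 3 = 0 := by rw [hf.1 3 (by decide), hf₁.1 3 (by decide), h3]
      have a10 : s'.arr 10 = s.arr 10 := by rw [hf.2 10 (by decide), hs 10 (by simp)]
      have a11 : s'.arr 11 = s.arr 11 := by rw [hf.2 11 (by decide), hs 11 (by simp)]
      have a12 : s'.arr 12 = s.arr 12 := by rw [hf.2 12 (by decide), hs 12 (by simp)]
      have same : ∀ i, (⟨k, hk⟩ : Fin n) ∉ coreOf n s.arr i → ∀ y : Fin n,
          (y ∈ coreOf n s.arr i ∧ (y : ℕ) < k) ↔ (y ∈ coreOf n s.arr i ∧ (y : ℕ) ≤ k) := by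
        intro i hi y
        refine ⟨fun h => ⟨h.1, h.2.le⟩, fun h => ⟨h.1, lt_of_le_of_ne h.2 fun hyk => hi ?_⟩⟩
        rw [← show y = ⟨k, hk⟩ from Fin.ext hyk]
        exact h.1
      simp only [runs_seq, runs_load, runs_succ, runs_store, runs_ite, runs_skip, Test.Holds]
      simp [h21, h3', a10, a11, a12]
      refine ⟨fun hb => ⟨fun hb' => ⟨fun i h1 h2 => ?_, by omega⟩,
        fun hb' => ⟨fun i h1 h2 => ?_, by omega⟩⟩, fun hb => ⟨fun i h1 h2 => ?_, by omega⟩⟩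
      · obtain ⟨l, hl, hnd, hlB⟩ := hI i h1 h2
        have hkl : ∀ z ∈ l, (z : ℕ) ≠ k := fun z hz => ((hlB z).1 hz).2.ne
        by_cases hi : i = s.arr 10 k
        · refine ⟨⟨k, hk⟩ :: l, ⟨?_, ?_⟩, ?_, fun y => ?_⟩
          · simp [hi]
          · simp only [Function.update_self]
            rw [← hi]
            exact hl.update hkl
          · exact List.nodup_cons.2 ⟨fun h => hkl _ h rfl, hnd⟩
          · rw [List.mem_cons, hlB]
            constructor
            · rintro (rfl | h)
              · exact ⟨⟨hi.symm, by rw [hi]; exact hb'⟩, le_rfl⟩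
              · exact ⟨h.1, h.2.le⟩
            · rintro ⟨h3, h4⟩
              rcases h4.lt_or_eq with h5 | h5
              · exact Or.inr ⟨h3, h5⟩
              · exact Or.inl (Fin.ext h5)
        · refine ⟨l, ?_, hnd, fun y => ?_⟩
          · rw [Function.update_apply, if_neg hi]
            exact hl.update hkl
          · rw [hlB]
            exact same i (fun h => hi h.1.symm) y
      · obtain ⟨l, hl, hnd, hlB⟩ := hI i h1 h2
        refine ⟨l, hl, hnd, fun y => ?_⟩
        rw [hlB]
        exact same i (fun h => hb' (by have h3 := h.2; rwa [← show s.arr 10 k = i from h.1] at h3)) y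
      · obtain ⟨l, hl, hnd, hlB⟩ := hI i h1 h2
        refine ⟨l, hl, hnd, fun y => ?_⟩
        rw [hlB]
        exact same i (fun h => by have h3 : s.arr 10 k = i := h.1; omega) y
    · rintro s' t - ⟨e, rfl, hI, he⟩
      refine ⟨fun i h1 h2 => ?_, by omega⟩
      obtain ⟨l, hl, hnd, hlB⟩ := hI i h1 h2
      exact ⟨l, hl, hnd, fun y => by rw [hlB]; simp⟩

/-- One round: replace the cores for balls of radius `j` by cores for balls of radius `j + 1`. -/
def round : Prog := classLoop;;rebuild;;.copy 28 29

/-- The memory holds disjoint cores of balls of radius `j`, `reg 28` many. -/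
def HoldsCores (G : SimpleGraph (Fin n)) (j : ℕ) (s : State) : Prop :=
  ∃ B : ℕ → Set (Fin n), IsCoreFamily G j (s.reg 28) B Set.univ ∧ HoldsLists s (s.reg 28) B ∧
    s.reg 28 ≤ n ∧ ∀ i i', 1 ≤ i → i ≤ s.reg 28 → 1 ≤ i' → i' ≤ s.reg 28 → ∀ x ∈ B i, x ∈ B i' →
      i = i'

theorem runs_round {s : State} {j : ℕ} (hL : IsAdjacencyLists G off adj) (hH : IsHellyGraph G)
    (hG : G.Connected) (hE : Env n off adj s) (hs : HoldsCores G j s) :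
    Runs round s fun s' t => HoldsCores G (j + 1) s' ∧ t ≤ 66 * n + 32 * off n + 10 := by
  obtain ⟨B, hB, hlist, hqn, hd⟩ := hs
  refine (runs_classLoop hL hH hG hE rfl hqn hB hlist hd).seq ?_
  rintro s₁ t₁ hf₁ ⟨h29, hfam, ht₁⟩
  have hE₁ := hE.frame hf₁ (by decide) (by decide) (by decide) (by decide) (by decide)
  refine (runs_rebuild hE₁.1 hE₁.2).seq ?_
  rintro s₂ t₂ hf₂ ⟨hl₂, ht₂⟩
  rw [runs_copy]
  have e29 : s₂.reg 29 = s₁.reg 29 := hf₂.1 29 (by decide)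
  refine ⟨⟨coreOf n s₁.arr, ?_, ?_, ?_, ?_⟩, by omega⟩
  · simpa [e29] using hfam
  · simp only [setReg_reg, if_true, e29]
    exact fun i h1 h2 => hl₂ i h1 (by omega)
  · simp [e29]; omega
  · intro i i' _ _ _ _ x hx hx'
    exact hx.1.symm.trans hx'.1

/-- Make every vertex a core of its own. -/
def coresInit : Prog :=
  .forUp 21 0 (.succ 15 21;;.store 8 15 15;;.store 9 21 3);;.copy 28 0

theorem runs_coresInit {s : State} (hG : G.Connected) (h0 : s.reg 0 = n) (h3 : s.reg 3 = 0) :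
    Runs coresInit s fun s' t => HoldsCores G 0 s' ∧ t ≤ 5 * n + 3 := by
  refine (runs_forUp (N := n) (fun k s' e => (∀ i < k, s'.arr 8 (i + 1) = i + 1 ∧ s'.arr 9 i = 0) ∧
    e ≤ 1 + 5 * k) h0 (by decide) (by decide) ?_ ?_).seq ?_
  · simp
  · rintro k s' e hk h21 hf ⟨hI, he⟩
    have h3' : s'.reg 3 = 0 := by rw [hf.1 3 (by decide), h3]
    simp only [runs_seq, runs_succ, runs_store]
    simp [h21, h3']
    refine ⟨fun i hi => ?_, by omega⟩
    rcases hi.lt_or_eq with h | rfl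
    · rw [Function.update_apply, Function.update_apply, if_neg (by omega), if_neg (by omega)]
      exact hI i h
    · simp
  · rintro s₁ t₁ hf₁ ⟨e, rfl, hI, he⟩
    rw [runs_copy, hf₁.1 0 (by decide), h0]
    -- Core number `i + 1` is the vertex `i`, which is its own ball of radius `0`.
    refine ⟨⟨fun i => {x | (x : ℕ) + 1 = i}, ⟨fun i => {x | (x : ℕ) + 1 = i}, ?_, ?_⟩, ?_, ?_, ?_⟩,
      by omega⟩
    · intro v _
      have hv := v.2
      exact ⟨v + 1, by omega, by simp, rfl⟩
    · intro i h1 h2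
      simp at h2
      refine ⟨?_, ⟨i - 1, by omega⟩, by simp; omega⟩
      ext x
      simp only [Set.mem_ofPred_eq, Nat.le_zero, hG.dist_eq_zero_iff]
      constructor
      · intro hx a ha
        exact Fin.ext (by omega)
      · intro hx
        have := hx ⟨i - 1, by omega⟩ (by simp; omega)
        rw [this]
        simp; omega
    · intro i h1 h2
      simp at h2
      obtain ⟨h4, h5⟩ := hI (i - 1) (by omega)
      rw [Nat.sub_add_cancel h1] at h4
      refine ⟨[⟨i - 1, by omega⟩], ⟨?_, ?_⟩, by simp, fun y => ?_⟩
      · simp [h4]; omega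
      · simpa [IsList] using h5
      · simp only [List.mem_singleton, Set.mem_ofPred_eq, Fin.ext_iff]
        omega
    · simp
    · rintro i i' _ _ _ _ x rfl rfl
      rfl

/-- Do `reg 6` rounds, or fewer if a single core remains. -/
def rounds : Prog := coresInit;;.forUp 38 6 (.ite (.eq 28 4) .skip round)

/-- More than one core at radius `j` means that the radius of the graph exceeds `j`, and a single
core consists of the vertices of eccentricity at most `j`. So either the first single core is the
center, or `J` rounds certify a radius above `J`. -/
theorem runs_rounds {s : State} {J : ℕ} (hL : IsAdjacencyLists G off adj) (hH : IsHellyGraph G)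
    (hG : G.Connected) (hE : Env n off adj s) (h6 : s.reg 6 = J) :
    Runs rounds s fun s' t => (∃ l : List (Fin n), IsList (s'.arr 9) (s'.arr 8 1) l ∧ l.Nodup ∧
        (∃ z, z ∈ l) ∧
        ((∃ r, {x | x ∈ l} = {x | vertexEcc G x ≤ r} ∧ ∀ x, r ≤ vertexEcc G x) ∨
          ∀ x, J < vertexEcc G x)) ∧
      t ≤ 80 * (J + 1) * (n + off n) := by
  obtain ⟨x₀⟩ := hG.nonempty
  have hn : 0 < n := x₀.pos
  refine (runs_coresInit hG hE.1 hE.2).seq ?_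
  rintro s₁ t₁ hf₁ ⟨hc₁, ht₁⟩
  have hE₁ := hE.frame hf₁ (by decide) (by decide) (by decide) (by decide) (by decide)
  have key : ∀ {j : ℕ} {s' : State}, HoldsCores G j s' → s'.reg 28 ≠ 1 →
      ∀ x, j + 1 ≤ vertexEcc G x := by
    rintro j s' ⟨B, hB, hlist, hqn, hd⟩ h28 x
    by_contra hlt
    exact h28 (hB.eq_one (c := x) (by omega) hd)
  -- Here `j` is the current radius of the balls. It stops growing once one core is left, and it
  -- never exceeds the radius of the graph.
  refine (runs_forUp (N := J) (fun k s' e => ∃ j, HoldsCores G j s' ∧ (j = k ∨ s'.reg 28 = 1) ∧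
    (∀ x, j ≤ vertexEcc G x) ∧ e ≤ 1 + (66 * n + 32 * off n + 13) * k) ?_ (by decide)
    (by decide) ?_ ?_).mono ?_
  · rw [hf₁.1 6 (by decide), h6]
  · exact ⟨0, by simpa [HoldsCores, HoldsLists] using hc₁, Or.inl rfl, by simp, by simp⟩
  · rintro k s' e hk h38 hf ⟨j, hc, hj, hmin, he⟩
    have hE' := hE₁.frame hf (by decide) (by decide) (by decide) (by decide) (by decide)
    rw [runs_ite, runs_skip]
    have hmul : (66 * n + 32 * off n + 13) * (k + 1) =
      (66 * n + 32 * off n + 13) * k + (66 * n + 32 * off n + 13) := Nat.mul_succ _ _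
    constructor
    · intro hb
      simp [Test.Holds, hE'.3] at hb
      refine ⟨j, by simpa [HoldsCores, HoldsLists] using hc, Or.inr (by simp [hb]), hmin, by omega⟩
    · intro hb
      simp [Test.Holds, hE'.3] at hb
      refine (runs_round hL hH hG hE' hc).mono ?_
      rintro s₂ t₂ - ⟨hc₂, ht₂⟩
      have hjk : j = k := hj.resolve_right hb
      exact ⟨j + 1, by simpa [HoldsCores, HoldsLists] using hc₂, Or.inl (by omega), key hc hb,
        by omega⟩
  · rintro s' t - ⟨e, rfl, j, hc, hj, hmin, he⟩
    have hc' := hc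
    obtain ⟨B, hB, hlist, hqn, hd⟩ := hc'
    have : Nonempty (Fin n) := ⟨x₀⟩
    have hpos := hB.pos
    obtain ⟨l, hl, hnd, hlB⟩ := hlist 1 le_rfl hpos
    refine ⟨⟨l, hl, hnd, ?_, ?_⟩, ?_⟩
    · obtain ⟨A, -, hA⟩ := hB
      obtain ⟨z, hz⟩ := (hA 1 le_rfl hpos).2
      exact ⟨z, (hlB z).2 hz⟩
    · by_cases h28 : s'.reg 28 = 1
      · rw [h28] at hB
        exact Or.inl ⟨j, by rw [← hB.eq_of_one]; exact Set.ext hlB, hmin⟩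
      · have hjJ : j = J := hj.resolve_right h28
        exact Or.inr fun x => by have := key hc h28 x; omega
    · nlinarith [Nat.zero_le (off n), Nat.zero_le (J * off n), Nat.mul_le_mul_left J hn]

/-- Breadth-first search from the vertices of the first core. -/
def coreBfs : Prog :=
  clear 2;;.const 10 0;;.load 32 8 4;;
  .loop (.ne 32 3)
    (.pred 33 32;;.store 2 33 4;;.store 3 10 33;;.succ 10 10;;.load 32 9 33);;
  bfsLoop 2

/-- The queue (array `3`) holds the elements of `S`, which have the label `1` in the
array `2`. -/
structure HoldsSources (S : Set (Fin n)) (s : State) : Prop where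
  mem : ∀ i < s.reg 10, ∃ z ∈ S, s.arr 3 i = (z : Fin n)
  inj : ∀ i < s.reg 10, ∀ j < s.reg 10, s.arr 3 i = s.arr 3 j → i = j
  exists_eq : ∀ z ∈ S, ∃ i < s.reg 10, s.arr 3 i = (z : Fin n)
  lab : ∀ z : Fin n, (z ∈ S → s.arr 2 z = 1) ∧ (z ∉ S → s.arr 2 z = 0)

theorem runs_coreBfs_loop (l : List (Fin n)) :
    ∀ {s : State} {S : Set (Fin n)}, Env n off adj s → IsList (s.arr 9) (s.reg 32) l → l.Nodup →
      (∀ z ∈ l, z ∉ S) → HoldsSources S s →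
      Runs (.loop (.ne 32 3)
          (.pred 33 32;;.store 2 33 4;;.store 3 10 33;;.succ 10 10;;.load 32 9 33)) s
        fun s' t => HoldsSources (S ∪ {z | z ∈ l}) s' ∧ t ≤ 1 + 6 * l.length := by
  induction l with
  | nil =>
    intro s S hE hl _ _ hS
    refine runs_loop_unfold (fun hb => absurd hb ?_) fun _ => ⟨by simpa using hS, by simp⟩
    have : s.reg 32 = 0 := hl
    simp [Test.Holds, this, hE.2]
  | cons z l ih =>
    rintro s S hE ⟨h32, hl⟩ hnd hlS hS
    refine runs_loop_unfold (fun _ => ?_) fun hb => absurd ?_ hb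
    swap
    · simp [Test.Holds, h32, hE.2]
    have hz : z ∉ S := hlS z (by simp)
    have hQz : ∀ i < s.reg 10, s.arr 3 i ≠ z := by
      intro i hi h
      obtain ⟨w, hw, hw'⟩ := hS.mem i hi
      rw [h] at hw'
      exact hz (by rwa [Fin.ext hw'])
    simp only [runs_seq, runs_pred, runs_store, runs_succ, runs_load]
    refine (ih (S := insert z S) ⟨by simp [hE.1], by simp [hE.2], by simp [hE.3], by simp [hE.4],
      by simp [hE.5]⟩ (by simpa [h32] using hl) (List.nodup_cons.1 hnd).2 ?_ ?_).mono ?_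
    · rintro w hw (rfl | hwS)
      · exact (List.nodup_cons.1 hnd).1 hw
      · exact hlS w (by simp [hw]) hwS
    · simp [h32, hE.3]
      refine ⟨?_, ?_, ?_, ?_⟩
      · simp
        intro i hi
        rcases Nat.lt_succ_iff_lt_or_eq.1 (Nat.lt_succ_of_le hi) with h | rfl
        · obtain ⟨w, hw, hw'⟩ := hS.mem i h
          exact Or.inr ⟨w, hw, by rw [Function.update_apply, if_neg (by omega), hw']⟩
        · exact Or.inl (by simp)
      · simp
        intro i hi j hj hij
        rcases hi.lt_or_eq with h | rfl <;> rcases hj.lt_or_eq with h' | rfl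
        · rw [Function.update_apply, Function.update_apply, if_neg (by omega),
            if_neg (by omega)] at hij
          exact hS.inj i h j h' hij
        · rw [Function.update_apply, if_neg (by omega), Function.update_self] at hij
          exact absurd hij (hQz i h)
        · rw [Function.update_self, Function.update_apply, if_neg (by omega)] at hij
          exact absurd hij.symm (hQz j h')
        · rfl
      · simp
        refine ⟨⟨s.reg 10, le_rfl, by simp⟩, fun w hw => ?_⟩
        obtain ⟨i, hi, h⟩ := hS.exists_eq w hw
        exact ⟨i, hi.le, by rw [Function.update_apply, if_neg (by omega), h]⟩
      · intro w
        simp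
        by_cases hwz : w = z
        · subst hwz
          simp
        · have hwz' : (w : ℕ) ≠ z := fun h => hwz (Fin.ext h)
          have := hS.lab w
          simpa [hwz, hwz'] using this
    · rintro s' t - ⟨hS', ht⟩
      refine ⟨?_, by simp; omega⟩
      convert hS' using 1
      ext w
      simp only [Set.mem_union, Set.mem_ofPred_eq, List.mem_cons, Set.mem_insert_iff]
      tauto

theorem runs_coreBfs {s : State} {l : List (Fin n)} (hL : IsAdjacencyLists G off adj)
    (hG : G.Connected) (hE : Env n off adj s) (hl : IsList (s.arr 9) (s.arr 8 1) l)
    (hnd : l.Nodup) (hne : ∃ z, z ∈ l) :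
    Runs coreBfs s fun s' t => (∃ v : Fin n, s'.reg 18 = v ∧
        ∀ x, setDist G {z | z ∈ l} x ≤ setDist G {z | z ∈ l} v) ∧
      t ≤ 40 * (n + off n) := by
  have hn : 0 < n := hne.choose.pos
  have hS : {z | z ∈ l}.Nonempty := hne
  refine (runs_clear hE.1 hE.2).seq ?_
  rintro s₁ t₁ hf₁ ⟨hc, rfl⟩
  have hE₁ := hE.frame hf₁ (by decide) (by decide) (by decide) (by decide) (by decide)
  have e8 : s₁.arr 8 = s.arr 8 := hf₁.2 8 (by decide)
  have e9 : s₁.arr 9 = s.arr 9 := hf₁.2 9 (by decide)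
  rw [runs_seq, runs_const, runs_seq, runs_load]
  have hE₂ : Env n off adj ((s₁.setReg 10 0).setReg 32 ((s₁.setReg 10 0).arr 8
    ((s₁.setReg 10 0).reg 4))) :=
    ⟨by simp [hE₁.1], by simp [hE₁.2], by simp [hE₁.3], by simp [hE₁.4], by simp [hE₁.5]⟩
  refine (runs_coreBfs_loop l (S := ∅) hE₂ (by simpa [e8, e9, hE₁.3] using hl) hnd (by simp)
    ⟨by simp, by simp, by simp, fun z => by simp [hc]⟩).seq ?_
  rintro s₃ t₃ hf₃ ⟨hS₃, ht₃⟩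
  rw [Set.empty_union] at hS₃
  have hE₃ := hE₂.frame hf₃ (by decide) (by decide) (by decide) (by decide) (by decide)
  have hlen : l.length ≤ n := by
    simpa using hnd.length_le_card
  have hpos : 0 < s₃.reg 10 := by
    obtain ⟨z, hz⟩ := hne
    obtain ⟨i, hi, -⟩ := hS₃.exists_eq z hz
    omega
  have hz : ∀ v : Fin n, levelOf G {z | z ∈ l} v = 0 ↔ v ∈ l := fun v => by
    rw [levelOf_val]; exact setDist_eq_zero_iff hG hS
  refine (runs_bfsLoop (lam := 1) hE₃ hL.adjArrays (hL.isLevel hG hS) (by decide)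
    (by decide) (by decide) rfl (BfsInv.init Nat.one_pos hpos ?_ ?_ hS₃.inj ?_ ?_)).mono ?_
  · intro i hi
    obtain ⟨z, -, h⟩ := hS₃.mem i hi
    rw [h]; exact z.2
  · intro i hi
    obtain ⟨z, hz', h⟩ := hS₃.mem i hi
    rw [h]; exact (hz z).2 hz'
  · intro v hv h0
    exact hS₃.exists_eq ⟨v, hv⟩ ((hz ⟨v, hv⟩).1 h0)
  · intro v hv
    have h1 := hS₃.lab ⟨v, hv⟩
    by_cases hvl : (⟨v, hv⟩ : Fin n) ∈ l
    · rw [if_pos ((hz ⟨v, hv⟩).2 hvl)]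
      exact h1.1 hvl
    · rw [if_neg fun h => hvl ((hz ⟨v, hv⟩).1 h)]
      exact h1.2 hvl
  · rintro s' t - ⟨⟨-, h2, h3, -⟩, ht⟩
    refine ⟨⟨⟨_, h2⟩, rfl, fun x => ?_⟩, by omega⟩
    have := h3 x x.2
    rwa [levelOf_val, show s'.reg 18 = ((⟨s'.reg 18, h2⟩ : Fin n) : ℕ) from rfl, levelOf_val] at this

end RandRAM

/-! ### The complete algorithm -/

namespace RandRAM

variable {n : ℕ} {G : SimpleGraph (Fin n)} {off adj : ℕ → ℕ}

/-- An algorithm for a diametral pair of a Helly graph. It tries two vertices: the second one is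
good if the radius is small, and the first one is good otherwise. -/
def diametralPair : Prog :=
  root;;net;;layers;;.copy 8 26;;tryVertex;;rounds;;coreBfs;;.copy 8 18;;tryVertex;;
  .copy 0 40;;.copy 1 41;;.pred 2 42

theorem HoldsPair.of_frame {P : Prog} {s s' : State} (hf : Frame P s s') (h : HoldsPair G s)
    (h40 : 40 ∉ P.regs) (h41 : 41 ∉ P.regs) (h42 : 42 ∉ P.regs) : HoldsPair G s' := by
  obtain ⟨u, v, e1, e2, e3⟩ := h
  exact ⟨u, v, by rw [hf.1 _ h40, e1], by rw [hf.1 _ h41, e2], by rw [hf.1 _ h42, e3]⟩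

theorem Env.setReg {s : State} (h : Env n off adj s) {x k : ℕ} (h0 : 0 ≠ x) (h3 : 3 ≠ x)
    (h4 : 4 ≠ x) : Env n off adj (s.setReg x k) :=
  ⟨by simp [h.1, h0], by simp [h.2, h3], by simp [h.3, h4], by simp [h.4], by simp [h.5]⟩

set_option maxHeartbeats 2000000 in
theorem runs_diametralPair (hL : IsAdjacencyLists G off adj) (hH : IsHellyGraph G)
    (hG : G.Connected) (ω : ℕ → Bool) :
    Runs diametralPair (initialState n off adj ω) fun s' t => s'.HoldsDiametralPair G ∧
      ∃ L, 1 ≤ L ∧ L * (L - 1) ≤ 2 * n ∧ t ≤ 700 * (L + 1) * (n + off n) := by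
  have : Nonempty (Fin n) := hG.nonempty
  obtain ⟨x₀⟩ := this
  have hn : 0 < n := x₀.pos
  set s := initialState n off adj ω with hs
  have hr : ∀ x, x ≠ 0 → s.reg x = 0 := fun x hx => by simp [hs, initialState, hx]
  have ha : ∀ a i, a ≠ 0 → a ≠ 1 → s.arr a i = 0 := fun a i h h' => by
    simp [hs, initialState, h, h']
  refine (runs_root (n := n) (by simp [hs, initialState])).seq ?_
  rintro s₁ t₁ hf₁ ⟨L, h4, h5, h6, hL1, hLn, hLn', ht₁⟩
  have hE₁ : Env n off adj s₁ := by
    refine ⟨?_, ?_, h4, ?_, ?_⟩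
    · rw [hf₁.1 0 (by decide)]; simp [hs, initialState]
    · rw [hf₁.1 3 (by decide), hr 3 (by decide)]
    · rw [hf₁.2 0 (by decide)]; simp [hs, initialState]
    · rw [hf₁.2 1 (by decide)]; simp [hs, initialState]
  refine (runs_net hL hG hE₁ h5 hn hL1 hLn'
    (by rw [hf₁.1 20 (by decide), hr 20 (by decide)])
    (fun v => by rw [hf₁.2 4 (by decide), ha 4 v (by decide) (by decide)])).seq ?_
  rintro s₂ t₂ hf₂ ⟨⟨z, h19, hz⟩, ht₂⟩
  have hE₂ := hE₁.frame hf₂ (by decide) (by decide) (by decide) (by decide) (by decide)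
  have hL2n : L ≤ 2 * n := by
    rcases Nat.lt_or_ge 1 L with h | h
    · have := Nat.mul_le_mul_left L (show 1 ≤ L - 1 by omega)
      omega
    · omega
  refine (runs_layers (z := z) (L := L) hL hG hE₂ (by rw [hf₂.1 5 (by decide), h5]) (by nlinarith)
    h19 (fun i => by rw [hf₂.2 6 (by decide), hf₁.2 6 (by decide), ha 6 i (by decide) (by decide)])
    (fun i => by rw [hf₂.2 7 (by decide), hf₁.2 7 (by decide), ha 7 i (by decide) (by decide)])
    hL2n).seq ?_
  rintro s₃ t₃ hf₃ ⟨⟨y, j, h26, hj₁, hj₂, hy⟩, ht₃⟩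
  have hE₃ := hE₂.frame hf₃ (by decide) (by decide) (by decide) (by decide) (by decide)
  have h42 : s₃.reg 42 = 0 := by
    rw [hf₃.1 42 (by decide), hf₂.1 42 (by decide), hf₁.1 42 (by decide), hr 42 (by decide)]
  have h6₃ : s₃.reg 6 = 3 * L + 2 := by
    rw [hf₃.1 6 (by decide), hf₂.1 6 (by decide), h6]
  rw [runs_seq, runs_copy]
  refine (runs_tryVertex (u := y) hL hG (hE₃.setReg (by decide) (by decide) (by decide))
    (by simp [h26]) (Or.inl (by simp [h42]))).seq ?_
  rintro s₄ t₄ hf₄ ⟨hp₄, -, hecc₄, ht₄⟩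
  have hE₄ := (hE₃.setReg (x := 8) (k := s₃.reg 26) (by decide) (by decide) (by decide)).frame hf₄
    (by decide) (by decide) (by decide) (by decide) (by decide)
  refine (runs_rounds (J := 3 * L + 2) hL hH hG hE₄
    (by rw [hf₄.1 6 (by decide)]; simp [h6₃])).seq ?_
  rintro s₅ t₅ hf₅ ⟨⟨l, hl, hnd, hne, hcase⟩, ht₅⟩
  have hE₅ := hE₄.frame hf₅ (by decide) (by decide) (by decide) (by decide) (by decide)
  refine (runs_coreBfs hL hG hE₅ hl hnd hne).seq ?_
  rintro s₆ t₆ hf₆ ⟨⟨v, h18, hv⟩, ht₆⟩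
  have hE₆ := hE₅.frame hf₆ (by decide) (by decide) (by decide) (by decide) (by decide)
  have hp₆ : HoldsPair G s₆ := (hp₄.of_frame hf₅ (by decide) (by decide) (by decide)).of_frame hf₆
    (by decide) (by decide) (by decide)
  have e42 : s₆.reg 42 = s₄.reg 42 := by rw [hf₆.1 42 (by decide), hf₅.1 42 (by decide)]
  rw [runs_seq, runs_copy]
  refine (runs_tryVertex (u := v) hL hG (hE₆.setReg (by decide) (by decide) (by decide))
    (by simp [h18]) (Or.inr (by simpa [HoldsPair] using hp₆))).seq ?_
  rintro s₇ t₇ hf₇ ⟨⟨a, b, e40, e41, e42'⟩, hle₇, hecc₇, ht₇⟩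
  simp only [runs_seq, runs_copy, runs_pred]
  -- If the rounds found the center, the vertex `v` farthest from it is good. Otherwise the radius
  -- is at least `3 L + 3` and the vertex `y` from the layers is good.
  have hmax : ∀ p q, G.dist p q ≤ G.dist a b := by
    intro p q
    simp at hle₇
    rcases hcase with ⟨r, hlr, hrmin⟩ | hbig
    · rw [hlr] at hv
      have hner : {x | vertexEcc G x ≤ r}.Nonempty := by rw [← hlr]; exact hne
      have := hH.dist_le_vertexEcc_of_center hG hner hrmin hv p q
      omega
    · have : Nonempty (Fin n) := ⟨x₀⟩
      -- The net vertex `x` near a central vertex `c` has eccentricity at most `r + L`, and `z` is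
      -- no worse.
      obtain ⟨c, hc⟩ := Finite.exists_min (vertexEcc G)
      obtain ⟨x, hxc, hzx⟩ := hz c
      have hxe : vertexEcc G x ≤ vertexEcc G c + L := vertexEcc_le_iff.2 fun w => by
        have h1 := hG.dist_triangle (u := x) (v := c) (w := w)
        have h2 := dist_le_vertexEcc (G := G) c w
        omega
      have := hH.dist_le_vertexEcc_of_layer hG (r := vertexEcc G c) ⟨c, le_refl (vertexEcc G c)⟩ hc
        (hzx.trans hxe) (by have := hbig c; omega) hj₁ hj₂ hy p q
      omega
  have hdiam : G.dist a b = G.diam := by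
    have : Nonempty (Fin n) := ⟨x₀⟩
    obtain ⟨p, q, hpq⟩ := G.exists_dist_eq_diam
    exact le_antisymm (SimpleGraph.dist_le_diam (SimpleGraph.connected_iff_ediam_ne_top.1 hG))
      (hpq ▸ hmax p q)
  refine ⟨⟨⟨a, b, by simp [e40], by simp [e41], hdiam⟩, by simp [e42', hdiam]⟩, L, hL1, hLn, ?_⟩
  have h1 : n ≤ L * n := Nat.le_mul_of_pos_left n hL1
  have h2 : off n ≤ L * off n := Nat.le_mul_of_pos_left _ hL1
  nlinarith

end RandRAM

theorem theorem2p7 (c : ℕ) :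
    ∃ (P : RandRAM.Prog) (C : ℝ) (d : ℕ),
      ∀ (n : ℕ) (G : SimpleGraph (Fin n)), G.Connected → IsHellyGraph G →
        ∀ off adj : ℕ → ℕ, RandRAM.IsAdjacencyLists G off adj →
          1 - 1 / (n : ℝ) ^ c ≤
            RandRAM.coinMeasure.real
              {ω : ℕ → Bool | ∃ (t : ℕ) (s : RandRAM.State),
                RandRAM.Exec P (RandRAM.initialState n off adj ω) t s ∧
                (t : ℝ) ≤ C * (G.edgeSet.ncard : ℝ) * √(n : ℝ) * Real.log (n : ℝ) ^ d ∧
                s.HoldsDiametralPair G} := by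
  refine ⟨RandRAM.diametralPair, 11200, 0, fun n G hG hH off adj hL => ?_⟩
  have : Nonempty (Fin n) := hG.nonempty
  obtain ⟨x₀⟩ := this
  -- For `n = 1` there are no edges and the time bound is zero, but the required probability `1 - 1
  -- / 1 ^ c` is zero too.
  rcases (show n = 1 ∨ 2 ≤ n by have := x₀.pos; omega) with rfl | hn
  · simp
  have hprob : MeasureTheory.IsProbabilityMeasure RandRAM.coinMeasure := by
    unfold RandRAM.coinMeasure
    infer_instance
  suffices h : {ω : ℕ → Bool | ∃ (t : ℕ) (s : RandRAM.State),
      RandRAM.Exec RandRAM.diametralPair (RandRAM.initialState n off adj ω) t s ∧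
      (t : ℝ) ≤ 11200 * (G.edgeSet.ncard : ℝ) * √(n : ℝ) * Real.log (n : ℝ) ^ 0 ∧
      s.HoldsDiametralPair G} = Set.univ by
    rw [h, MeasureTheory.probReal_univ, sub_le_self_iff]
    positivity
  refine Set.eq_univ_of_forall fun ω => ?_
  obtain ⟨t, s, hexec, hpair, L, hL1, hLn, ht⟩ := RandRAM.runs_diametralPair hL hH hG ω
  refine ⟨t, s, hexec, ?_, hpair⟩
  have hm : n ≤ G.edgeSet.ncard + 1 := by
    have := hG.card_vert_le_card_edgeSet_add_one
    simpa [Nat.card_coe_set_eq] using this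
  rw [hL.off_eq] at ht
  -- Connectedness and `2 ≤ n` give `n ≤ m + 1 ≤ 2 m`.
  have hsize : n + 2 * G.edgeSet.ncard ≤ 4 * G.edgeSet.ncard := by omega
  have ht' : t ≤ 700 * (L + 1) * (4 * G.edgeSet.ncard) :=
    ht.trans (Nat.mul_le_mul_left _ hsize)
  -- Since `L (L - 1) ≤ 2 n` and `√n ≥ 1`. The constant `11200` is `700 * 4 * 4`.
  have hroot : (L : ℝ) + 1 ≤ 4 * √(n : ℝ) := by
    have hn1 : (1 : ℝ) ≤ √(n : ℝ) := by
      rw [Real.one_le_sqrt]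
      exact_mod_cast (by omega : 1 ≤ n)
    have hsq : √(n : ℝ) * √(n : ℝ) = n := Real.mul_self_sqrt (Nat.cast_nonneg n)
    have hLn' : (L : ℝ) * (L - 1) ≤ 2 * n := by
      have : ((L * (L - 1) : ℕ) : ℝ) ≤ ((2 * n : ℕ) : ℝ) := Nat.cast_le.2 hLn
      push_cast [Nat.cast_sub hL1] at this
      exact this
    have hL1' : (1 : ℝ) ≤ L := by exact_mod_cast hL1
    by_contra! hlt
    nlinarith
  calc (t : ℝ) ≤ ((700 * (L + 1) * (4 * G.edgeSet.ncard) : ℕ) : ℝ) := Nat.cast_le.2 ht'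
    _ = 2800 * G.edgeSet.ncard * ((L : ℝ) + 1) := by push_cast; ring
    _ ≤ 2800 * G.edgeSet.ncard * (4 * √(n : ℝ)) := by gcongr
    _ = 11200 * (G.edgeSet.ncard : ℝ) * √(n : ℝ) * Real.log (n : ℝ) ^ 0 := by ring
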